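/- **Notation.** Let $r:\mathbb Z\to\mathbb C$ be a function, and let $\mathbf t=(t_1,0,t_3,0,t_5,\dots)$, $\mathbf t^*=(t_1^*,0,t_3^*,0,t_5^*,\dots)$, where $t_m,t^*_m$ ($m$ odd) are independent formal variables. All identities are identities of formal power series in these variables. *Neutral fermions.* Let $\phi_n$, $n\in\mathbb Z$, satisfy $\phi_m\phi_n+\phi_n\phi_m=(-1)^m\delta_{m,-n}$ and act on the Fock space with basis $\phi_{n_1}\cdots\phi_{n_k}|0\rangle$, $n_1>\dots>n_k\ge0$, where $\phi_m|0\rangle=0$ for $m<0$ and $\langle 0|\phi_m=0$ for $m>0$, $\langle0|0\rangle=1$, $\langle 0|\phi_0|0\rangle=0$. For odd $k\geq 1$ put $H_k=\frac12\sum_{n\in\mathbb Z}(-1)^{n+1}\phi_n\phi_{-n-k}$ and $B_k=\frac12\sum_{n\in\mathbb Z}(-1)^n r(n)r(n-1)\cdots r(n-k+1)\,\phi_n\phi_{k-n}$. The BKP hypergeometric tau function is $$\tau_r(\mathbf t,\mathbf t^*)=\langle 0|\,e^{\sum_{k\ \mathrm{odd}}t_kH_k}\,e^{-\sum_{k\ \mathrm{odd}}t_k^*B_k}\,|0\rangle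 .$$ *Charged fermions.* Let $\psi_n,\psi_n^*$, $n\in\mathbb Z$, satisfy $\psi_m\psi^*_n+\psi^*_n\psi_m=\delta_{m,n}$, $\psi_m\psi_n+\psi_n\psi_m=\psi^*_m\psi^*_n+\psi^*_n\psi^*_m=0$, with $\psi_n|0\rangle=0$ for $n<0$, $\psi^*_n|0\rangle=0$ for $n\ge 0$, let $|n\rangle$ be the vacuum of charge $n$ (so that $|n\rangle=\psi_{n-1}\cdots\psi_0|0\rangle$ for $n\geq 0$), and for $k\ge1$ put $H^{KP}_k=\sum_{n}\psi_n\psi^*_{n+k}$, $A_k=\sum_n r(n)r(n-1)\cdots r(n-k+1)\,\psi^*_{n-k}\psi_n$. The KP hypergeometric tau function is $$\tau_r^{KP}(n,\mathbf t,\mathbf t^*)=\langle n|\,e^{\sum_{k\ge1}t_kH^{KP}_k}\,e^{-\sum_{k\ge1}t_k^*A_k}\,|n\rangle .$$ *Symmetric functions.* Let $\sum_k z^kh_k(\mathbf t)=\exp\sum_{m\ge1}z^mt_m$, with $h_k=0$ for $k<0$. For a partition $\lambda=(n_1,\dots,n_l)$ with $l=l(\lambda)$ positive parts, $s_\lambda(\mathbf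 t)=\det\big(h_{n_i-i+j}(\mathbf t)\big)_{i,j=1}^{l}$. Let $\sum_kz^kq_k(\mathbf t)=\exp\big(2\sum_{m\ \mathrm{odd}}z^mt_m\big)$ and $Q_{(a,b)}=q_aq_b+2\sum_{i=1}^b(-1)^iq_{a+i}q_{b-i}$. For a partition $\lambda$ with distinct parts, $Q_\lambda$ is the Schur $Q$-function, i.e. the Pfaffian of the skew-symmetric matrix whose entries above the diagonal are the $Q_{(n_i,n_j)}$, $i<j$ (a part $0$ being added to $\lambda$ if $l(\lambda)$ is odd). Put $$r_\lambda=\prod_{i=1}^{l(\lambda)}r(1)r(2)\cdots r(n_i),\qquad r^{KP}_\lambda(0)=\prod_{(i,j)\in\lambda}r(j-i),$$ the second product being over the nodes of the Young diagram of $\lambda$ ($i$ is the row, $j$ the column). **Statement.** If $r(n)=r(1-n)$ for all $n\in\mathbb Z$, then $$\tau^{KP}_r(0,\mathbf t,\mathbf t^*)=\tau_r(\mathbf t,\mathbf t^*)^2,$$ and $$\Big(1+\sum_{\lambda\in DP}2^{-l(\lambda)}r_\lambda\,Q_\lambda\big(\tfrac{\mathbf t}{2}\big)Q_\lambda\big(\tfrac{\mathbf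 t^*}{2}\big)\Big)^2=1+\sum_{\lambda\in P}r^{KP}_\lambda(0)\,s_\lambda(\mathbf t)s_\lambda(\mathbf t^*),$$ where the sum on the left is over all nonzero partitions with distinct parts, the sum on the right is over all nonzero partitions, and both sums converge coefficientwise. -/

import Mathlib

open scoped MvPowerSeries.WithPiTopology

noncomputable section

namespace HypTau

/-! ### Fermionic Fock spaces

`Fock ι` has a basis indexed by the finite subsets of a linearly ordered set `ι` of modes;
the subset `{i₁ > i₂ > ... > iₖ}` stands for `c(i₁) c(i₂) ⋯ c(iₖ) |0⟩`, with `c(i)` the creation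
operator of the mode `i`. -/

/-- The algebraic Fock space on a set `ι` of modes. -/
abbrev Fock (ι : Type) : Type := Finset ι →₀ ℂ

/-- The basis vector with set `S` of excited modes; the vacuum is `ket ∅`. -/
def ket {ι : Type} (S : Finset ι) : Fock ι := Finsupp.single S 1

section Modes

variable {ι : Type} [LinearOrder ι]

/-- The sign picked up when an operator of mode `i` moves past the excited modes above `i`. -/
def wedgeSign (i : ι) (S : Finset ι) : ℂ := (-1) ^ (S.filter (fun j => i < j)).card

/-- Creation of the mode `i`. -/
def create (i : ι) : Module.End ℂ (Fock ι) :=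
  Finsupp.linearCombination ℂ fun S =>
    if i ∈ S then 0 else wedgeSign i S • ket (insert i S)

/-- Annihilation of the mode `i`. -/
def annihilate (i : ι) : Module.End ℂ (Fock ι) :=
  Finsupp.linearCombination ℂ fun S =>
    if i ∈ S then wedgeSign i S • ket (S.erase i) else 0

end Modes

/-- The operator `∑_{k ∈ ℤ} A k`. It is used only for families such that every basis vector is
killed by all but finitely many of the `A k`. -/
def sumOp {ι : Type} (A : ℤ → Module.End ℂ (Fock ι)) : Module.End ℂ (Fock ι) :=
  Finsupp.linearCombination ℂ fun S => ∑ᶠ k : ℤ, A k (ket S)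

/-- The diagonal matrix element `⟨S| A |S⟩`; for `S = ∅`, the vacuum expectation value of `A`. -/
def expectation {ι : Type} (S : Finset ι) (A : Module.End ℂ (Fock ι)) : ℂ := A (ket S) S

/-- The product `r(n) r(n-1) ⋯ r(n-k+1)`. -/
def rProd (r : ℤ → ℂ) (n : ℤ) (k : ℕ) : ℂ := ∏ j ∈ Finset.range k, r (n - j)

/-! ### Neutral fermions -/

/-- The neutral fermions `φ_n`, `n ∈ ℤ`, on the Fock space with modes `0, 1, 2, …`. They satisfy
`φ_m φ_n + φ_n φ_m = (-1)^m δ_{m,-n}`, `φ_m |0⟩ = 0` for `m < 0`, `⟨0| φ_m = 0` for `m > 0`, and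
`φ_{n₁} ⋯ φ_{nₖ} |0⟩ = ket {n₁, …, nₖ}` for `n₁ > ⋯ > nₖ ≥ 0`. -/
def phi (n : ℤ) : Module.End ℂ (Fock ℕ) :=
  if 0 < n then create n.toNat
  else if n = 0 then create 0 + (2⁻¹ : ℂ) • annihilate 0
  else ((-1 : ℂ) ^ n) • annihilate (-n).toNat

/-- `H_n = ½ ∑_k (-1)^{k+1} φ_k φ_{-k-n}`. -/
def hamB (n : ℤ) : Module.End ℂ (Fock ℕ) :=
  (2⁻¹ : ℂ) • sumOp fun k => ((-1 : ℂ) ^ (k + 1)) • (phi k * phi (-k - n))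

/-- `B_k = ½ ∑_n (-1)^n φ_n φ_{k-n} r(n) r(n-1) ⋯ r(n-k+1)`. -/
def opB (r : ℤ → ℂ) (k : ℕ) : Module.End ℂ (Fock ℕ) :=
  (2⁻¹ : ℂ) • sumOp fun n => ((-1 : ℂ) ^ n * rProd r n k) • (phi n * phi (k - n))

/-! ### Charged fermions -/

/-- The charged fermions `ψ_n`, `n ∈ ℤ`. The vacuum is the state in which exactly the levels
`n < 0` are filled; the modes of the Fock space are the particles at levels `n ≥ 0` and the holes
at levels `n < 0`. One has `ψ_m ψ*_n + ψ*_n ψ_m = δ_{m,n}`, `ψ_n |0⟩ = 0` for `n < 0` and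
`ψ*_n |0⟩ = 0` for `n ≥ 0`. -/
def psi (n : ℤ) : Module.End ℂ (Fock ℤ) := if 0 ≤ n then create n else annihilate n

/-- The adjoint charged fermions `ψ*_n`. -/
def psiStar (n : ℤ) : Module.End ℂ (Fock ℤ) := if 0 ≤ n then annihilate n else create n

/-- `H^{KP}_m = ∑_k ψ_k ψ*_{k+m}`, for `m ≠ 0`. -/
def hamKP (m : ℤ) : Module.End ℂ (Fock ℤ) := sumOp fun k => psi k * psiStar (k + m)

/-- `A_k = ∑_n r(n) r(n-1) ⋯ r(n-k+1) ψ*_{n-k} ψ_n`, for `k ≥ 1`. -/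
def opA (r : ℤ → ℂ) (k : ℕ) : Module.End ℂ (Fock ℤ) :=
  sumOp fun n => rProd r n k • (psiStar (n - k) * psi n)

/-- The excitations of the charge `n` vacuum: `|n⟩ = ψ_{n-1} ⋯ ψ_0 |0⟩` for `n ≥ 0` and
`|n⟩ = ψ*_n ⋯ ψ*_{-1} |0⟩` for `n < 0`, up to a sign which does not affect `⟨n| A |n⟩`. -/
def chargedVacuum (n : ℤ) : Finset ℤ := Finset.Ico 0 n ∪ Finset.Ico n 0

/-! ### Formal power series in the times -/

/-- The formal variables: `Sum.inl m` is `t_m` and `Sum.inr m` is `t*_m`, `m = 1, 2, 3, …`. -/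
abbrev Times : Type := ℕ+ ⊕ ℕ+

/-- The formal linear form `∑_s c_s x_s` with coefficients `c_s` in a ring `R`, possibly
noncommutative. -/
def linForm {σ R : Type} [Ring R] (c : σ → R) : MvPowerSeries σ R :=
  fun m => if m.degree = 1 then ∑ s ∈ m.support, c s else 0

/-- The exponential `∑_k X^k / k!` of a power series `X` without constant term: powers `X^k` with
`k` larger than the degree of a monomial do not contribute to its coefficient. -/
def formalExp {σ R : Type} [Ring R] [Algebra ℂ R] (X : MvPowerSeries σ R) : MvPowerSeries σ R :=
  fun m => ∑ k ∈ Finset.range (m.degree + 1),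
    ((Nat.factorial k : ℂ)⁻¹) • MvPowerSeries.coeff m (X ^ k)

/-- The matrix element `⟨S| X |S⟩` of a power series `X` with operator coefficients. -/
def formalExpectation {ι : Type} (S : Finset ι) (X : MvPowerSeries Times (Module.End ℂ (Fock ι))) :
    MvPowerSeries Times ℂ :=
  fun m => expectation S (MvPowerSeries.coeff m X)

/-- The series `∑_{m ≥ 1} t_m A_m` with operators `A_m`. -/
def flowT {ι : Type} (A : ℕ → Module.End ℂ (Fock ι)) :
    MvPowerSeries Times (Module.End ℂ (Fock ι)) :=
  linForm (Sum.elim (fun m => A m) (fun _ => 0))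

/-- The series `∑_{m ≥ 1} t*_m A_m` with operators `A_m`. -/
def flowTStar {ι : Type} (A : ℕ → Module.End ℂ (Fock ι)) :
    MvPowerSeries Times (Module.End ℂ (Fock ι)) :=
  linForm (Sum.elim (fun _ => 0) (fun m => A m))

/-- The BKP tau function `τ_r(t, t*) = ⟨0| e^{H(t)} e^{-B(t*)} |0⟩`, where
`H(t) = ∑_{m odd} t_m H_m` and `B(t*) = ∑_{m odd} t*_m B_m`. -/
def tauBKP (r : ℤ → ℂ) : MvPowerSeries Times ℂ :=
  formalExpectation ∅
    (formalExp (flowT fun m => if Odd m then hamB m else 0) *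
      formalExp (-flowTStar fun m => if Odd m then opB r m else 0))

/-- The KP tau function of hypergeometric type
`τ^{KP}_r(n, t, t*) = ⟨n| e^{H^{KP}(t)} e^{-A(t*)} |n⟩`, where
`H^{KP}(t) = ∑_{m ≥ 1} t_m H^{KP}_m` and `A(t*) = ∑_{m ≥ 1} t*_m A_m`. -/
def tauKP (r : ℤ → ℂ) (n : ℤ) : MvPowerSeries Times ℂ :=
  formalExpectation (chargedVacuum n)
    (formalExp (flowT fun m => hamKP m) * formalExp (-flowTStar fun m => opA r m))

/-- The specialization `t_{2k} = t*_{2k} = 0` of all times with even numbers. -/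
def restrictOdd (f : MvPowerSeries Times ℂ) : MvPowerSeries Times ℂ :=
  fun m => if ∀ s ∈ m.support, Odd (Sum.elim PNat.val PNat.val s) then
    MvPowerSeries.coeff m f else 0

/-- The times `t = (t_1, 0, t_3, 0, t_5, …)`. -/
def oddT (m : ℕ+) : MvPowerSeries Times ℂ :=
  if Odd (m : ℕ) then MvPowerSeries.X (Sum.inl m) else 0

/-- The times `t* = (t*_1, 0, t*_3, 0, t*_5, …)`. -/
def oddTStar (m : ℕ+) : MvPowerSeries Times ℂ :=
  if Odd (m : ℕ) then MvPowerSeries.X (Sum.inr m) else 0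

/-! ### Schur functions and Schur Q-functions, as functions of the times -/

section Symmetric

variable {R : Type} [CommRing R] [Algebra ℂ R]

/-- `h_k(t)`, where `∑_k z^k h_k(t) = exp (∑_{m ≥ 1} z^m t_m)`. -/
def hSym (t : ℕ+ → R) (k : ℕ) : R :=
  PowerSeries.coeff k
    (formalExp (PowerSeries.mk fun m => if h : 0 < m then t ⟨m, h⟩ else 0) : PowerSeries R)

/-- `h_k(t)` for an integer index, with `h_k = 0` for `k < 0`. -/
def hSymInt (t : ℕ+ → R) (k : ℤ) : R := if 0 ≤ k then hSym t k.toNat else 0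

/-- The Schur function `s_λ(t) = det (h_{n_i - i + j}(t))`, with `i, j` from `1` to `l(λ)`. -/
def schurS (μ : YoungDiagram) (t : ℕ+ → R) : R :=
  Matrix.det (Matrix.of fun i j : Fin (μ.colLen 0) =>
    hSymInt t ((μ.rowLen i : ℤ) - (i : ℤ) + (j : ℤ)))

/-- `q_k(t)`, where `∑_k z^k q_k(t) = exp (2 ∑_{m odd} z^m t_m)`; for `t_m = (1/m) ∑_i x_i^m` the
right-hand side is `∏_i (1 + z x_i) / (1 - z x_i)`. -/
def qSym (t : ℕ+ → R) (k : ℕ) : R :=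
  hSym (fun m => if Odd (m : ℕ) then 2 * t m else 0) k

/-- `Q_{(a,b)} = q_a q_b + 2 ∑_{i=1}^b (-1)^i q_{a+i} q_{b-i}`. -/
def qPair (t : ℕ+ → R) (a b : ℕ) : R :=
  qSym t a * qSym t b +
    2 * ∑ i ∈ Finset.Icc 1 b, (-1) ^ i * (qSym t (a + i) * qSym t (b - i))

/-- The Pfaffian of the skew-symmetric matrix with entries `f (l i) (l j)`, `i < j`, above the
diagonal, by expansion along the first row. -/
def pfaffian (f : ℕ → ℕ → R) : List ℕ → R
  | [] => 1
  | a :: l => ∑ i : Fin l.length, (-1) ^ (i : ℕ) * f a l[i] * pfaffian f (l.eraseIdx i)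
termination_by l => l.length
decreasing_by
  have := i.isLt
  simp only [List.length_eraseIdx, List.length_cons]
  split <;> omega

/-- The projective Schur function (Schur Q-function) `Q_λ(t)` of a strict partition `λ`, as Schur's
Pfaffian of the `Q_{(λ_i, λ_j)}`, where a zero part is added if the length of `λ` is odd. -/
def schurQ (μ : YoungDiagram) (t : ℕ+ → R) : R :=
  pfaffian (qPair t) (if Even μ.rowLens.length then μ.rowLens else μ.rowLens ++ [0])

end Symmetric

/-! ### Partitions, as Young diagrams -/

/-- The nonzero partitions. -/
abbrev NonzeroPartition : Type := {μ : YoungDiagram // μ ≠ ⊥}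

/-- The nonzero strict partitions (partitions with distinct parts). -/
abbrev NonzeroStrict : Type := {μ : YoungDiagram // μ ≠ ⊥ ∧ μ.rowLens.SortedGT}

/-- `r_λ = ∏_i r(1) r(2) ⋯ r(n_i)`, the product over the parts `n_i` of `λ`. -/
def rStrict (r : ℤ → ℂ) (μ : YoungDiagram) : ℂ :=
  (μ.rowLens.map fun n => ∏ j ∈ Finset.Icc 1 n, r j).prod

/-- `r^{KP}_λ(k) = ∏_{(i,j) ∈ λ} r(k + j - i)`. -/
def rKP (r : ℤ → ℂ) (k : ℤ) (μ : YoungDiagram) : ℂ :=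
  ∏ c ∈ μ.cells, r (k + (c.2 : ℤ) - (c.1 : ℤ))

/-- The term `2^{-l(λ)} r_λ Q_λ(t/2) Q_λ(t*/2)`. -/
def termBKP (r : ℤ → ℂ) (μ : YoungDiagram) : MvPowerSeries Times ℂ :=
  (((2 : ℂ)⁻¹) ^ μ.rowLens.length * rStrict r μ) •
    (schurQ μ (fun m => (2⁻¹ : ℂ) • oddT m) * schurQ μ (fun m => (2⁻¹ : ℂ) • oddTStar m))

/-- The term `r^{KP}_λ(0) s_λ(t) s_λ(t*)`. -/
def termKP (r : ℤ → ℂ) (μ : YoungDiagram) : MvPowerSeries Times ℂ :=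
  rKP r 0 μ • (schurS μ oddT * schurS μ oddTStar)

end HypTau

end

open HypTau

/-!
Both identities compare three quantities: the tau function of the neutral fermions, the tau function
of the charged fermions restricted to odd times, and the two sums over partitions.

*The sums.* The tau function `⟨0| e^{H(t)} e^{-B(t*)} |0⟩` is expanded by inserting a complete set
of states between the two exponentials (`hasSum_formalExpectation_mul`). The factors `⟨0| e^{H(t)}
|S⟩` are determined by linear differential equations: the derivative in `t_k` replaces the state by
its image under `H_k`, which is again a sum of states, with one index shifted by `k`. A family of
power series whose derivatives are combinations of its members vanishes if its constant terms do
(`eq_zero_of_pderiv_mem_span`). As Pfaffians and determinants of the appropriate generating series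
satisfy the same equations, they are the matrix elements: this gives `Q`-functions for the neutral
fermions (`vacSeries_phiState`, `schurQ_half`), and Schur functions for the charged fermions
(`exists_vacSeries_psiProd`, `exists_vacSeries_partitionState`). The factors `⟨S| e^{-B(t*)} |0⟩`
are reduced to them in two steps. For the constant `r = 1` the operators `-B_k` are adjoint to the
`H_k`; and a diagonal operator, with eigenvalues the weights `r_λ`, takes `B_k` for `r = 1` to `B_k`
for the given `r` (`matrixElement_dualEvolB`; `matrixElement_dualEvolKP` for the charged fermions).
The strict partitions, with a part `0` added if their length is odd, are the states with an even
number of neutral fermions, and the other states do not contribute by parity; the partitions are the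
states of charge zero, and the other states do not contribute by conservation of the charge. Hence
both sums are equal to the respective vacuum expectations (`hasSum_nonzeroStrict`,
`hasSum_nonzeroPartition`).

*The square.* The combinations `2^{-1/2} (ψ_n + (-1)^n ψ*_{-n})` and `2^{-1/2} i (ψ_n - (-1)^n
ψ*_{-n})` of the charged fermions form two families of neutral fermions which anticommute with each
other. Accordingly there is a bilinear map `doubling` from pairs of neutral Fock spaces to the
charged Fock space for which the two families act on the two factors. For odd `k`, the operators
`H^{KP}_k` and `A_k` have the same commutation relations with both families as `H_k` and `B_k` have
with the neutral fermions; for `A_k` this uses the symmetry `r(n) = r(1-n)`. They therefore act on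
the image of `doubling` by the Leibniz rule (`hamKP_doubling`, `opA_doubling`), and `e^{H^{KP}(t)}
e^{-A(t*)}` acts as the product of two copies of `e^{H(t)} e^{-B(t*)}`. The only obstruction to the
factorization of the vacuum expectation comes from `φ_0`, which does not annihilate the vacuum; but
the vectors in question are even, and on these the vacuum component is multiplicative
(`doubling_apply_empty`). This is `formalExpectation_evolKP`.
-/

noncomputable section

namespace HypTau

open MvPowerSeries Finset

/-! ### Partial derivatives and exponentials of power series -/

section Derivative

variable {σ R : Type}

/-- The product rule for formal partial derivatives over a noncommutative coefficient ring. -/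
theorem pderivFun_mul_noncomm [Ring R] (s : σ) (f g : MvPowerSeries σ R) :
    pderivFun s (f * g) = pderivFun s f * g + f * pderivFun s g := by
  classical
  ext m
  set e : σ →₀ ℕ := Finsupp.single s 1 with he
  have hshift : ∀ n : σ →₀ ℕ, n s ≠ 0 → n - e + e = n := fun n hn =>
    tsub_add_cancel_of_le (by
      rw [he, Finsupp.single_le_iff]; exact Nat.one_le_iff_ne_zero.2 hn)
  have h1 : ∑ p ∈ antidiagonal m, coeff (p.1 + e) f * (p.1 s + 1) * coeff p.2 g =
      ∑ p ∈ antidiagonal (m + e), coeff p.1 f * (p.1 s) * coeff p.2 g := by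
    refine Finset.sum_of_injOn (fun p => (p.1 + e, p.2)) ?_ ?_ ?_ ?_
    · rintro ⟨a, b⟩ _ ⟨c, d⟩ _ h
      simpa using h
    · rintro ⟨a, b⟩ h
      simp only [mem_coe, HasAntidiagonal.mem_antidiagonal] at h ⊢
      rw [← h, add_right_comm]
    · rintro ⟨a, b⟩ h h'
      by_cases ha : a s = 0
      · simp [ha]
      · refine absurd ⟨(a - e, b), ?_, ?_⟩ h'
        · simp only [mem_coe, HasAntidiagonal.mem_antidiagonal] at h ⊢
          apply add_right_cancel (b := e)
          rw [← h, add_right_comm, hshift a ha]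
        · simp [hshift a ha]
    · rintro ⟨a, b⟩ _
      simp [he]
  have h2 : ∑ p ∈ antidiagonal m, coeff p.1 f * (coeff (p.2 + e) g * (p.2 s + 1)) =
      ∑ p ∈ antidiagonal (m + e), coeff p.1 f * (coeff p.2 g * (p.2 s)) := by
    refine Finset.sum_of_injOn (fun p => (p.1, p.2 + e)) ?_ ?_ ?_ ?_
    · rintro ⟨a, b⟩ _ ⟨c, d⟩ _ h
      simpa using h
    · rintro ⟨a, b⟩ h
      simp only [mem_coe, HasAntidiagonal.mem_antidiagonal] at h ⊢
      rw [← h, add_assoc]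
    · rintro ⟨a, b⟩ h h'
      by_cases hb : b s = 0
      · simp [hb]
      · refine absurd ⟨(a, b - e), ?_, ?_⟩ h'
        · simp only [mem_coe, HasAntidiagonal.mem_antidiagonal] at h ⊢
          apply add_right_cancel (b := e)
          rw [← h, add_assoc, hshift b hb]
        · simp [hshift b hb]
    · rintro ⟨a, b⟩ _
      simp [he]
  rw [coeff_pderivFun, map_add, coeff_mul, coeff_mul, coeff_mul]
  simp only [coeff_pderivFun]
  rw [← he, h1, h2, ← sum_add_distrib, sum_mul]
  refine sum_congr rfl fun p hp => ?_
  have : (m s : R) + 1 = (p.1 s : R) + p.2 s := by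
    have := congrArg (fun n : σ →₀ ℕ => ((n s : ℕ) : R)) (HasAntidiagonal.mem_antidiagonal.1 hp)
    simpa [he] using this.symm
  rw [this, mul_add, mul_assoc, ← (Nat.cast_commute (p.1 s) _).eq, ← mul_assoc,
    mul_assoc (coeff p.1 f) (coeff p.2 g)]

variable [Ring R]

theorem pderivFun_pow_of_commute (s : σ) (X : MvPowerSeries σ R)
    (h : Commute X (pderivFun s X)) (k : ℕ) :
    pderivFun s (X ^ (k + 1)) = (k + 1) • (pderivFun s X * X ^ k) := by
  induction k with
  | zero => simp
  | succ k ih =>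
    rw [pow_succ, pderivFun_mul_noncomm, ih, smul_mul_assoc, mul_assoc, ← pow_succ,
      (h.pow_left (k + 1)).eq, ← succ_nsmul]

theorem coeff_pow_eq_zero_of_degree_lt (X : MvPowerSeries σ R) (h : coeff 0 X = 0) (k : ℕ) :
    ∀ m : σ →₀ ℕ, m.degree < k → coeff m (X ^ k) = 0 := by
  classical
  induction k with
  | zero => simp
  | succ k ih =>
    intro m hm
    rw [pow_succ, coeff_mul]
    refine sum_eq_zero fun p hp => ?_
    by_cases hq : p.2 = 0
    · rw [hq, h, mul_zero]
    · rw [ih, zero_mul]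
      have h1 : p.2.degree ≠ 0 := fun h' => hq ((Finsupp.degree_eq_zero_iff _).1 h')
      have h2 := congrArg Finsupp.degree (HasAntidiagonal.mem_antidiagonal.1 hp)
      rw [map_add] at h2
      omega

theorem coeff_linForm_single (c : σ → R) (s : σ) :
    coeff (Finsupp.single s 1) (linForm c) = c s := by
  change (if (Finsupp.degree (Finsupp.single s 1)) = 1 then
    ∑ i ∈ (Finsupp.single s 1).support, c i else _) = _
  simp

theorem coeff_linForm_eq_zero (c : σ → R) (m : σ →₀ ℕ) (h : ∀ s, m ≠ Finsupp.single s 1) :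
    coeff m (linForm c) = 0 := by
  change (if (Finsupp.degree m) = 1 then (_ : R) else 0) = 0
  rw [if_neg]
  intro h'
  have h1 : m ∈ {d : σ →₀ ℕ | d.degree = 1} := h'
  rw [← Finsupp.range_single_one] at h1
  obtain ⟨s, hs⟩ := h1
  exact h s hs.symm

theorem coeff_zero_linForm (c : σ → R) : coeff 0 (linForm c) = 0 :=
  coeff_linForm_eq_zero c 0 fun s h => by simpa using congrArg (fun n => n s) h

theorem coeff_linForm_cases (c : σ → R) (m : σ →₀ ℕ) :
    coeff m (linForm c) = 0 ∨ ∃ s, m = Finsupp.single s 1 ∧ coeff m (linForm c) = c s := by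
  by_cases h : ∃ s, m = Finsupp.single s 1
  · obtain ⟨s, rfl⟩ := h
    exact Or.inr ⟨s, rfl, coeff_linForm_single c s⟩
  · exact Or.inl (coeff_linForm_eq_zero c m (not_exists.1 h))

theorem pderivFun_linForm (c : σ → R) (s : σ) : pderivFun s (linForm c) = C (c s) := by
  classical
  ext m
  rw [coeff_pderivFun, coeff_C]
  split_ifs with h
  · subst h
    simp [coeff_linForm_single]
  · rw [coeff_linForm_eq_zero, zero_mul]
    intro s' hs'
    have h1 := congrArg Finsupp.degree hs'
    simp only [map_add, Finsupp.degree_single] at h1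
    exact h ((Finsupp.degree_eq_zero_iff _).1 (by omega))

theorem commute_C_linForm (c : σ → R) (y : R) (h : ∀ s, Commute (c s) y) :
    Commute (linForm c) (C y) := by
  ext m
  rw [coeff_mul_C, coeff_C_mul]
  obtain h' | ⟨s, -, h'⟩ := coeff_linForm_cases c m
  · rw [h', zero_mul, mul_zero]
  · rw [h', (h s).eq]

variable [Algebra ℂ R]

theorem coeff_formalExp_eq_sum (X : MvPowerSeries σ R) (m : σ →₀ ℕ) :
    coeff m (formalExp X) =
      ∑ k ∈ range (m.degree + 1), ((Nat.factorial k : ℂ)⁻¹) • coeff m (X ^ k) := rfl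

theorem coeff_formalExp (X : MvPowerSeries σ R) (h : coeff 0 X = 0) (m : σ →₀ ℕ) (n : ℕ)
    (hn : m.degree < n) :
    coeff m (formalExp X) = ∑ k ∈ range n, ((Nat.factorial k : ℂ)⁻¹) • coeff m (X ^ k) := by
  change ∑ k ∈ range (m.degree + 1), _ = _
  refine sum_subset (range_mono hn) fun k _ hk => ?_
  rw [coeff_pow_eq_zero_of_degree_lt X h k m (by simpa using hk), smul_zero]

theorem coeff_zero_formalExp (X : MvPowerSeries σ R) :
    coeff 0 (formalExp X) = 1 := by
  change ∑ k ∈ range (Finsupp.degree (0 : σ →₀ ℕ) + 1), _ = _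
  simp

/-- `∂ exp X = ∂X exp X`, as soon as `X` commutes with `∂X`. -/
theorem pderivFun_formalExp (s : σ) (X : MvPowerSeries σ R) (h0 : coeff 0 X = 0)
    (h : Commute X (pderivFun s X)) :
    pderivFun s (formalExp X) = pderivFun s X * formalExp X := by
  classical
  ext m
  rw [coeff_pderivFun, coeff_mul]
  have h1 : ∀ p ∈ antidiagonal m, coeff p.1 (pderivFun s X) * coeff p.2 (formalExp X) =
      ∑ k ∈ range (m.degree + 1),
        ((Nat.factorial k : ℂ)⁻¹) • (coeff p.1 (pderivFun s X) * coeff p.2 (X ^ k)) := by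
    intro p hp
    have h2 := congrArg Finsupp.degree (HasAntidiagonal.mem_antidiagonal.1 hp)
    rw [map_add] at h2
    rw [coeff_formalExp X h0 p.2 (m.degree + 1) (by omega), mul_sum]
    simp only [mul_smul_comm]
  rw [sum_congr rfl h1, sum_comm]
  simp only [← smul_sum, ← coeff_mul]
  rw [coeff_formalExp X h0 _ (m.degree + 1 + 1) (by simp), sum_range_succ']
  have h3 : coeff (m + Finsupp.single s 1) (X ^ 0) = 0 := by
    rw [pow_zero, coeff_one, if_neg]
    intro h'
    simpa using congrArg (fun n => n s) h'
  rw [h3, smul_zero, add_zero, sum_mul]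
  refine sum_congr rfl fun k _ => ?_
  rw [smul_mul_assoc, ← coeff_pderivFun, pderivFun_pow_of_commute s X h, map_nsmul,
    ← Nat.cast_smul_eq_nsmul ℂ, smul_smul]
  congr 1
  rw [Nat.factorial_succ]
  push_cast
  have : (k : ℂ) + 1 ≠ 0 := by exact_mod_cast Nat.succ_ne_zero k
  rw [mul_inv, mul_comm, mul_inv_cancel_left₀ this]

theorem commute_formalExp_left {X : MvPowerSeries σ R} {y : R} (h : Commute X (C y)) :
    Commute (formalExp X) (C y) := by
  ext m
  rw [coeff_mul_C, coeff_C_mul]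
  change (∑ k ∈ range (m.degree + 1), _) * y = y * (∑ k ∈ range (m.degree + 1), _)
  rw [sum_mul, mul_sum]
  refine sum_congr rfl fun k _ => ?_
  rw [smul_mul_assoc, mul_smul_comm, ← coeff_mul_C, ← coeff_C_mul, (h.pow_left k).eq]

theorem pderivFun_formalExp_linForm (c : σ → R) (h : ∀ s s', Commute (c s) (c s')) (s : σ) :
    pderivFun s (formalExp (linForm c)) = C (c s) * formalExp (linForm c) := by
  rw [pderivFun_formalExp s _ (coeff_zero_linForm c), pderivFun_linForm]
  rw [pderivFun_linForm]
  exact commute_C_linForm c _ fun s' => h s' s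

theorem exists_eq_add_single {m : σ →₀ ℕ} (hm : m ≠ 0) :
    ∃ s n, m = n + Finsupp.single s 1 := by
  obtain ⟨s, hs⟩ := Finsupp.ne_iff.1 hm
  refine ⟨s, m - Finsupp.single s 1, (tsub_add_cancel_of_le ?_).symm⟩
  rw [Finsupp.single_le_iff]
  exact Nat.one_le_iff_ne_zero.2 hs

theorem natCast_add_one_cancel {a b : R} {n : ℕ} (h : a * ((n : R) + 1) = b * ((n : R) + 1)) :
    a = b := by
  have hn : (n : ℂ) + 1 ≠ 0 := by exact_mod_cast Nat.succ_ne_zero n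
  have key : ∀ x : R, x = ((n : ℂ) + 1)⁻¹ • (x * ((n : R) + 1)) := by
    intro x
    have : (n : R) + 1 = algebraMap ℂ R (n + 1) := by simp
    rw [this, ← Algebra.commutes, ← Algebra.smul_def, smul_smul, inv_mul_cancel₀ hn, one_smul]
  rw [key a, key b, h]

/-- A power series is determined by its constant coefficient and a first order linear system. -/
theorem eq_of_pderivFun_eq_C_mul (c : σ → R) {f g : MvPowerSeries σ R}
    (hf : ∀ s, pderivFun s f = C (c s) * f) (hg : ∀ s, pderivFun s g = C (c s) * g)
    (h0 : coeff 0 f = coeff 0 g) : f = g := by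
  suffices H : ∀ n : ℕ, ∀ m : σ →₀ ℕ, m.degree = n → coeff m f = coeff m g by
    ext m; exact H _ m rfl
  intro n
  induction n with
  | zero =>
    intro m hm
    rw [(Finsupp.degree_eq_zero_iff m).1 hm, h0]
  | succ n ih =>
    intro m hm
    obtain ⟨s, k, rfl⟩ := exists_eq_add_single (m := m) (by rintro rfl; simp at hm)
    have hk : k.degree = n := by simpa using hm
    apply natCast_add_one_cancel (n := k s)
    rw [← coeff_pderivFun, ← coeff_pderivFun, hf, hg, coeff_C_mul, coeff_C_mul, ih k hk]

theorem formalExp_linForm_add (a b : σ → R) (ha : ∀ s s', Commute (a s) (a s'))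
    (hb : ∀ s s', Commute (b s) (b s')) (hab : ∀ s s', Commute (a s) (b s')) :
    formalExp (linForm fun s => a s + b s) = formalExp (linForm a) * formalExp (linForm b) := by
  refine eq_of_pderivFun_eq_C_mul (fun s => a s + b s) ?_ ?_ ?_
  · refine pderivFun_formalExp_linForm _ fun s s' => ?_
    exact ((ha s s').add_right (hab s s')).add_left (((hab s' s).symm).add_right (hb s s'))
  · intro s
    rw [pderivFun_mul_noncomm, pderivFun_formalExp_linForm a ha, pderivFun_formalExp_linForm b hb,
      ← mul_assoc (formalExp _),
      (commute_formalExp_left (commute_C_linForm a (b s) fun s' => hab s' s)).eq, map_add, add_mul,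
      mul_assoc, mul_assoc]
  · classical
    rw [coeff_mul]
    simp [coeff_zero_formalExp]

end Derivative

/-- Uniqueness for a system of linear differential equations: a family of power series whose
partial derivatives are linear combinations of members of the family, and whose constant
coefficients vanish, is zero. -/
theorem eq_zero_of_pderiv_mem_span {σ I : Type} (d : I → MvPowerSeries σ ℂ)
    (hD : ∀ s a, pderiv ℂ s (d a) ∈ Submodule.span ℂ (Set.range d))
    (h0 : ∀ a, coeff 0 (d a) = 0) (a : I) : d a = 0 := by
  suffices H : ∀ n : ℕ, ∀ m : σ →₀ ℕ, m.degree = n → ∀ a, coeff m (d a) = 0 by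
    ext m; exact H _ m rfl a
  intro n
  induction n with
  | zero =>
    intro m hm a
    rw [(Finsupp.degree_eq_zero_iff m).1 hm, h0]
  | succ n ih =>
    intro m hm a
    obtain ⟨s, k, rfl⟩ := exists_eq_add_single (m := m) (by rintro rfl; simp at hm)
    have hk : k.degree = n := by simpa using hm
    apply natCast_add_one_cancel (n := k s)
    rw [← coeff_pderiv, zero_mul]
    have : ∀ x ∈ Submodule.span ℂ (Set.range d), coeff k x = 0 := by
      intro x hx
      induction hx using Submodule.span_induction with
      | mem x h => obtain ⟨b, rfl⟩ := h; exact ih k hk b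
      | zero => exact map_zero _
      | add x y _ _ hx hy => rw [map_add, hx, hy, add_zero]
      | smul c x _ hx => rw [MvPowerSeries.coeff_smul, hx, mul_zero]
    exact this _ (hD s a)

/-! ### Setting some of the variables to zero -/

section Restrict

variable {σ R : Type} [Ring R]

open Classical in
/-- The substitution of `0` for all variables which do not satisfy `P`. -/
def restrictVars (P : σ → Prop) (f : MvPowerSeries σ R) : MvPowerSeries σ R :=
  fun m => if ∀ s ∈ m.support, P s then coeff m f else 0

open Classical in
theorem coeff_restrictVars (P : σ → Prop) (f : MvPowerSeries σ R) (m : σ →₀ ℕ) :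
    coeff m (restrictVars P f) = if ∀ s ∈ m.support, P s then coeff m f else 0 := rfl

theorem forall_mem_support_add (P : σ → Prop) (a b : σ →₀ ℕ) :
    (∀ s ∈ (a + b).support, P s) ↔ (∀ s ∈ a.support, P s) ∧ ∀ s ∈ b.support, P s := by
  simp only [Finsupp.mem_support_iff, Finsupp.add_apply]
  constructor
  · exact fun h => ⟨fun s hs => h s (by omega), fun s hs => h s (by omega)⟩
  · rintro ⟨h1, h2⟩ s hs
    by_cases ha : a s = 0
    · exact h2 s (by omega)
    · exact h1 s ha

theorem restrictVars_mul (P : σ → Prop) (f g : MvPowerSeries σ R) :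
    restrictVars P (f * g) = restrictVars P f * restrictVars P g := by
  classical
  ext m
  rw [coeff_restrictVars, coeff_mul, coeff_mul]
  split_ifs with h
  · refine sum_congr rfl fun p hp => ?_
    rw [← HasAntidiagonal.mem_antidiagonal.1 hp, forall_mem_support_add] at h
    rw [coeff_restrictVars, coeff_restrictVars, if_pos h.1, if_pos h.2]
  · refine (sum_eq_zero fun p hp => ?_).symm
    rw [← HasAntidiagonal.mem_antidiagonal.1 hp, forall_mem_support_add] at h
    rw [coeff_restrictVars, coeff_restrictVars]
    split_ifs with h1 h2
    · exact absurd ⟨h1, h2⟩ h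
    all_goals simp

theorem restrictVars_pow (P : σ → Prop) (f : MvPowerSeries σ R) (k : ℕ) :
    restrictVars P (f ^ k) = restrictVars P f ^ k := by
  classical
  induction k with
  | zero =>
    ext m
    rw [coeff_restrictVars, pow_zero, pow_zero, coeff_one]
    split_ifs with h1 h2 h2 <;> simp_all
  | succ k ih => rw [pow_succ, restrictVars_mul, ih, pow_succ]

theorem restrictVars_formalExp [Algebra ℂ R] (P : σ → Prop) (f : MvPowerSeries σ R) :
    restrictVars P (formalExp f) = formalExp (restrictVars P f) := by
  classical
  ext m
  rw [coeff_restrictVars]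
  change (if _ then ∑ k ∈ range (m.degree + 1), _ else _) = ∑ k ∈ range (m.degree + 1), _
  simp only [← restrictVars_pow, coeff_restrictVars]
  split_ifs with h <;> simp

open Classical in
theorem restrictVars_linForm (P : σ → Prop) (c : σ → R) :
    restrictVars P (linForm c) = linForm fun s => if P s then c s else 0 := by
  ext m
  rw [coeff_restrictVars]
  by_cases h : ∃ s, m = Finsupp.single s 1
  · obtain ⟨s, rfl⟩ := h
    simp [coeff_linForm_single]
  · rw [coeff_linForm_eq_zero _ _ (not_exists.1 h), coeff_linForm_eq_zero _ _ (not_exists.1 h)]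
    simp

end Restrict

theorem linForm_neg {σ R : Type} [Ring R] (c : σ → R) : -linForm c = linForm fun s => -c s := by
  ext m
  rw [map_neg]
  by_cases h : ∃ s, m = Finsupp.single s 1
  · obtain ⟨s, rfl⟩ := h
    rw [coeff_linForm_single, coeff_linForm_single]
  · rw [coeff_linForm_eq_zero _ _ (not_exists.1 h), coeff_linForm_eq_zero _ _ (not_exists.1 h),
      neg_zero]

/-! ### Power series with operator coefficients -/

section Operators

variable {σ V W : Type} [AddCommGroup V] [Module ℂ V] [AddCommGroup W] [Module ℂ W]

/-- The linear map `T` intertwines the coefficients of `X` with those of `Y`. -/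
def Intertwines (T : V →ₗ[ℂ] W) (X : MvPowerSeries σ (Module.End ℂ V))
    (Y : MvPowerSeries σ (Module.End ℂ W)) : Prop :=
  ∀ m v, T (coeff m X v) = coeff m Y (T v)

theorem Intertwines.mul {T : V →ₗ[ℂ] W} {X X' : MvPowerSeries σ (Module.End ℂ V)}
    {Y Y' : MvPowerSeries σ (Module.End ℂ W)} (h : Intertwines T X Y) (h' : Intertwines T X' Y') :
    Intertwines T (X * X') (Y * Y') := by
  classical
  intro m v
  rw [coeff_mul, coeff_mul, LinearMap.sum_apply, LinearMap.sum_apply, map_sum]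
  refine sum_congr rfl fun p _ => ?_
  rw [Module.End.mul_apply, Module.End.mul_apply, h, h']

theorem Intertwines.pow {T : V →ₗ[ℂ] W} {X : MvPowerSeries σ (Module.End ℂ V)}
    {Y : MvPowerSeries σ (Module.End ℂ W)} (h : Intertwines T X Y) (k : ℕ) :
    Intertwines T (X ^ k) (Y ^ k) := by
  classical
  induction k with
  | zero =>
    intro m v
    rw [pow_zero, pow_zero, coeff_one, coeff_one]
    split_ifs <;> simp
  | succ k ih => rw [pow_succ, pow_succ]; exact ih.mul h

theorem Intertwines.formalExp {T : V →ₗ[ℂ] W} {X : MvPowerSeries σ (Module.End ℂ V)}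
    {Y : MvPowerSeries σ (Module.End ℂ W)} (h : Intertwines T X Y) :
    Intertwines T (formalExp X) (formalExp Y) := by
  intro m v
  rw [coeff_formalExp_eq_sum, coeff_formalExp_eq_sum, LinearMap.sum_apply, LinearMap.sum_apply,
    map_sum]
  refine sum_congr rfl fun k _ => ?_
  rw [LinearMap.smul_apply, LinearMap.smul_apply, map_smul, h.pow k]

theorem Intertwines.linForm {T : V →ₗ[ℂ] W} {c : σ → Module.End ℂ V} {c' : σ → Module.End ℂ W}
    (h : ∀ s v, T (c s v) = c' s (T v)) : Intertwines T (linForm c) (linForm c') := by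
  intro m v
  by_cases hm : ∃ s, m = Finsupp.single s 1
  · obtain ⟨s, rfl⟩ := hm
    rw [coeff_linForm_single, coeff_linForm_single, h]
  · rw [coeff_linForm_eq_zero _ _ (not_exists.1 hm), coeff_linForm_eq_zero _ _ (not_exists.1 hm)]
    simp

/-- The exponentials of adjoint operators are adjoint. -/
theorem formalExp_linForm_adjoint (β : V →ₗ[ℂ] W →ₗ[ℂ] ℂ) {c : σ → Module.End ℂ V}
    {c' : σ → Module.End ℂ W} (h : ∀ s x y, β (c s x) y = β x (c' s y)) (m : σ →₀ ℕ) (x : V)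
    (y : W) :
    β (coeff m (formalExp (linForm c)) x) y = β x (coeff m (formalExp (linForm c')) y) := by
  classical
  have h1 : ∀ m x y, β (coeff m (linForm c) x) y = β x (coeff m (linForm c') y) := by
    intro m x y
    by_cases hm : ∃ s, m = Finsupp.single s 1
    · obtain ⟨s, rfl⟩ := hm
      rw [coeff_linForm_single, coeff_linForm_single, h]
    · rw [coeff_linForm_eq_zero _ _ (not_exists.1 hm), coeff_linForm_eq_zero _ _ (not_exists.1 hm)]
      simp
  have h2 : ∀ (k : ℕ) (m : σ →₀ ℕ) (x : V) (y : W),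
      β (coeff m (linForm c ^ k) x) y = β x (coeff m (linForm c' ^ k) y) := by
    intro k
    induction k with
    | zero =>
      intro m x y
      rw [pow_zero, pow_zero, coeff_one, coeff_one]
      split_ifs <;> simp
    | succ k ih =>
      intro m x y
      rw [pow_succ, pow_succ', coeff_mul, coeff_mul, LinearMap.sum_apply, LinearMap.sum_apply,
        map_sum, map_sum, LinearMap.sum_apply]
      refine Eq.trans (sum_congr rfl fun p _ => ?_) (Finsupp.sum_antidiagonal_swap m fun a b =>
        β x ((coeff b (linForm c') * coeff a (linForm c' ^ k)) y))
      simp only [Module.End.mul_apply, ih, h1]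
  rw [coeff_formalExp_eq_sum, coeff_formalExp_eq_sum, LinearMap.sum_apply, LinearMap.sum_apply,
    map_sum, map_sum, LinearMap.sum_apply]
  refine sum_congr rfl fun k _ => ?_
  rw [LinearMap.smul_apply, LinearMap.smul_apply, map_smul, map_smul, LinearMap.smul_apply, h2]

end Operators

/-! ### Operators on Fock space -/

section Kets

variable {ι : Type}

theorem ket_ext {W : Type} [AddCommGroup W] [Module ℂ W] {A B : Fock ι →ₗ[ℂ] W}
    (h : ∀ S, A (ket S) = B (ket S)) : A = B :=
  Finsupp.lhom_ext' fun S => LinearMap.ext_ring (h S)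

theorem eq_sum_ket (v : Fock ι) : v = ∑ S ∈ v.support, v S • ket S := by
  conv_lhs => rw [← Finsupp.sum_single v]
  simp [Finsupp.sum, ket]

theorem ket_apply_self (S : Finset ι) : ket S S = 1 := Finsupp.single_eq_same

theorem ket_apply_of_ne {S T : Finset ι} (h : T ≠ S) : ket S T = 0 := Finsupp.single_eq_of_ne h

/-- The matrix element `⟨T| X |S⟩` of a power series with operator coefficients. -/
def matrixElement {σ : Type} (T S : Finset ι) (X : MvPowerSeries σ (Module.End ℂ (Fock ι))) :
    MvPowerSeries σ ℂ := fun m => coeff m X (ket S) T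

theorem coeff_matrixElement {σ : Type} (T S : Finset ι)
    (X : MvPowerSeries σ (Module.End ℂ (Fock ι))) (m : σ →₀ ℕ) :
    coeff m (matrixElement T S X) = coeff m X (ket S) T := rfl

/-- Insertion of a complete set of states between two operators. -/
theorem hasSum_formalExpectation_mul (X Y : MvPowerSeries Times (Module.End ℂ (Fock ι))) :
    HasSum (fun S : Finset ι => matrixElement ∅ S X * matrixElement S ∅ Y)
      (formalExpectation ∅ (X * Y)) := by
  classical
  rw [WithPiTopology.hasSum_iff_hasSum_coeff]
  intro m
  have h1 : coeff m (formalExpectation ∅ (X * Y)) = ∑ p ∈ antidiagonal m,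
      coeff p.1 X (coeff p.2 Y (ket ∅)) ∅ := by
    change (coeff m (X * Y) (ket ∅)) ∅ = _
    rw [coeff_mul, LinearMap.sum_apply, Finsupp.finsetSum_apply]
    rfl
  rw [h1]
  simp only [coeff_mul, coeff_matrixElement]
  refine hasSum_sum fun p _ => ?_
  have h2 : coeff p.1 X (coeff p.2 Y (ket ∅)) ∅ = ∑ S ∈ (coeff p.2 Y (ket ∅)).support,
      coeff p.1 X (ket S) ∅ * coeff p.2 Y (ket ∅) S := by
    conv_lhs => rw [eq_sum_ket (coeff p.2 Y (ket ∅))]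
    rw [map_sum, Finsupp.finsetSum_apply]
    refine sum_congr rfl fun S _ => ?_
    rw [map_smul, Finsupp.smul_apply, smul_eq_mul, mul_comm]
  rw [h2]
  refine hasSum_sum_of_ne_finset_zero fun S hS => ?_
  rw [Finsupp.notMem_support_iff.1 hS, mul_zero]

/-- Every vector is killed by all but finitely many of the operators `A k`. -/
def LocallyFinite (A : ℤ → Module.End ℂ (Fock ι)) : Prop :=
  ∀ S, (Function.support fun k => A k (ket S)).Finite

theorem LocallyFinite.finite_support {A : ℤ → Module.End ℂ (Fock ι)} (hA : LocallyFinite A)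
    (v : Fock ι) : (Function.support fun k => A k v).Finite := by
  refine (v.support.finite_toSet.biUnion fun S _ => hA S).subset fun k hk => ?_
  by_contra h
  simp only [mem_coe, Set.mem_iUnion, Function.mem_support, not_exists, not_not] at h
  apply hk
  change A k v = 0
  rw [eq_sum_ket v, map_sum]
  exact sum_eq_zero fun S hS => by rw [map_smul, h S hS, smul_zero]

theorem LocallyFinite.sumOp_apply {A : ℤ → Module.End ℂ (Fock ι)} (hA : LocallyFinite A)
    (v : Fock ι) : sumOp A v = ∑ᶠ k, A k v := by
  induction v using Finsupp.induction_linear with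
  | zero => simp
  | add x y hx hy =>
    simp only [map_add]
    rw [finsum_add_distrib (hA.finite_support x) (hA.finite_support y), hx, hy]
  | single S c =>
    have h1 : (Finsupp.single S c : Fock ι) = c • ket S := by simp [ket]
    rw [h1]
    simp only [map_smul]
    rw [← smul_finsum' _ (hA S)]
    congr 1
    simp [sumOp, ket]

theorem LocallyFinite.sumOp_apply_apply {A : ℤ → Module.End ℂ (Fock ι)} (hA : LocallyFinite A)
    (v : Fock ι) (S : Finset ι) : sumOp A v S = ∑ᶠ k, A k v S := by
  rw [hA.sumOp_apply]
  exact (Finsupp.applyAddHom S).map_finsum (hA.finite_support v)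

theorem LocallyFinite.map_sumOp_apply {W : Type} [AddCommGroup W] [Module ℂ W]
    {A : ℤ → Module.End ℂ (Fock ι)} (hA : LocallyFinite A) (x : Fock ι →ₗ[ℂ] W)
    (v : Fock ι) : x (sumOp A v) = ∑ᶠ k, x (A k v) := by
  rw [hA.sumOp_apply]
  exact x.toAddMonoidHom.map_finsum (hA.finite_support v)

theorem LocallyFinite.commutator_apply {A : ℤ → Module.End ℂ (Fock ι)} (hA : LocallyFinite A)
    (x : Module.End ℂ (Fock ι)) (v : Fock ι) :
    sumOp A (x v) - x (sumOp A v) = ∑ᶠ k, (A k (x v) - x (A k v)) := by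
  rw [hA.map_sumOp_apply, hA.sumOp_apply, finsum_sub_distrib (hA.finite_support _)]
  refine (hA.finite_support v).subset fun k hk h => hk ?_
  change x (A k v) = 0
  rw [show A k v = 0 from h, map_zero]

theorem LocallyFinite.commute {A : ℤ → Module.End ℂ (Fock ι)} (hA : LocallyFinite A)
    (x : Module.End ℂ (Fock ι)) (h : ∀ k, Commute (A k) x) : Commute (sumOp A) x := by
  refine LinearMap.ext fun v => ?_
  rw [Module.End.mul_apply, Module.End.mul_apply, ← sub_eq_zero, hA.commutator_apply]
  refine finsum_eq_zero_of_forall_eq_zero fun k => ?_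
  rw [← Module.End.mul_apply, ← Module.End.mul_apply, (h k).eq, sub_self]

variable [LinearOrder ι]

/-- An operator which commutes with operators creating all states from the vacuum, and kills the
vacuum, is zero. -/
theorem eq_zero_of_commute_creation (x : ι → Module.End ℂ (Fock ι))
    (hx : ∀ i S, (∀ j ∈ S, j < i) → x i (ket S) = ket (insert i S))
    (C : Module.End ℂ (Fock ι)) (hC : ∀ i, Commute C (x i)) (h0 : C (ket ∅) = 0) : C = 0 := by
  refine ket_ext fun S => ?_
  induction S using Finset.induction_on_max with
  | empty => exact h0
  | insert i S hi ih =>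
    rw [← hx i S hi, ← Module.End.mul_apply, (hC i).eq, Module.End.mul_apply, ih]
    simp

/-- The statement dual to `eq_zero_of_commute_creation`: an operator which commutes with operators
taking all states to the vacuum, and is killed by the dual vacuum, is zero. -/
theorem eq_zero_of_commute_annihilation (y : ι → Module.End ℂ (Fock ι)) (κ : ι → ℂ)
    (hκ : ∀ i, κ i ≠ 0)
    (hy : ∀ i S v, (∀ j ∈ S, j < i) → y i v S = κ i * v (insert i S))
    (C : Module.End ℂ (Fock ι)) (hC : ∀ i, Commute C (y i)) (h0 : ∀ v, C v ∅ = 0) : C = 0 := by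
  refine LinearMap.ext fun v => Finsupp.ext fun S => ?_
  induction S using Finset.induction_on_max generalizing v with
  | empty => exact h0 v
  | insert i S hi ih =>
    have h1 := hy i S (C v) hi
    rw [← Module.End.mul_apply, ← (hC i).eq, Module.End.mul_apply, ih (y i v)] at h1
    simpa [hκ i] using h1.symm

/-! ### Canonical anticommutation relations -/

theorem create_ket (i : ι) (S : Finset ι) :
    create i (ket S) = if i ∈ S then 0 else wedgeSign i S • ket (insert i S) := by
  simp [create, ket]

theorem annihilate_ket (i : ι) (S : Finset ι) :
    annihilate i (ket S) = if i ∈ S then wedgeSign i S • ket (S.erase i) else 0 := by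
  simp [annihilate, ket]

theorem wedgeSign_mul_self (i : ι) (S : Finset ι) : wedgeSign i S * wedgeSign i S = 1 := by
  rw [wedgeSign, ← mul_pow]; simp

theorem wedgeSign_insert (i : ι) {j : ι} {S : Finset ι} (h : j ∉ S) :
    wedgeSign i (insert j S) = (if i < j then -1 else 1) * wedgeSign i S := by
  rw [wedgeSign, wedgeSign, filter_insert]
  split_ifs
  · rw [card_insert_of_notMem (by simp [h]), pow_succ']
  · rw [one_mul]

theorem wedgeSign_erase (i : ι) {j : ι} {S : Finset ι} (h : j ∈ S) :
    wedgeSign i (S.erase j) = (if i < j then -1 else 1) * wedgeSign i S := by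
  conv_rhs => rw [← insert_erase h, wedgeSign_insert i (notMem_erase j S), ← mul_assoc]
  split_ifs <;> simp

theorem wedgeSign_of_forall_lt {i : ι} {S : Finset ι} (h : ∀ j ∈ S, j < i) : wedgeSign i S = 1 := by
  rw [wedgeSign, filter_false_of_mem fun j hj => (h j hj).not_gt, card_empty, pow_zero]

theorem create_ket_of_forall_lt {i : ι} {S : Finset ι} (h : ∀ j ∈ S, j < i) :
    create i (ket S) = ket (insert i S) := by
  rw [create_ket, if_neg fun hi => (h i hi).false, wedgeSign_of_forall_lt h, one_smul]

theorem create_mul_create (i j : ι) : create i * create j + create j * create i = 0 := by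
  refine ket_ext fun S => ?_
  simp only [LinearMap.add_apply, Module.End.mul_apply, LinearMap.zero_apply]
  by_cases hij : i = j
  · subst hij
    by_cases hi : i ∈ S <;> simp [create_ket, hi]
  by_cases hi : i ∈ S <;> by_cases hj : j ∈ S <;>
    simp [create_ket, hi, hj, hij, Ne.symm hij, wedgeSign_insert]
  rw [insert_comm i j, smul_comm]
  rcases lt_or_gt_of_ne hij with h | h <;> simp [h, h.not_gt]

theorem annihilate_mul_annihilate (i j : ι) :
    annihilate i * annihilate j + annihilate j * annihilate i = 0 := by
  refine ket_ext fun S => ?_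
  simp only [LinearMap.add_apply, Module.End.mul_apply, LinearMap.zero_apply]
  by_cases hij : i = j
  · subst hij
    by_cases hi : i ∈ S <;> simp [annihilate_ket, hi]
  by_cases hi : i ∈ S <;> by_cases hj : j ∈ S <;>
    simp [annihilate_ket, hi, hj, hij, Ne.symm hij, wedgeSign_erase]
  rw [erase_right_comm, smul_comm]
  rcases lt_or_gt_of_ne hij with h | h <;> simp [h, h.not_gt]

theorem annihilate_mul_create (i j : ι) :
    annihilate i * create j + create j * annihilate i = if i = j then 1 else 0 := by
  refine ket_ext fun S => ?_
  simp only [LinearMap.add_apply, Module.End.mul_apply]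
  by_cases hij : i = j
  · subst hij
    by_cases hi : i ∈ S
    · simp [create_ket, annihilate_ket, hi, wedgeSign_erase, smul_smul, wedgeSign_mul_self]
    · simp [create_ket, annihilate_ket, hi, wedgeSign_insert, smul_smul, wedgeSign_mul_self]
  rw [if_neg hij]
  by_cases hi : i ∈ S <;> by_cases hj : j ∈ S <;>
    simp [create_ket, annihilate_ket, hi, hj, hij, Ne.symm hij, wedgeSign_erase, wedgeSign_insert]
  rw [erase_insert_of_ne (Ne.symm hij), smul_comm]
  rcases lt_or_gt_of_ne hij with h | h <;> simp [h, h.not_gt]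

end Kets

theorem neg_one_zpow_neg (m : ℤ) : (-1 : ℂ) ^ (-m) = (-1) ^ m := by
  rw [zpow_neg, ← inv_zpow, inv_neg_one]

theorem neg_one_zpow_mul_self (m : ℤ) : (-1 : ℂ) ^ m * (-1) ^ m = 1 := by
  rw [← mul_zpow]; simp

theorem neg_one_zpow_add (m n : ℤ) : (-1 : ℂ) ^ (m + n) = (-1) ^ m * (-1) ^ n :=
  zpow_add₀ (by norm_num) m n

theorem neg_one_zpow_sub (m n : ℤ) : (-1 : ℂ) ^ (m - n) = (-1) ^ m * (-1) ^ n := by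
  rw [sub_eq_add_neg, neg_one_zpow_add, neg_one_zpow_neg]

theorem neg_one_zpow_odd {k : ℕ} (hk : Odd k) : (-1 : ℂ) ^ (k : ℤ) = -1 := by
  rw [zpow_natCast, hk.neg_one_pow]

/-! ### Diagonal operators and forms on Fock space -/

section Diagonal

variable {ι : Type}

/-- The operator with eigenvectors `ket S` and eigenvalues `w S`. -/
def diagOp (w : Finset ι → ℂ) : Module.End ℂ (Fock ι) :=
  Finsupp.linearCombination ℂ fun S => w S • ket S

theorem diagOp_ket (w : Finset ι → ℂ) (S : Finset ι) : diagOp w (ket S) = w S • ket S := by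
  simp [diagOp, ket]

theorem diagOp_apply (w : Finset ι → ℂ) (v : Fock ι) (S : Finset ι) :
    diagOp w v S = w S * v S := by
  suffices h : Finsupp.lapply S ∘ₗ diagOp w = w S • Finsupp.lapply (R := ℂ) S from
    LinearMap.congr_fun h v
  refine ket_ext fun T => ?_
  by_cases h : S = T
  · subst h; simp [diagOp_ket]
  · simp [diagOp_ket, ket_apply_of_ne h]

/-- The bilinear form for which the vectors `ket S` are orthogonal, of square lengths `ν S`. -/
def diagForm (ν : Finset ι → ℂ) : Fock ι →ₗ[ℂ] Fock ι →ₗ[ℂ] ℂ :=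
  Finsupp.linearCombination ℂ fun S => ν S • Finsupp.lapply S

theorem diagForm_ket_left (ν : Finset ι → ℂ) (S : Finset ι) (y : Fock ι) :
    diagForm ν (ket S) y = ν S * y S := by
  simp [diagForm, ket]

theorem diagForm_ket_right (ν : Finset ι → ℂ) (S : Finset ι) (x : Fock ι) :
    diagForm ν x (ket S) = ν S * x S := by
  suffices h : (diagForm ν).flip (ket S) = ν S • Finsupp.lapply S from LinearMap.congr_fun h x
  refine ket_ext fun T => ?_
  rw [LinearMap.flip_apply, diagForm_ket_left]
  by_cases h : S = T
  · subst h; simp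
  · simp [ket_apply_of_ne h, ket_apply_of_ne (Ne.symm h)]

theorem diagForm_comm (ν : Finset ι → ℂ) (x y : Fock ι) : diagForm ν x y = diagForm ν y x := by
  suffices h : diagForm ν = (diagForm ν).flip from LinearMap.congr_fun₂ h x y
  refine ket_ext fun S => LinearMap.ext fun y => ?_
  rw [LinearMap.flip_apply, diagForm_ket_left, diagForm_ket_right]

variable [LinearOrder ι]

theorem create_apply_empty (i : ι) (v : Fock ι) : create i v ∅ = 0 := by
  suffices h : Finsupp.lapply ∅ ∘ₗ create i = (0 : Fock ι →ₗ[ℂ] ℂ) from LinearMap.congr_fun h v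
  refine ket_ext fun S => ?_
  rw [LinearMap.comp_apply, create_ket]
  split_ifs
  · simp
  · simp [ket_apply_of_ne (insert_ne_empty i S).symm]

theorem annihilate_vacuum (i : ι) : annihilate i (ket ∅) = 0 := by
  simp [annihilate_ket]

theorem annihilate_apply_of_forall_lt {i : ι} {S : Finset ι} (h : ∀ j ∈ S, j < i) (v : Fock ι) :
    annihilate i v S = v (insert i S) := by
  suffices h : Finsupp.lapply S ∘ₗ annihilate i = Finsupp.lapply (R := ℂ) (insert i S) from
    LinearMap.congr_fun h v
  have hi : i ∉ S := fun hi => (h i hi).false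
  refine ket_ext fun T => ?_
  rw [LinearMap.comp_apply, annihilate_ket, Finsupp.lapply_apply, Finsupp.lapply_apply]
  by_cases hT : insert i S = T
  · subst hT
    simp [erase_insert hi, wedgeSign_insert _ hi, wedgeSign_of_forall_lt h, ket_apply_self]
  · rw [ket_apply_of_ne hT]
    split_ifs with hiT
    · rw [Finsupp.smul_apply, ket_apply_of_ne, smul_zero]
      rintro rfl
      exact hT (insert_erase hiT)
    · simp

theorem diagForm_create (ν : Finset ι → ℂ) (i : ι) (κ : ℂ)
    (h : ∀ S, i ∉ S → ν (insert i S) = κ * ν S) (x y : Fock ι) :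
    diagForm ν (create i x) y = diagForm ν x ((κ • annihilate i) y) := by
  suffices h : diagForm ν ∘ₗ create i = ((diagForm ν).flip ∘ₗ (κ • annihilate i)).flip from
    LinearMap.congr_fun₂ h x y
  refine ket_ext fun S => ket_ext fun T => ?_
  simp only [LinearMap.comp_apply, LinearMap.flip_apply, LinearMap.smul_apply, map_smul]
  rw [diagForm_ket_right, create_ket, diagForm_ket_left, annihilate_ket, smul_eq_mul]
  by_cases hT : insert i S = T ∧ i ∉ S
  · obtain ⟨rfl, hi⟩ := hT
    simp [hi, h S hi, ket_apply_self, wedgeSign_insert]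
    ring
  · have h1 : (if i ∈ S then (0 : Fock ι) else wedgeSign i S • ket (insert i S)) T = 0 := by
      split_ifs with hi
      · simp
      · rw [Finsupp.smul_apply, ket_apply_of_ne fun h' => hT ⟨h'.symm, hi⟩, smul_zero]
    have h2 : (if i ∈ T then wedgeSign i T • ket (T.erase i) else (0 : Fock ι)) S = 0 := by
      split_ifs with hi
      · rw [Finsupp.smul_apply, ket_apply_of_ne, smul_zero]
        rintro rfl
        exact hT ⟨insert_erase hi, notMem_erase i T⟩
      · simp
    rw [h1, h2]
    simp

theorem diagOp_create (ρ : ι → ℂ) (i : ι) :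
    diagOp (fun S => ∏ j ∈ S, ρ j) * create i =
      ρ i • (create i * diagOp (fun S => ∏ j ∈ S, ρ j)) := by
  refine ket_ext fun S => ?_
  simp only [LinearMap.smul_apply, Module.End.mul_apply]
  by_cases hi : i ∈ S
  · simp [create_ket, hi, diagOp_ket]
  · simp only [create_ket, hi, diagOp_ket, map_smul, prod_insert, not_false_eq_true, if_false,
      smul_smul]
    congr 1
    ring

theorem diagOp_annihilate (ρ : ι → ℂ) (i : ι) :
    ρ i • (diagOp (fun S => ∏ j ∈ S, ρ j) * annihilate i) =
      annihilate i * diagOp (fun S => ∏ j ∈ S, ρ j) := by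
  refine ket_ext fun S => ?_
  simp only [LinearMap.smul_apply, Module.End.mul_apply]
  by_cases hi : i ∈ S
  · simp only [annihilate_ket, hi, diagOp_ket, map_smul, if_true, smul_smul]
    rw [← mul_prod_erase S ρ hi]
    congr 1
    ring
  · simp [annihilate_ket, hi, diagOp_ket]

/-- The operator `(-1)^F`, where `F` counts the excited modes. -/
def parity : Module.End ℂ (Fock ι) := diagOp fun S => (-1) ^ S.card

theorem parity_create (i : ι) (v : Fock ι) : parity (create i v) = -create i (parity v) := by
  have := LinearMap.congr_fun (diagOp_create (fun _ : ι => (-1 : ℂ)) i) v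
  simp only [prod_const] at this
  exact Eq.trans this (neg_one_smul ℂ (create i (parity v)))

theorem parity_annihilate (i : ι) (v : Fock ι) :
    parity (annihilate i v) = -annihilate i (parity v) := by
  have := LinearMap.congr_fun (diagOp_annihilate (fun _ : ι => (-1 : ℂ)) i) v
  simp only [prod_const] at this
  exact neg_eq_iff_eq_neg.1 ((neg_one_smul ℂ (parity (annihilate i v))).symm.trans this)

end Diagonal

/-- If `A` and `B` act on a family `x` by weighted shifts which commute with each other, then their
commutator commutes with the family. -/
theorem commute_commutator_of_shift {R : Type} [Ring R] [Algebra ℂ R] (x : ℤ → R) (A B : R)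
    (α β : ℤ → ℂ) (a b : ℤ) (hA : ∀ m, A * x m = x m * A + α m • x (m + a))
    (hB : ∀ m, B * x m = x m * B + β m • x (m + b))
    (h : ∀ m, β m * α (m + b) = α m * β (m + a)) (m : ℤ) : Commute (A * B - B * A) (x m) := by
  have h1 : A * B * x m = x m * A * B + α m • (x (m + a) * B) + β m • (x (m + b) * A) +
      (β m * α (m + b)) • x (m + b + a) := by
    rw [mul_assoc, hB, mul_add, ← mul_assoc, hA, mul_smul_comm, hA, add_mul, smul_add, smul_smul,
      smul_mul_assoc]
    abel
  have h2 : B * A * x m = x m * B * A + β m • (x (m + b) * A) + α m • (x (m + a) * B) +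
      (α m * β (m + a)) • x (m + a + b) := by
    rw [mul_assoc, hA, mul_add, ← mul_assoc, hB, mul_smul_comm, hB, add_mul, smul_add, smul_smul,
      smul_mul_assoc]
    abel
  change (A * B - B * A) * x m = x m * (A * B - B * A)
  rw [sub_mul, h1, h2, h, mul_sub, add_right_comm m b a, ← mul_assoc, ← mul_assoc]
  abel

/-! ### Neutral fermions -/

theorem phi_natCast_pos {n : ℕ} (h : 0 < n) : phi n = create n := by
  rw [phi, if_pos (by exact_mod_cast h), Int.toNat_natCast]

theorem phi_zero : phi 0 = create 0 + (2⁻¹ : ℂ) • annihilate 0 := by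
  simp [phi]

theorem phi_neg_natCast {n : ℕ} (h : 0 < n) : phi (-n) = ((-1 : ℂ) ^ n) • annihilate n := by
  rw [phi, if_neg (by omega), if_neg (by omega), neg_neg, Int.toNat_natCast, neg_one_zpow_neg,
    zpow_natCast]

theorem int_cases_pos (m : ℤ) :
    (∃ a : ℕ, 0 < a ∧ m = a) ∨ m = 0 ∨ ∃ a : ℕ, 0 < a ∧ m = -(a : ℤ) := by
  rcases lt_trichotomy m 0 with h | h | h
  · exact Or.inr (Or.inr ⟨(-m).toNat, by omega, by omega⟩)
  · exact Or.inr (Or.inl h)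
  · exact Or.inl ⟨m.toNat, by omega, by omega⟩

theorem anticommutator_smul_add {V : Type} [AddCommGroup V] [Module ℂ V] (a b c d : ℂ)
    (x y z w : Module.End ℂ V) :
    (a • x + b • y) * (c • z + d • w) + (c • z + d • w) * (a • x + b • y) =
      (a * c) • (x * z + z * x) + (a * d) • (x * w + w * x) + (b * c) • (y * z + z * y) +
        (b * d) • (y * w + w * y) := by
  simp only [mul_add, add_mul, smul_mul_smul_comm, smul_add]
  rw [mul_comm c a, mul_comm c b, mul_comm d a, mul_comm d b]
  abel

theorem phi_eq (n : ℤ) :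
    phi n = (if 0 ≤ n then 1 else 0 : ℂ) • create n.natAbs +
      (if 0 < n then 0 else if n = 0 then 2⁻¹ else (-1) ^ n : ℂ) • annihilate n.natAbs := by
  rcases lt_trichotomy n 0 with h | rfl | h
  · rw [phi, if_neg (by omega), if_neg (by omega), if_neg (by omega), if_neg (by omega),
      if_neg (by omega), zero_smul, zero_add, show (-n).toNat = n.natAbs by omega]
  · simp [phi]
  · rw [phi, if_pos h, if_pos h.le, if_pos h, zero_smul, add_zero, one_smul,
      show n.toNat = n.natAbs by omega]

/-- The anticommutation relations of the neutral fermions. -/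
theorem phi_mul_phi (m n : ℤ) :
    phi m * phi n + phi n * phi m = if m + n = 0 then ((-1 : ℂ) ^ m) • 1 else 0 := by
  rw [phi_eq, phi_eq, anticommutator_smul_add, create_mul_create, annihilate_mul_annihilate,
    annihilate_mul_create, add_comm (create _ * annihilate _), annihilate_mul_create, smul_zero,
    smul_zero, zero_add, add_zero]
  by_cases h : m.natAbs = n.natAbs
  · rw [if_pos h, if_pos h.symm, ← add_smul]
    rcases lt_trichotomy m 0 with h1 | rfl | h1
    · by_cases h2 : m + n = 0
      · simp [h2, h1.not_ge, h1.not_gt, h1.ne, show 0 ≤ n by omega]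
      · rw [if_neg h2, if_neg (by omega), if_neg (by omega : ¬ 0 ≤ n)]
        simp
    · obtain rfl : n = 0 := by omega
      norm_num
    · by_cases h2 : m + n = 0
      · obtain rfl : n = -m := by omega
        rw [if_pos h2, if_pos h1.le, if_pos h1, if_neg (by omega), if_neg (by omega),
          neg_one_zpow_neg]
        simp
      · rw [if_neg h2, if_pos h1, if_pos (by omega : 0 < n)]
        simp
  · rw [if_neg h, if_neg (Ne.symm h), if_neg (by omega : ¬ m + n = 0), smul_zero, smul_zero,
      add_zero]

theorem phi_phi_add (m n : ℤ) (v : Fock ℕ) :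
    phi m (phi n v) + phi n (phi m v) = if m + n = 0 then ((-1 : ℂ) ^ m) • v else 0 := by
  have := LinearMap.congr_fun (phi_mul_phi m n) v
  split_ifs at this ⊢ <;> exact this

theorem phi_phi_of_ne {m n : ℤ} (h : m + n ≠ 0) (v : Fock ℕ) :
    phi m (phi n v) = -phi n (phi m v) := by
  rw [eq_neg_iff_add_eq_zero, phi_phi_add, if_neg h]

theorem phi_ket_of_forall_lt (i : ℕ) (S : Finset ℕ) (h : ∀ j ∈ S, j < i) :
    phi i (ket S) = ket (insert i S) := by
  obtain rfl | hi := Nat.eq_zero_or_pos i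
  · obtain rfl : S = ∅ := eq_empty_of_forall_notMem fun j hj => by simpa using h j hj
    rw [Nat.cast_zero, phi_zero, LinearMap.add_apply, create_ket_of_forall_lt h,
      LinearMap.smul_apply, annihilate_vacuum, smul_zero, add_zero]
  · rw [phi_natCast_pos hi, create_ket_of_forall_lt h]

theorem phi_ket_eq_zero {n : ℤ} (hn : n < 0) {S : Finset ℕ} (h : (-n).toNat ∉ S) :
    phi n (ket S) = 0 := by
  obtain ⟨a, ha, rfl⟩ : ∃ a : ℕ, 0 < a ∧ n = -(a : ℤ) := ⟨(-n).toNat, by omega, by omega⟩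
  rw [phi_neg_natCast ha, LinearMap.smul_apply, annihilate_ket, if_neg (by simpa using h),
    smul_zero]

theorem phi_vacuum {n : ℤ} (hn : n < 0) : phi n (ket ∅) = 0 :=
  phi_ket_eq_zero hn (notMem_empty _)

theorem phi_apply_empty {n : ℤ} (hn : 0 < n) (v : Fock ℕ) : phi n v ∅ = 0 := by
  rw [phi, if_pos hn, create_apply_empty]

/-- The operator `φ_{-i}` removes the highest mode `i` from a component of a vector. The constant is
exceptional for `i = 0`, since `φ_0` is both a creation and an annihilation operator. -/
theorem phi_neg_apply (i : ℕ) (S : Finset ℕ) (v : Fock ℕ) (h : ∀ j ∈ S, j < i) :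
    phi (-i) v S = (if i = 0 then 2⁻¹ else (-1) ^ i) * v (insert i S) := by
  obtain rfl | hi := Nat.eq_zero_or_pos i
  · obtain rfl : S = ∅ := eq_empty_of_forall_notMem fun j hj => by simpa using h j hj
    rw [Nat.cast_zero, neg_zero, phi_zero, LinearMap.add_apply, Finsupp.add_apply,
      create_apply_empty, LinearMap.smul_apply, Finsupp.smul_apply,
      annihilate_apply_of_forall_lt h, if_pos rfl, zero_add, smul_eq_mul]
  · rw [phi_neg_natCast hi, LinearMap.smul_apply, Finsupp.smul_apply,
      annihilate_apply_of_forall_lt h, if_neg hi.ne', smul_eq_mul]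

theorem parity_phi (n : ℤ) (v : Fock ℕ) : parity (phi n v) = -phi n (parity v) := by
  obtain ⟨a, ha, rfl⟩ | rfl | ⟨a, ha, rfl⟩ := int_cases_pos n
  · rw [phi_natCast_pos ha, parity_create]
  · simp only [phi_zero, LinearMap.add_apply, LinearMap.smul_apply, map_add, map_smul,
      parity_create, parity_annihilate, neg_add, smul_neg]
  · simp only [phi_neg_natCast ha, LinearMap.smul_apply, map_smul, parity_annihilate, smul_neg]

/-- The square lengths of the vectors `ket S` for the form in which `φ_n` and `(-1)^n φ_{-n}` are
adjoint: a factor `⟨0| φ_0 φ_0 |0⟩ = 1/2` appears if the mode `0` is excited. -/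
def neutralNorm (S : Finset ℕ) : ℂ := if 0 ∈ S then 2⁻¹ else 1

theorem neutralNorm_ne_zero (S : Finset ℕ) : neutralNorm S ≠ 0 := by
  rw [neutralNorm]; split_ifs <;> norm_num

/-- The operators `(-1)^n φ_{-n}` and `φ_n` are adjoint for the form in which the states are
orthogonal with norms `neutralNorm`. -/
theorem diagForm_phi (n : ℤ) (x y : Fock ℕ) :
    diagForm neutralNorm (phi n x) y =
      (-1) ^ n * diagForm neutralNorm x (phi (-n) y) := by
  have hpos : ∀ (a : ℕ), 0 < a → ∀ x y : Fock ℕ,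
      diagForm neutralNorm (create a x) y = diagForm neutralNorm x (annihilate a y) := by
    intro a ha x y
    rw [diagForm_create _ a 1, one_smul]
    intro S _
    rw [neutralNorm, neutralNorm, one_mul]
    simp [ha.ne]
  have hzero : ∀ x y : Fock ℕ, diagForm neutralNorm (create 0 x) y =
      diagForm neutralNorm x (((2⁻¹ : ℂ) • annihilate 0) y) := by
    refine diagForm_create _ 0 2⁻¹ fun S hS => ?_
    simp [neutralNorm, hS]
  obtain ⟨a, ha, rfl⟩ | rfl | ⟨a, ha, rfl⟩ := int_cases_pos n
  · rw [phi_natCast_pos ha, phi_neg_natCast ha, LinearMap.smul_apply, map_smul, hpos a ha,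
      zpow_natCast, smul_eq_mul, ← mul_assoc, ← mul_pow]
    simp
  · have h2 := hzero y x
    rw [diagForm_comm, diagForm_comm _ y] at h2
    rw [neg_zero, phi_zero, LinearMap.add_apply, LinearMap.add_apply, map_add, map_add,
      LinearMap.add_apply, hzero, h2, zpow_zero, one_mul, add_comm]
  · rw [neg_neg, phi_natCast_pos ha, phi_neg_natCast ha, LinearMap.smul_apply, map_smul,
      LinearMap.smul_apply, diagForm_comm _ _ y, ← hpos a ha, diagForm_comm _ _ x, smul_eq_mul,
      neg_one_zpow_neg, zpow_natCast]

/-! ### Bilinear expressions in the neutral fermions -/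

/-- The terms of the bilinear expression `∑_n c_n φ_n φ_{K-n}`. -/
def phiBilinear (c : ℤ → ℂ) (K n : ℤ) : Module.End ℂ (Fock ℕ) := c n • (phi n * phi (K - n))

theorem locallyFinite_phiBilinear (c : ℤ → ℂ) {K : ℤ} (hK : K ≠ 0) :
    LocallyFinite (phiBilinear c K) := by
  intro S
  obtain ⟨N, hN⟩ : ∃ N : ℕ, ∀ j ∈ S, j < N := ⟨S.sup id + 1, fun j hj =>
    Nat.lt_succ_of_le (le_sup (f := id) hj)⟩
  refine (Set.finite_Icc (-(N : ℤ)) (N + |K|)).subset fun n hn => ?_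
  by_contra hn'
  rw [Set.mem_Icc, not_and_or, not_le, not_le] at hn'
  apply hn
  change c n • (phi n (phi (K - n) (ket S))) = 0
  have h1 := le_abs_self K
  have h2 := abs_nonneg K
  rcases hn' with h | h
  · rw [phi_phi_of_ne (by omega), phi_ket_eq_zero (by omega) fun h' => ?_]
    · simp
    · have := hN _ h'; omega
  · rw [phi_ket_eq_zero (n := K - n) (by omega) fun h' => ?_]
    · simp
    · have := hN _ h'; omega

theorem sumOp_phiBilinear_phi (c : ℤ → ℂ) {K : ℤ} (hK : K ≠ 0) (m : ℤ) (v : Fock ℕ) :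
    sumOp (phiBilinear c K) (phi m v) = phi m (sumOp (phiBilinear c K) v) +
      ((-1) ^ m * (c (m + K) - c (-m))) • phi (m + K) v := by
  rw [← sub_eq_iff_eq_add', (locallyFinite_phiBilinear c hK).commutator_apply]
  have h1 : ∀ n, phiBilinear c K n (phi m v) - phi m (phiBilinear c K n v) =
      (if n = m + K then ((-1) ^ m * c (m + K)) • phi (m + K) v else 0) -
        (if n = -m then ((-1) ^ m * c (-m)) • phi (m + K) v else 0) := by
    intro n
    change c n • phi n (phi (K - n) (phi m v)) - phi m (c n • phi n (phi (K - n) v)) = _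
    have h2 := phi_phi_add (K - n) m v
    have h3 := phi_phi_add m n (phi (K - n) v)
    have h4 : phi n (phi (K - n) (phi m v)) - phi m (phi n (phi (K - n) v)) =
        phi n (if K - n + m = 0 then ((-1 : ℂ) ^ (K - n)) • v else 0) -
          if m + n = 0 then ((-1 : ℂ) ^ m) • phi (K - n) v else 0 := by
      rw [← h2, ← h3, map_add]
      abel
    rw [map_smul, ← smul_sub, h4, smul_sub]
    congr 1
    · by_cases h : n = m + K
      · subst h
        rw [if_pos (by ring), if_pos rfl, map_smul, smul_smul,
          show K - (m + K) = -m by ring, neg_one_zpow_neg, mul_comm]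
      · rw [if_neg (by omega), if_neg h, map_zero, smul_zero]
    · by_cases h : n = -m
      · subst h
        rw [if_pos (by ring), if_pos rfl, smul_smul, show K - -m = m + K by ring, mul_comm]
      · rw [if_neg (by omega), if_neg h, smul_zero]
  rw [finsum_congr h1, finsum_sub_distrib, finsum_eq_single _ (m + K), finsum_eq_single _ (-m),
    if_pos rfl, if_pos rfl, ← sub_smul, mul_sub]
  · intro n hn; rw [if_neg hn]
  · intro n hn; rw [if_neg hn]
  · refine (Set.finite_singleton (m + K)).subset fun n hn => ?_
    by_contra h
    exact hn (if_neg h)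
  · refine (Set.finite_singleton (-m)).subset fun n hn => ?_
    by_contra h
    exact hn (if_neg h)

theorem hamB_eq (k : ℕ) :
    hamB k = (2⁻¹ : ℂ) • sumOp (phiBilinear (fun n => (-1) ^ (n + 1)) (-k)) := by
  rw [hamB]
  congr 2
  funext n
  rw [phiBilinear, show -n - (k : ℤ) = -k - n by ring]

theorem opB_eq (r : ℤ → ℂ) (k : ℕ) :
    opB r k = (2⁻¹ : ℂ) • sumOp (phiBilinear (fun n => (-1) ^ n * rProd r n k) k) := rfl

/-- The commutation relation `[H_k, φ_m] = φ_{m-k}`. -/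
theorem hamB_phi {k : ℕ} (hk : Odd k) (m : ℤ) (v : Fock ℕ) :
    hamB k (phi m v) = phi m (hamB k v) + phi (m - k) v := by
  have hk0 : -(k : ℤ) ≠ 0 := by have := hk.pos; omega
  rw [hamB_eq, LinearMap.smul_apply, sumOp_phiBilinear_phi _ hk0, smul_add, LinearMap.smul_apply,
    map_smul, smul_smul, ← sub_eq_add_neg]
  have h : (2⁻¹ : ℂ) * ((-1) ^ m * ((-1) ^ (m - k + 1) - (-1) ^ (-m + 1))) = 1 := by
    rw [neg_one_zpow_add, neg_one_zpow_add, neg_one_zpow_sub, neg_one_zpow_neg,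
      neg_one_zpow_odd hk]
    linear_combination neg_one_zpow_mul_self m
  rw [h, one_smul]

/-- The form in which the symmetry `r(n) = r(1-n)` enters: the coefficients of `B_k` are invariant
under the exchange of the two fermions. -/
theorem rProd_neg {r : ℤ → ℂ} (hr : ∀ n, r n = r (1 - n)) (m : ℤ) (k : ℕ) :
    rProd r (-m) k = rProd r (m + k) k := by
  rw [rProd, rProd, ← prod_range_reflect]
  refine prod_congr rfl fun j hj => ?_
  rw [hr]
  congr 1
  have := mem_range.1 hj
  omega

/-- The commutation relation `[B_k, φ_m] = -r(m+k) ⋯ r(m+1) φ_{m+k}`; the symmetry of `r` makes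
the two contributions of the bilinear expression equal. -/
theorem opB_phi {r : ℤ → ℂ} (hr : ∀ n, r n = r (1 - n)) {k : ℕ} (hk : Odd k) (m : ℤ)
    (v : Fock ℕ) :
    opB r k (phi m v) = phi m (opB r k v) + (-rProd r (m + k) k) • phi (m + k) v := by
  have hk0 : (k : ℤ) ≠ 0 := by have := hk.pos; omega
  rw [opB_eq, LinearMap.smul_apply, sumOp_phiBilinear_phi _ hk0, smul_add, LinearMap.smul_apply,
    map_smul, smul_smul]
  congr 2
  rw [neg_one_zpow_add, neg_one_zpow_neg, neg_one_zpow_odd hk, rProd_neg hr]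
  linear_combination (-rProd r (m + k) k) * neg_one_zpow_mul_self m

theorem rProd_add (r : ℤ → ℂ) (m : ℤ) (k l : ℕ) :
    rProd r (m + l + k) (k + l) = rProd r (m + l + k) k * rProd r (m + l) l := by
  rw [rProd, prod_range_add, rProd, rProd]
  congr 1
  refine prod_congr rfl fun j _ => ?_
  congr 1
  push_cast
  ring

theorem hamB_vacuum {k : ℕ} (hk : Odd k) : hamB k (ket ∅) = 0 := by
  have hk0 : -(k : ℤ) ≠ 0 := by have := hk.pos; omega
  rw [hamB_eq, LinearMap.smul_apply, (locallyFinite_phiBilinear _ hk0).sumOp_apply,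
    finsum_eq_zero_of_forall_eq_zero, smul_zero]
  intro n
  change (_ : ℂ) • phi n (phi (-k - n) (ket ∅)) = 0
  have := hk.pos
  by_cases h : -(k : ℤ) - n < 0
  · rw [phi_vacuum h, map_zero, smul_zero]
  · rw [phi_phi_of_ne (by omega), phi_vacuum (by omega), map_zero, neg_zero, smul_zero]

theorem opB_apply_empty (r : ℤ → ℂ) {k : ℕ} (hk : Odd k) (v : Fock ℕ) : opB r k v ∅ = 0 := by
  have hk0 : (k : ℤ) ≠ 0 := by have := hk.pos; omega
  rw [opB_eq, LinearMap.smul_apply, Finsupp.smul_apply,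
    (locallyFinite_phiBilinear _ hk0).sumOp_apply_apply, finsum_eq_zero_of_forall_eq_zero,
    smul_zero]
  intro n
  change ((_ : ℂ) • phi n (phi (k - n) v)) ∅ = 0
  have := hk.pos
  by_cases h : 0 < n
  · rw [Finsupp.smul_apply, phi_apply_empty h, smul_zero]
  · rw [phi_phi_of_ne (by omega), Finsupp.smul_apply, Finsupp.neg_apply,
      phi_apply_empty (by omega), neg_zero, smul_zero]

theorem commute_hamB {k l : ℕ} (hk : Odd k) (hl : Odd l) : Commute (hamB k) (hamB l) := by
  refine sub_eq_zero.1 (eq_zero_of_commute_creation (fun i : ℕ => phi i) phi_ket_of_forall_lt _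
    (fun i => commute_commutator_of_shift phi (hamB k) (hamB l) 1 1 (-k) (-l) ?_ ?_ ?_ i) ?_)
  · intro m
    exact LinearMap.ext fun v => (hamB_phi hk m v).trans (by simp [sub_eq_add_neg])
  · intro m
    exact LinearMap.ext fun v => (hamB_phi hl m v).trans (by simp [sub_eq_add_neg])
  · intro m; rfl
  · change hamB k (hamB l (ket ∅)) - hamB l (hamB k (ket ∅)) = 0
    rw [hamB_vacuum hk, hamB_vacuum hl, map_zero, map_zero, sub_zero]

theorem commute_opB {r : ℤ → ℂ} (hr : ∀ n, r n = r (1 - n)) {k l : ℕ} (hk : Odd k) (hl : Odd l) :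
    Commute (opB r k) (opB r l) := by
  refine sub_eq_zero.1 (eq_zero_of_commute_annihilation (fun i : ℕ => phi (-i))
    (fun i => if i = 0 then 2⁻¹ else (-1) ^ i) (fun i => ?_)
    (fun i S v h => phi_neg_apply i S v h) _
    (fun i => commute_commutator_of_shift phi (opB r k) (opB r l) (fun m => -rProd r (m + k) k)
      (fun m => -rProd r (m + l) l) k l ?_ ?_ ?_ _) ?_)
  · split_ifs
    · norm_num
    · exact pow_ne_zero _ (by norm_num)
  · exact fun m => LinearMap.ext fun v => opB_phi hr hk m v
  · exact fun m => LinearMap.ext fun v => opB_phi hr hl m v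
  · intro m
    have h1 := rProd_add r m k l
    have h2 := rProd_add r m l k
    rw [add_right_comm m (k : ℤ) l, add_comm l k] at h2
    simp only [neg_mul_neg]
    rw [mul_comm, ← h1, h2, add_right_comm, mul_comm]
  · intro v
    change (opB r k (opB r l v) - opB r l (opB r k v)) ∅ = 0
    rw [Finsupp.sub_apply, opB_apply_empty r hk, opB_apply_empty r hl, sub_zero]

theorem parity_sumOp_phiBilinear (c : ℤ → ℂ) {K : ℤ} (hK : K ≠ 0) (v : Fock ℕ) :
    parity (sumOp (phiBilinear c K) v) = sumOp (phiBilinear c K) (parity v) := by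
  refine (LinearMap.congr_fun ((locallyFinite_phiBilinear c hK).commute parity fun n =>
    LinearMap.ext fun v => ?_) v).symm
  change c n • phi n (phi (K - n) (parity v)) = parity (c n • phi n (phi (K - n) v))
  rw [map_smul, parity_phi, parity_phi, map_neg, neg_neg]

theorem parity_hamB {k : ℕ} (hk : Odd k) (v : Fock ℕ) :
    parity (hamB k v) = hamB k (parity v) := by
  have hk0 : -(k : ℤ) ≠ 0 := by have := hk.pos; omega
  rw [hamB_eq, LinearMap.smul_apply, map_smul, parity_sumOp_phiBilinear _ hk0,
    LinearMap.smul_apply]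

theorem parity_opB (r : ℤ → ℂ) {k : ℕ} (hk : Odd k) (v : Fock ℕ) :
    parity (opB r k v) = opB r k (parity v) := by
  have hk0 : (k : ℤ) ≠ 0 := by have := hk.pos; omega
  rw [opB_eq, LinearMap.smul_apply, map_smul, parity_sumOp_phiBilinear _ hk0,
    LinearMap.smul_apply]

/-- For `r = 1`, the operators `-B_k` are adjoint to the Hamiltonians `H_k`. -/
theorem diagForm_opB_one {k : ℕ} (hk : Odd k) (x y : Fock ℕ) :
    diagForm neutralNorm (-opB 1 k x) y = diagForm neutralNorm x (hamB k y) := by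
  have hk0 : (k : ℤ) ≠ 0 := by have := hk.pos; omega
  rw [opB_eq, hamB_eq, ← neg_one_smul ℂ, LinearMap.smul_apply, LinearMap.smul_apply, smul_smul,
    map_smul, map_smul, LinearMap.smul_apply, smul_eq_mul, smul_eq_mul]
  have h1 := (locallyFinite_phiBilinear (fun n => (-1) ^ n * rProd 1 n k) hk0).map_sumOp_apply
    ((diagForm neutralNorm).flip y) x
  have h2 := (locallyFinite_phiBilinear (fun n => (-1) ^ (n + 1))
    (neg_ne_zero.2 hk0)).map_sumOp_apply (diagForm neutralNorm x) y
  rw [LinearMap.flip_apply] at h1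
  rw [h1, h2, ← finsum_comp_equiv (Equiv.subRight (k : ℤ))
    (f := fun n => diagForm neutralNorm x (phiBilinear (fun n => (-1) ^ (n + 1)) (-k) n y)),
    neg_one_mul, neg_mul, ← mul_neg]
  congr 1
  rw [← finsum_neg_distrib]
  refine finsum_congr fun n => ?_
  rw [LinearMap.flip_apply, Equiv.subRight_apply]
  change -(diagForm neutralNorm (((-1) ^ n * rProd 1 n k) • phi n (phi (k - n) x)) y) =
    diagForm neutralNorm x (((-1) ^ (n - k + 1) : ℂ) • phi (n - k) (phi (-k - (n - k)) y))
  rw [map_smul, map_smul, LinearMap.smul_apply, diagForm_phi, diagForm_phi, smul_eq_mul,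
    smul_eq_mul, show -((k : ℤ) - n) = n - k by ring, show -(k : ℤ) - (n - k) = -n by ring,
    neg_one_zpow_add, neg_one_zpow_sub, neg_one_zpow_sub, neg_one_zpow_odd hk]
  have h3 : rProd 1 n k = 1 := by simp [rProd]
  rw [h3]
  linear_combination (-1 : ℂ) ^ n * (diagForm neutralNorm x (phi (n - k) (phi (-n) y))) *
    neg_one_zpow_mul_self n

/-! ### The weights of strict partitions -/

/-- The weight `r(1) r(2) ⋯ r(n)` of a part `n`. -/
def partWeight (r : ℤ → ℂ) (n : ℕ) : ℂ := ∏ j ∈ Icc 1 n, r j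

theorem partWeight_zero (r : ℤ → ℂ) : partWeight r 0 = 1 := by simp [partWeight]

theorem partWeight_add (r : ℤ → ℂ) (p k : ℕ) :
    partWeight r (p + k) = rProd r (p + k) k * partWeight r p := by
  induction k with
  | zero => simp [rProd]
  | succ k ih =>
    rw [← add_assoc, partWeight, prod_Icc_succ_top (by omega), ← partWeight, ih, rProd, rProd,
      prod_range_succ']
    push_cast
    simp only [sub_zero, add_sub_add_right_eq_sub, ← add_assoc]
    ring

/-- The diagonal operator whose eigenvalue on `ket S` is the product of the weights of the
elements of `S`. -/
def neutralWeightOp (r : ℤ → ℂ) : Module.End ℂ (Fock ℕ) :=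
  diagOp fun S => ∏ n ∈ S, partWeight r n

theorem neutralWeightOp_phi (r : ℤ → ℂ) (n : ℕ) (v : Fock ℕ) :
    neutralWeightOp r (phi n v) = partWeight r n • phi n (neutralWeightOp r v) := by
  have hc := LinearMap.congr_fun (diagOp_create (partWeight r) n) v
  have ha := LinearMap.congr_fun (diagOp_annihilate (partWeight r) n) v
  obtain rfl | hn := Nat.eq_zero_or_pos n
  · rw [partWeight_zero, one_smul] at hc ha ⊢
    rw [Nat.cast_zero, phi_zero, LinearMap.add_apply, LinearMap.smul_apply, map_add, map_smul]
    exact congrArg₂ (fun a b => a + (2⁻¹ : ℂ) • b) hc ha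
  · rw [phi_natCast_pos hn]
    exact hc

theorem neutralWeightOp_phi_neg (r : ℤ → ℂ) (n : ℕ) (v : Fock ℕ) :
    partWeight r n • neutralWeightOp r (phi (-n) v) = phi (-n) (neutralWeightOp r v) := by
  obtain rfl | hn := Nat.eq_zero_or_pos n
  · have := neutralWeightOp_phi r 0 v
    rw [partWeight_zero, one_smul] at this ⊢
    exact this
  · have ha := LinearMap.congr_fun (diagOp_annihilate (partWeight r) n) v
    rw [phi_neg_natCast hn, LinearMap.smul_apply, LinearMap.smul_apply, map_smul, smul_comm]
    exact congrArg _ ha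

/-- Moving the diagonal operator of the weights `r(1) ⋯ r(n)` past `φ_n φ_{k-n}` produces the
coefficient of this product in `B_k`, so that the operator takes `B_k` for the constant `r = 1` to
`B_k`. -/
theorem neutralWeightOp_phi_phi {r : ℤ → ℂ} (hr : ∀ n, r n = r (1 - n)) {k : ℕ} (hk : 0 < k)
    (n : ℤ) (v : Fock ℕ) :
    neutralWeightOp r (phi n (phi (k - n) v)) =
      rProd r n k • phi n (phi (k - n) (neutralWeightOp r v)) := by
  -- It suffices to consider `n ≥ k - n`, as both sides are antisymmetric.
  have h0 : ∀ n : ℤ, (k : ℤ) - n ≤ n → neutralWeightOp r (phi n (phi (k - n) v)) =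
      rProd r n k • phi n (phi (k - n) (neutralWeightOp r v)) := by
    intro n hn
    obtain ⟨a, rfl⟩ : ∃ a : ℕ, n = a := ⟨n.toNat, by omega⟩
    rcases le_total a k with h | h
    · obtain ⟨b, rfl⟩ := Nat.exists_eq_add_of_le h
      rw [show ((a + b : ℕ) : ℤ) - a = b by push_cast; ring, neutralWeightOp_phi,
        neutralWeightOp_phi, map_smul, smul_smul]
      congr 1
      have h1 := rProd_add r (-b) a b
      have h2 := rProd_neg hr 0 b
      have h3 := partWeight_add r 0 a
      have h4 := partWeight_add r 0 b
      simp only [neg_add_cancel, neg_zero, zero_add, Nat.cast_zero, partWeight_zero,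
        mul_one] at h1 h2 h3 h4
      rw [h1, h2, h3, h4]
    · obtain ⟨p, rfl⟩ := Nat.exists_eq_add_of_le' h
      rw [show (k : ℤ) - ((p + k : ℕ) : ℤ) = -p by push_cast; ring, neutralWeightOp_phi,
        partWeight_add, ← neutralWeightOp_phi_neg, map_smul, smul_smul]
      push_cast
      rfl
  rcases le_total ((k : ℤ) - n) n with h | h
  · exact h0 n h
  · have h1 := h0 (k - n) (by omega)
    rw [sub_sub_cancel] at h1
    rw [phi_phi_of_ne (by omega), phi_phi_of_ne (m := n) (by omega), map_neg, h1, smul_neg]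
    congr 2
    have := rProd_neg hr (-n) k
    rw [neg_neg, neg_add_eq_sub] at this
    exact this.symm

theorem opB_neutralWeightOp {r : ℤ → ℂ} (hr : ∀ n, r n = r (1 - n)) {k : ℕ} (hk : Odd k)
    (v : Fock ℕ) : opB r k (neutralWeightOp r v) = neutralWeightOp r (opB 1 k v) := by
  have hk0 : (k : ℤ) ≠ 0 := by have := hk.pos; omega
  rw [opB_eq, opB_eq, LinearMap.smul_apply, LinearMap.smul_apply, map_smul,
    (locallyFinite_phiBilinear _ hk0).sumOp_apply,
    (locallyFinite_phiBilinear _ hk0).map_sumOp_apply]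
  congr 1
  refine finsum_congr fun n => ?_
  change ((-1) ^ n * rProd r n k) • phi n (phi (k - n) (neutralWeightOp r v)) =
    neutralWeightOp r (((-1) ^ n * rProd 1 n k) • phi n (phi (k - n) v))
  have h3 : rProd 1 n k = 1 := by simp [rProd]
  rw [map_smul, neutralWeightOp_phi_phi hr hk.pos, h3, mul_one, smul_smul]

/-! ### Alternating sums over lists and Pfaffians -/

section ListSums

variable {α β M N : Type}

/-- The alternating sum `∑_i (-1)^i F(l_i, l ∖ l_i)` over the entries of a list. -/
def altSum [AddCommGroup M] : (α → List α → M) → List α → M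
  | _, [] => 0
  | F, b :: l => F b l - altSum (fun c m => F c (b :: m)) l

/-- The sum of the values of `G` at the lists obtained from `l` by lowering one entry by `k`. -/
def shiftSum [AddCommMonoid M] (k : ℤ) : (List ℤ → M) → List ℤ → M
  | _, [] => 0
  | G, a :: l => G ((a - k) :: l) + shiftSum k (fun m => G (a :: m)) l

theorem altSum_eq_sum [AddCommGroup M] (F : α → List α → M) (l : List α) :
    altSum F l = ∑ i : Fin l.length, (-1 : ℤ) ^ (i : ℕ) • F l[i] (l.eraseIdx i) := by
  induction l generalizing F with
  | nil => simp [altSum]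
  | cons b l ih =>
    rw [altSum, ih]
    refine Eq.trans ?_ (Fin.sum_univ_succ (n := l.length) _).symm
    simp [pow_succ, sub_eq_add_neg]

theorem altSum_congr [AddCommGroup M] {F G : α → List α → M} {l : List α}
    (h : ∀ c m, m.length < l.length → F c m = G c m) : altSum F l = altSum G l := by
  induction l generalizing F G with
  | nil => rfl
  | cons b l ih =>
    rw [altSum, altSum, h b l (by simp),
      ih fun c m hm => h c (b :: m) (by simpa using hm)]

theorem altSum_add [AddCommGroup M] (F G : α → List α → M) (l : List α) :
    altSum (fun c m => F c m + G c m) l = altSum F l + altSum G l := by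
  induction l generalizing F G with
  | nil => simp [altSum]
  | cons b l ih => rw [altSum, altSum, altSum, ih]; abel

theorem map_altSum [AddCommGroup M] [AddCommGroup N] (f : M →+ N) (F : α → List α → M)
    (l : List α) : f (altSum F l) = altSum (fun c m => f (F c m)) l := by
  induction l generalizing F with
  | nil => simp [altSum]
  | cons b l ih => rw [altSum, altSum, map_sub, ih]

theorem altSum_map [AddCommGroup M] (g : α → β) (F : β → List β → M) (l : List α) :
    altSum F (l.map g) = altSum (fun c m => F (g c) (m.map g)) l := by
  induction l generalizing F with
  | nil => rfl
  | cons b l ih => rw [List.map_cons, altSum, altSum, ih]; rfl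

theorem map_shiftSum [AddCommMonoid M] [AddCommMonoid N] (f : M →+ N) (k : ℤ) (G : List ℤ → M)
    (l : List ℤ) : f (shiftSum k G l) = shiftSum k (fun m => f (G m)) l := by
  induction l generalizing G with
  | nil => simp [shiftSum]
  | cons b l ih => rw [shiftSum, shiftSum, map_add, ih]

theorem shiftSum_sub [AddCommGroup M] (k : ℤ) (F G : List ℤ → M) (l : List ℤ) :
    shiftSum k (fun m => F m - G m) l = shiftSum k F l - shiftSum k G l := by
  induction l generalizing F G with
  | nil => simp [shiftSum]
  | cons b l ih => rw [shiftSum, shiftSum, shiftSum, ih]; abel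

theorem shiftSum_mem_span [AddCommGroup M] [Module ℂ M] (k : ℤ) (G : List ℤ → M) (s : Set M)
    (h : ∀ l, G l ∈ s) (l : List ℤ) : shiftSum k G l ∈ Submodule.span ℂ s := by
  induction l generalizing G with
  | nil => exact zero_mem _
  | cons b l ih =>
    exact add_mem (Submodule.subset_span (h _)) (ih _ fun m => h _)

theorem shiftSum_altSum [AddCommGroup M] (k : ℤ) (F : ℤ → List ℤ → M) (l : List ℤ) :
    shiftSum k (altSum F) l = altSum (fun c m => F (c - k) m + shiftSum k (F c) m) l := by
  induction l generalizing F with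
  | nil => rfl
  | cons b l ih =>
    have h : (fun m => altSum F (b :: m)) =
        fun m => F b m - altSum (fun c m' => F c (b :: m')) m := rfl
    rw [shiftSum, altSum, altSum, h, shiftSum_sub, ih]
    simp only [shiftSum]
    rw [altSum_add, altSum_add, altSum_add]
    abel

/-- Moving an operator `y` to the right through a product of operators `x_c` with which it has
scalar anticommutators `κ_c`. -/
theorem mul_prod_map_eq_altSum {R : Type} [Ring R] [Algebra ℂ R] (x : α → R) (y : R) (κ : α → ℂ)
    (h : ∀ c, y * x c + x c * y = κ c • 1) (l : List α) :
    y * (l.map x).prod = altSum (fun c m => κ c • (m.map x).prod) l +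
      (-1 : ℤ) ^ l.length • ((l.map x).prod * y) := by
  induction l with
  | nil => simp [altSum]
  | cons b l ih =>
    have h1 : altSum (fun c m => κ c • (List.map x (b :: m)).prod) l =
        x b * altSum (fun c m => κ c • (m.map x).prod) l := by
      refine Eq.trans ?_ (map_altSum (AddMonoidHom.mulLeft (x b)) _ l).symm
      simp
    rw [altSum, h1, List.map_cons, List.prod_cons, ← mul_assoc, eq_sub_of_add_eq (h b), sub_mul,
      smul_mul_assoc, one_mul, mul_assoc, ih, mul_add, List.length_cons, pow_succ, mul_smul_comm,
      mul_assoc]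
    simp only [mul_neg, mul_one, neg_smul]
    abel

theorem apply_prod_map_eq_altSum {ι : Type} (x : α → Module.End ℂ (Fock ι))
    (y : Module.End ℂ (Fock ι)) (κ : α → ℂ) (h : ∀ c, y * x c + x c * y = κ c • 1) (l : List α) :
    y ((l.map x).prod (ket ∅)) ∅ = altSum (fun c m => κ c * (m.map x).prod (ket ∅) ∅) l +
      (-1) ^ l.length * (l.map x).prod (y (ket ∅)) ∅ := by
  let ev : Module.End ℂ (Fock ι) →+ ℂ :=
    (Finsupp.lapply ∅ ∘ₗ LinearMap.applyₗ (R := ℂ) (ket ∅)).toAddMonoidHom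
  have h1 := congrArg ev (mul_prod_map_eq_altSum x y κ h l)
  have h2 := map_altSum ev (fun c m => κ c • (m.map x).prod) l
  rw [map_add, map_zsmul, zsmul_eq_mul] at h1
  push_cast at h1
  exact h1.trans (congrArg (· + _) h2)

end ListSums

section Pfaffian

variable {α R : Type} [CommRing R]

/-- The Pfaffian of the skew-symmetric matrix with entries `f (l i) (l j)`, `i < j`, above the
diagonal, for a list with entries in an arbitrary type. -/
def pfaff (f : α → α → R) : List α → R
  | [] => 1
  | a :: l => ∑ i : Fin l.length, (-1) ^ (i : ℕ) * f a l[i] * pfaff f (l.eraseIdx i)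
termination_by l => l.length
decreasing_by
  have := i.isLt
  simp only [List.length_eraseIdx, List.length_cons]
  split <;> omega

theorem pfaff_nil (f : α → α → R) : pfaff f [] = 1 := by rw [pfaff]

theorem pfaff_cons (f : α → α → R) (a : α) (l : List α) :
    pfaff f (a :: l) = altSum (fun c m => f a c * pfaff f m) l := by
  rw [pfaff, altSum_eq_sum]
  refine sum_congr rfl fun i _ => ?_
  simp [zsmul_eq_mul, mul_assoc]

/-- A function on lists which satisfies the recursion of Pfaffians is a Pfaffian. -/
theorem eq_pfaff (f : α → α → R) (g : List α → R) (h0 : g [] = 1)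
    (h : ∀ a l, g (a :: l) = altSum (fun c m => f a c * g m) l) (l : List α) : g l = pfaff f l := by
  induction hn : l.length using Nat.strong_induction_on generalizing l with
  | _ n ih =>
    cases l with
    | nil => rw [h0, pfaff_nil]
    | cons a l =>
      rw [h, pfaff_cons]
      refine altSum_congr fun c m hm => ?_
      rw [ih m.length (by rw [← hn, List.length_cons]; omega) m rfl]

theorem pfaffian_eq_pfaff {β : Type} (g : ℕ → β) (f : β → β → R) (l : List ℕ) :
    pfaffian (fun a b => f (g a) (g b)) l = pfaff f (l.map g) := by
  symm
  induction hn : l.length using Nat.strong_induction_on generalizing l with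
  | _ n ih =>
    cases l with
    | nil => rw [List.map_nil, pfaff_nil, pfaffian]
    | cons a l =>
      rw [List.map_cons, pfaff_cons, altSum_map, pfaffian, altSum_eq_sum]
      refine sum_congr rfl fun i _ => ?_
      rw [ih _ _ _ rfl]
      · simp [zsmul_eq_mul, mul_assoc]
      · rw [← hn, List.length_cons, List.length_eraseIdx]
        split <;> omega

theorem map_pfaff {R' : Type} [CommRing R'] (φ : R →+* R') (f : α → α → R) (l : List α) :
    φ (pfaff f l) = pfaff (fun a b => φ (f a b)) l := by
  refine eq_pfaff _ (fun l => φ (pfaff f l)) (by simp [pfaff_nil]) (fun a l => ?_) l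
  rw [pfaff_cons]
  refine (map_altSum φ.toAddMonoidHom _ l).trans ?_
  simp

theorem pfaff_mul_left (c : R) (f : α → α → R) (n : ℕ) (l : List α) (hl : l.length = 2 * n) :
    pfaff (fun a b => c * f a b) l = c ^ n * pfaff f l := by
  induction n generalizing l with
  | zero =>
    obtain rfl := List.length_eq_zero_iff.1 hl
    simp [pfaff_nil]
  | succ n ih =>
    cases l with
    | nil => simp at hl
    | cons a l =>
      rw [pfaff_cons, pfaff_cons, altSum_eq_sum, altSum_eq_sum, mul_sum]
      refine sum_congr rfl fun i _ => ?_
      rw [ih]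
      · rw [mul_smul_comm]
        congr 1
        ring
      · have := i.isLt
        rw [List.length_cons] at hl
        rw [List.length_eraseIdx, if_pos this]
        omega

/-- Pfaffians satisfy the Leibniz rule: if a derivation shifts each index of the entries, up to a
factor `ε`, it shifts the entries of the list, up to the same factor. -/
theorem derivation_pfaff [Algebra ℂ R] (D : Derivation ℂ R R) (k : ℤ) (ε : ℂ)
    (f : ℤ → ℤ → R) (hf : ∀ a b, D (f a b) = ε • (f (a - k) b + f a (b - k))) (l : List ℤ) :
    D (pfaff f l) = ε • shiftSum k (pfaff f) l := by
  induction hn : l.length using Nat.strong_induction_on generalizing l with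
  | _ n ih =>
    cases l with
    | nil => simp [pfaff_nil, shiftSum]
    | cons a l =>
      have h1 : (fun m => pfaff f (a :: m)) = altSum fun c m => f a c * pfaff f m :=
        funext fun m => pfaff_cons f a m
      rw [shiftSum, h1, shiftSum_altSum, pfaff_cons, pfaff_cons, ← altSum_add]
      refine ((map_altSum (D : R →ₗ[ℂ] R).toAddMonoidHom _ l).trans
        (altSum_congr fun c m hm => ?_)).trans
        (map_altSum (LinearMap.lsmul ℂ R ε).toAddMonoidHom _ l).symm
      have h2 : shiftSum k (fun m => f a c * pfaff f m) m = f a c * shiftSum k (pfaff f) m :=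
        (map_shiftSum (AddMonoidHom.mulLeft (f a c)) k _ m).symm
      have h3 : D (f a c * pfaff f m) = f a c * D (pfaff f m) + pfaff f m * D (f a c) := by
        rw [D.leibniz, smul_eq_mul, smul_eq_mul]
      change D (f a c * pfaff f m) = ε • (_ : R)
      rw [h3, h2, hf, ih m.length (by rw [← hn, List.length_cons]; omega) m rfl, mul_smul_comm,
        mul_smul_comm, ← smul_add]
      congr 1
      ring

end Pfaffian

/-! ### Complete symmetric functions of the times -/

section Times

variable {σ : Type}

/-- The power series `t_m` are times without constant coefficient, and the variable `s` contributes
to `t_{χ(s)}` with coefficient `1`, and to no other `t_m`. -/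
structure IsTimes (t : ℕ+ → MvPowerSeries σ ℂ) (χ : σ → ℕ) : Prop where
  coeff_zero : ∀ m, coeff 0 (t m) = 0
  pderiv : ∀ s m, pderiv ℂ s (t m) = if χ s = m then 1 else 0

theorem hSym_eq_sum {R : Type} [CommRing R] [Algebra ℂ R] (t : ℕ+ → R) {n N : ℕ} (h : n < N) :
    hSym t n = ∑ k ∈ range N, ((Nat.factorial k : ℂ)⁻¹) • PowerSeries.coeff n
      ((PowerSeries.mk fun m => if h : 0 < m then t ⟨m, h⟩ else 0) ^ k) := by
  refine coeff_formalExp (σ := Unit) _ ?_ _ N (by simpa using h)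
  exact (PowerSeries.coeff_zero_eq_constantCoeff_apply _).symm.trans
    ((PowerSeries.coeff_mk 0 fun m => if h : 0 < m then t ⟨m, h⟩ else 0).trans
      (dif_neg (lt_irrefl 0)))

theorem IsTimes.coeff_zero_hSym {t : ℕ+ → MvPowerSeries σ ℂ} {χ : σ → ℕ} (ht : IsTimes t χ)
    (n : ℕ) : coeff 0 (hSym t n) = if n = 0 then 1 else 0 := by
  rw [hSym_eq_sum t n.lt_succ_self, map_sum, sum_eq_single 0]
  · rw [pow_zero, PowerSeries.coeff_one]
    split_ifs <;> simp
  · intro k _ hk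
    have h1 : PowerSeries.map (constantCoeff (σ := σ) (R := ℂ))
        (PowerSeries.mk fun m => if h : 0 < m then t ⟨m, h⟩ else 0) = 0 := by
      ext m
      rw [PowerSeries.coeff_map, PowerSeries.coeff_mk]
      split_ifs with h
      · exact ht.coeff_zero _
      · exact map_zero _
    have h2 := congrArg (PowerSeries.coeff n) (congrArg (· ^ k) h1)
    rw [zero_pow hk, map_zero] at h2
    simp only [← map_pow] at h2
    rw [PowerSeries.coeff_map] at h2
    rw [MvPowerSeries.coeff_smul]
    exact mul_eq_zero_of_right _ h2
  · simp

/-- The extension of a derivation of `R` to the power series over `R`, coefficient by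
coefficient. -/
def coeffwise {R : Type} [CommRing R] [Algebra ℂ R] (D : Derivation ℂ R R) (f : PowerSeries R) :
    PowerSeries R := PowerSeries.mk fun n => D (PowerSeries.coeff n f)

theorem coeffwise_mul {R : Type} [CommRing R] [Algebra ℂ R] (D : Derivation ℂ R R)
    (f g : PowerSeries R) : coeffwise D (f * g) = coeffwise D f * g + f * coeffwise D g := by
  ext n
  rw [coeffwise, PowerSeries.coeff_mk, map_add, PowerSeries.coeff_mul, PowerSeries.coeff_mul,
    PowerSeries.coeff_mul, ← sum_add_distrib, map_sum]
  refine sum_congr rfl fun p _ => ?_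
  rw [D.leibniz, coeffwise, coeffwise, PowerSeries.coeff_mk, PowerSeries.coeff_mk, smul_eq_mul,
    smul_eq_mul]
  ring

theorem coeffwise_pow_succ {R : Type} [CommRing R] [Algebra ℂ R] (D : Derivation ℂ R R)
    (f : PowerSeries R) (k : ℕ) :
    coeffwise D (f ^ (k + 1)) = (k + 1 : ℂ) • (f ^ k * coeffwise D f) := by
  induction k with
  | zero => simp
  | succ k ih =>
    rw [pow_succ, coeffwise_mul, ih, smul_mul_assoc, pow_succ]
    push_cast
    rw [add_smul (k + 1 : ℂ) 1, one_smul, mul_right_comm]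

theorem IsTimes.pderiv_hSym {t : ℕ+ → MvPowerSeries σ ℂ} {χ : σ → ℕ} (ht : IsTimes t χ)
    (s : σ) (n : ℕ) : MvPowerSeries.pderiv ℂ s (hSym t n) =
      if χ s = 0 ∨ n < χ s then 0 else hSym t (n - χ s) := by
  set D := MvPowerSeries.pderiv ℂ s
  set T : PowerSeries (MvPowerSeries σ ℂ) :=
    PowerSeries.mk fun m => if h : 0 < m then t ⟨m, h⟩ else 0 with hT
  have hDT : coeffwise D T = if χ s = 0 then 0 else PowerSeries.X ^ χ s := by
    ext m : 1
    rw [coeffwise, PowerSeries.coeff_mk, hT, PowerSeries.coeff_mk]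
    split_ifs with h1 h2 h2
    · refine (ht.pderiv s ⟨m, h1⟩).trans ?_
      rw [if_neg (by rw [h2]; exact h1.ne), map_zero]
    · refine (ht.pderiv s ⟨m, h1⟩).trans ?_
      rw [PowerSeries.coeff_X_pow]
      exact if_congr eq_comm rfl rfl
    · simp
    · rw [PowerSeries.coeff_X_pow, if_neg (by omega), map_zero]
  have h1 : D (hSym t n) = ∑ k ∈ range n,
      ((Nat.factorial k : ℂ)⁻¹) • PowerSeries.coeff n (T ^ k * coeffwise D T) := by
    rw [hSym_eq_sum t n.lt_succ_self, map_sum, ← hT, sum_range_succ']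
    have h2 : D (((Nat.factorial 0 : ℂ)⁻¹) • PowerSeries.coeff n (T ^ 0)) = 0 := by
      rw [pow_zero, PowerSeries.coeff_one]
      split_ifs <;> simp
    rw [h2, add_zero]
    refine sum_congr rfl fun k _ => ?_
    have h3 := congrArg (PowerSeries.coeff n) (coeffwise_pow_succ D T k)
    rw [coeffwise, PowerSeries.coeff_mk] at h3
    rw [D.map_smul, h3]
    have h4 : ∀ x : PowerSeries (MvPowerSeries σ ℂ),
        PowerSeries.coeff n ((k + 1 : ℂ) • x) = (k + 1 : ℂ) • PowerSeries.coeff n x := fun _ => rfl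
    have h5 : (k : ℂ) + 1 ≠ 0 := by exact_mod_cast Nat.succ_ne_zero k
    rw [h4, smul_smul, Nat.factorial_succ]
    push_cast
    rw [mul_inv, mul_comm, mul_inv_cancel_left₀ h5]
  rw [h1, hDT]
  by_cases h0 : χ s = 0
  · simp [h0]
  simp only [h0, if_false, false_or, PowerSeries.coeff_mul_X_pow']
  by_cases h2 : n < χ s
  · simp [h2, h2.not_ge]
  · rw [if_neg h2, hSym_eq_sum t (show n - χ s < n by omega)]
    simp [not_lt.1 h2, hT]

theorem IsTimes.coeff_zero_hSymInt {t : ℕ+ → MvPowerSeries σ ℂ} {χ : σ → ℕ} (ht : IsTimes t χ)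
    (n : ℤ) : coeff 0 (hSymInt t n) = if n = 0 then 1 else 0 := by
  rw [hSymInt]
  split_ifs with h1 h2 h2
  · rw [ht.coeff_zero_hSym, if_pos (by omega)]
  · rw [ht.coeff_zero_hSym, if_neg (by omega)]
  · omega
  · exact map_zero _

theorem IsTimes.pderiv_hSymInt {t : ℕ+ → MvPowerSeries σ ℂ} {χ : σ → ℕ} (ht : IsTimes t χ)
    (s : σ) (n : ℤ) : MvPowerSeries.pderiv ℂ s (hSymInt t n) =
      if χ s = 0 then 0 else hSymInt t (n - χ s) := by
  rw [hSymInt, hSymInt]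
  by_cases h1 : 0 ≤ n
  · rw [if_pos h1, ht.pderiv_hSym]
    split_ifs with h2 h3 h4 h3 h4
    · rfl
    · omega
    · rfl
    · omega
    · congr 1; omega
    · omega
  · rw [if_neg h1, map_zero]
    split_ifs with h2 h3
    · rfl
    · omega
    · rfl

/-- Half of the function `Q_{(a,b)}` at the arguments `t / 2`, for arbitrary integers `a` and `b`:
the vacuum expectation of `φ_a φ_b` in the presence of the flow with times `t`. -/
def pairSeries (t : ℕ+ → MvPowerSeries σ ℂ) (a b : ℤ) : MvPowerSeries σ ℂ :=
  (2⁻¹ : ℂ) • (hSymInt t a * hSymInt t b) +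
    ∑ i ∈ Icc 1 b.toNat, (-1) ^ i * (hSymInt t (a + i) * hSymInt t (b - i))

theorem pairSeries_eq (t : ℕ+ → MvPowerSeries σ ℂ) (a b : ℤ) {N : ℕ} (hN : b.toNat ≤ N) :
    pairSeries t a b = (2⁻¹ : ℂ) • (hSymInt t a * hSymInt t b) +
      ∑ i ∈ Icc 1 N, (-1) ^ i * (hSymInt t (a + i) * hSymInt t (b - i)) := by
  rw [pairSeries]
  congr 1
  refine sum_subset (Icc_subset_Icc_right hN) fun i _ hi' => ?_
  rw [mem_Icc] at *
  have h : hSymInt t (b - i) = 0 := if_neg (by omega)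
  rw [h, mul_zero, mul_zero]

theorem IsTimes.pderiv_pairSeries {t : ℕ+ → MvPowerSeries σ ℂ} {χ : σ → ℕ} (ht : IsTimes t χ)
    (s : σ) (a b : ℤ) : MvPowerSeries.pderiv ℂ s (pairSeries t a b) =
      if χ s = 0 then 0 else pairSeries t (a - χ s) b + pairSeries t a (b - χ s) := by
  have h1 : ∀ m n, MvPowerSeries.pderiv ℂ s (hSymInt t m * hSymInt t n) = if χ s = 0 then 0 else
      hSymInt t (m - χ s) * hSymInt t n + hSymInt t m * hSymInt t (n - χ s) := by
    intro m n
    rw [Derivation.leibniz, ht.pderiv_hSymInt, ht.pderiv_hSymInt, smul_eq_mul, smul_eq_mul]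
    split_ifs <;> ring
  have h2 : ∀ (i : ℕ) (f : MvPowerSeries σ ℂ), MvPowerSeries.pderiv ℂ s ((-1) ^ i * f) =
      (-1) ^ i * MvPowerSeries.pderiv ℂ s f := by
    intro i f
    rcases neg_one_pow_eq_or (MvPowerSeries σ ℂ) i with h | h <;> simp [h]
  rw [pairSeries_eq t (a - χ s) b le_rfl, pairSeries_eq t a (b - χ s) (N := b.toNat) (by omega),
    pairSeries, map_add, Derivation.map_smul, map_sum, h1]
  simp only [h2, h1]
  split_ifs
  · simp
  · simp only [mul_add, sum_add_distrib, smul_add, sub_right_comm b, add_sub_right_comm a]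
    abel

theorem IsTimes.coeff_zero_pairSeries {t : ℕ+ → MvPowerSeries σ ℂ} {χ : σ → ℕ}
    (ht : IsTimes t χ) (a b : ℤ) : coeff 0 (pairSeries t a b) =
      if a + b = 0 then (if a < 0 then (-1) ^ a else if a = 0 then 2⁻¹ else 0) else 0 := by
  have h1 : ∀ f g : MvPowerSeries σ ℂ, coeff 0 (f * g) = coeff 0 f * coeff 0 g :=
    fun f g => map_mul constantCoeff f g
  have h2 : ∀ i : ℕ, coeff 0 ((-1 : MvPowerSeries σ ℂ) ^ i) = (-1) ^ i := fun i => by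
    refine (map_pow (constantCoeff (σ := σ) (R := ℂ)) (-1) i).trans ?_
    simp
  rw [pairSeries, map_add, map_sum, MvPowerSeries.coeff_smul, h1]
  simp only [h1, h2, ht.coeff_zero_hSymInt]
  rcases lt_trichotomy a 0 with ha | rfl | ha
  · rw [if_neg ha.ne, if_pos ha, zero_mul, mul_zero, zero_add]
    split_ifs with hab
    · rw [sum_eq_single b.toNat]
      · rw [if_pos (by omega), if_pos (by omega), mul_one, mul_one,
          show a = -((b.toNat : ℕ) : ℤ) by omega, neg_one_zpow_neg, zpow_natCast]
      · intro i _ hi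
        rw [if_neg (show ¬ a + i = 0 by omega)]
        simp
      · intro h
        rw [mem_Icc] at h
        omega
    · refine sum_eq_zero fun i _ => ?_
      by_cases h : a + i = 0
      · rw [if_neg (show ¬ b - i = 0 by omega)]
        simp
      · simp [h]
  · rw [sum_eq_zero]
    · simp
    · intro i hi
      rw [mem_Icc] at hi
      rw [if_neg (by omega)]
      simp
  · rw [if_neg ha.ne', if_neg ha.not_gt, sum_eq_zero]
    · simp [ha.ne']
    · intro i _
      rw [if_neg (by omega)]
      simp

end Times

/-! ### Vacuum expectations of neutral fermions -/

/-- The state `φ_{l_1} φ_{l_2} ⋯ |0⟩`. -/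
def phiState (l : List ℤ) : Fock ℕ := (l.map phi).prod (ket ∅)

theorem phiState_cons (a : ℤ) (l : List ℤ) : phiState (a :: l) = phi a (phiState l) := by
  rw [phiState, List.map_cons, List.prod_cons]; rfl

/-- A fermion anticommuting with all `φ_n`, which acts on the vacuum as `φ_0`, and on the dual
vacuum as `-φ_0`. -/
def phiTwin : Module.End ℂ (Fock ℕ) := create 0 - (2⁻¹ : ℂ) • annihilate 0

theorem phiTwin_mul_phi (n : ℤ) : phiTwin * phi n + phi n * phiTwin = 0 := by
  have h : phiTwin = (1 : ℂ) • create 0 + (-2⁻¹ : ℂ) • annihilate 0 := by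
    rw [phiTwin, one_smul]
    refine LinearMap.ext fun v => ?_
    rw [LinearMap.sub_apply, LinearMap.add_apply, LinearMap.smul_apply, LinearMap.smul_apply,
      neg_smul, sub_eq_add_neg]
  rw [h, phi_eq, anticommutator_smul_add, create_mul_create, annihilate_mul_annihilate,
    annihilate_mul_create, add_comm (create _ * annihilate _), annihilate_mul_create, smul_zero,
    smul_zero, zero_add, add_zero]
  by_cases hn : n = 0
  · subst hn
    simp only [Int.natAbs_zero, if_true, lt_irrefl, if_false, le_refl]
    rw [← add_smul]
    norm_num
  · rw [if_neg (by omega : ¬ n.natAbs = 0), if_neg (by omega : ¬ 0 = n.natAbs), smul_zero,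
      smul_zero, add_zero]

theorem phiTwin_vacuum : phiTwin (ket ∅) = phi 0 (ket ∅) := by
  rw [phiTwin, phi_zero, LinearMap.sub_apply, LinearMap.add_apply, LinearMap.smul_apply,
    annihilate_vacuum, smul_zero, sub_zero, add_zero]

theorem phiTwin_apply_empty (v : Fock ℕ) : phiTwin v ∅ = -phi 0 v ∅ := by
  rw [phiTwin, phi_zero, LinearMap.sub_apply, LinearMap.add_apply, Finsupp.sub_apply,
    Finsupp.add_apply, create_apply_empty, zero_sub, zero_add]

/-- Wick's theorem for neutral fermions. -/
theorem phiState_apply_empty (l : List ℤ) : phiState l ∅ =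
    pfaff (fun a b => if a + b = 0 then (if a < 0 then (-1) ^ a else if a = 0 then 2⁻¹ else 0)
      else (0 : ℂ)) l := by
  refine eq_pfaff _ (fun l => phiState l ∅) (by simp [phiState, ket_apply_self]) (fun a l => ?_) l
  have h2 : phiState (a :: l) ∅ = altSum (fun c m => (if a + c = 0 then (-1) ^ a else 0) *
      phiState m ∅) l + (-1) ^ l.length * (l.map phi).prod (phi a (ket ∅)) ∅ := by
    rw [phiState_cons]
    exact apply_prod_map_eq_altSum phi (phi a) (fun c => if a + c = 0 then (-1) ^ a else 0)
      (fun c => by rw [phi_mul_phi]; split_ifs <;> simp) l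
  rcases lt_trichotomy a 0 with ha | rfl | ha
  · rw [h2, phi_vacuum ha, map_zero, Finsupp.zero_apply, mul_zero, add_zero]
    refine altSum_congr fun c m _ => ?_
    rw [if_pos ha]
  · -- The operator `phiTwin` moves `φ_0` from the vacuum to the dual vacuum.
    have h3 := apply_prod_map_eq_altSum phi phiTwin (fun _ => 0)
        (fun c => by rw [phiTwin_mul_phi, zero_smul]) l
    have h4 : altSum (fun c m => (0 : ℂ) * (List.map phi m).prod (ket ∅) ∅) l = 0 := by
      rw [altSum_eq_sum]; simp
    rw [h4, zero_add, phiTwin_apply_empty, phiTwin_vacuum] at h3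
    rw [← h3] at h2
    have h5 : altSum (fun c m => (if 0 + c = 0 then (-1 : ℂ) ^ (0 : ℤ) else 0) * phiState m ∅) l =
        2 * altSum (fun c m => (if 0 + c = 0 then
          (if (0 : ℤ) < 0 then (-1 : ℂ) ^ (0 : ℤ) else if (0 : ℤ) = 0 then 2⁻¹ else 0) else 0) *
            phiState m ∅) l := by
      refine Eq.trans ?_ (map_altSum (AddMonoidHom.mulLeft (2 : ℂ)) _ l).symm
      congr 1
      funext c m
      by_cases h : 0 + c = 0 <;> simp [h]
    rw [h5] at h2
    rw [phiState_cons] at h2 ⊢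
    have h6 : phi 0 (phiState l) ∅ = phi 0 ((l.map phi).prod (ket ∅)) ∅ := rfl
    linear_combination (1 / 2 : ℂ) * h2 + (1 / 2 : ℂ) * h6
  · rw [phiState_cons, phi_apply_empty ha, altSum_eq_sum]
    symm
    refine sum_eq_zero fun i _ => ?_
    rw [if_neg ha.not_gt, if_neg ha.ne', ite_self, zero_mul, smul_zero]

/-! ### Flows and vacuum expectations -/

section Flows

variable {σ ι : Type}

/-- The coefficients of the linear form `∑_s x_s A_{χ(s)}`, where `χ(s) = 0` stands for no
contribution. -/
def flow {V : Type} [AddCommGroup V] [Module ℂ V] (χ : σ → ℕ) (A : ℕ → Module.End ℂ V) (s : σ) :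
    Module.End ℂ V := if χ s = 0 then 0 else A (χ s)

/-- The series of vacuum expectations `⟨0| X v`. -/
def vacSeries (X : MvPowerSeries σ (Module.End ℂ (Fock ι))) :
    Fock ι →ₗ[ℂ] MvPowerSeries σ ℂ where
  toFun v := fun m => coeff m X v ∅
  map_add' v w := by
    ext m
    change coeff m X (v + w) ∅ = coeff m X v ∅ + coeff m X w ∅
    rw [map_add, Finsupp.add_apply]
  map_smul' a v := by
    ext m
    change coeff m X (a • v) ∅ = a * coeff m X v ∅
    rw [map_smul, Finsupp.smul_apply, smul_eq_mul]

theorem coeff_vacSeries (X : MvPowerSeries σ (Module.End ℂ (Fock ι))) (v : Fock ι)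
    (m : σ →₀ ℕ) : coeff m (vacSeries X v) = coeff m X v ∅ := rfl

theorem coeff_zero_vacSeries_formalExp (X : MvPowerSeries σ (Module.End ℂ (Fock ι)))
    (v : Fock ι) : coeff 0 (vacSeries (formalExp X) v) = v ∅ :=
  congrArg (fun A : Module.End ℂ (Fock ι) => A v ∅) (coeff_zero_formalExp X)

theorem pderiv_vacSeries {c : σ → Module.End ℂ (Fock ι)} (hc : ∀ s s', Commute (c s) (c s'))
    (s : σ) (v : Fock ι) : MvPowerSeries.pderiv ℂ s (vacSeries (formalExp (linForm c)) v) =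
      vacSeries (formalExp (linForm c)) (c s v) := by
  ext m
  have h1 : coeff m (pderivFun s (formalExp (linForm c))) =
      coeff m (formalExp (linForm c)) * c s := by
    rw [pderivFun_formalExp_linForm c hc,
      ← (commute_formalExp_left (commute_C_linForm c (c s) fun s' => hc s' s)).eq, coeff_mul_C]
  have h2 := congrArg (fun A : Module.End ℂ (Fock ι) => A v ∅) h1
  rw [coeff_pderivFun] at h2
  rw [coeff_pderiv, coeff_vacSeries, coeff_vacSeries]
  refine Eq.trans ?_ h2
  have h3 : ((m s : Module.End ℂ (Fock ι)) + 1) v = ((m s : ℂ) + 1) • v := by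
    rw [LinearMap.add_apply, Module.End.natCast_apply, add_smul, one_smul, Nat.cast_smul_eq_nsmul]
    rfl
  change _ = coeff (m + Finsupp.single s 1) (formalExp (linForm c))
    (((m s : Module.End ℂ (Fock ι)) + 1) v) ∅
  rw [h3, map_smul, Finsupp.smul_apply, smul_eq_mul, mul_comm]

theorem commute_flow {V : Type} [AddCommGroup V] [Module ℂ V] {χ : σ → ℕ}
    {A : ℕ → Module.End ℂ V} (hA : ∀ s s', χ s ≠ 0 → χ s' ≠ 0 → Commute (A (χ s)) (A (χ s')))
    (s s' : σ) : Commute (flow χ A s) (flow χ A s') := by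
  rw [flow, flow]
  by_cases h : χ s = 0
  · rw [if_pos h]; exact Commute.zero_left _
  by_cases h' : χ s' = 0
  · rw [if_pos h']; exact Commute.zero_right _
  · rw [if_neg h, if_neg h']; exact hA s s' h h'

/-- The index `m` of an odd time `t_m`, and `0` for all other variables. -/
def oddIndexT : Times → ℕ := Sum.elim (fun m => if Odd (m : ℕ) then m else 0) fun _ => 0

/-- The index `m` of an odd time `t*_m`, and `0` for all other variables. -/
def oddIndexTStar : Times → ℕ := Sum.elim (fun _ => 0) fun m => if Odd (m : ℕ) then m else 0

theorem oddIndexT_odd (s : Times) (h : oddIndexT s ≠ 0) : Odd (oddIndexT s) := by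
  rcases s with m | m
  · by_cases hm : Odd (m : ℕ)
    · simp [oddIndexT, hm]
    · simp [oddIndexT, hm] at h
  · simp [oddIndexT] at h

theorem oddIndexTStar_odd (s : Times) (h : oddIndexTStar s ≠ 0) : Odd (oddIndexTStar s) := by
  rcases s with m | m
  · simp [oddIndexTStar] at h
  · by_cases hm : Odd (m : ℕ)
    · simp [oddIndexTStar, hm]
    · simp [oddIndexTStar, hm] at h

theorem isTimes_X {χ : Times → ℕ} (e : ℕ+ → Times)
    (h : ∀ s (m : ℕ+), χ s = m ↔ e m = s ∧ Odd (m : ℕ)) :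
    IsTimes (fun m => if Odd (m : ℕ) then MvPowerSeries.X (e m) else 0) χ := by
  classical
  refine ⟨fun m => ?_, fun s m => ?_⟩
  · split_ifs
    · exact coeff_zero_X _
    · exact map_zero _
  · by_cases hm : Odd (m : ℕ)
    · rw [if_pos hm, MvPowerSeries.pderiv_X, Pi.single_apply]
      exact if_congr (by rw [h]; simp [hm]) rfl rfl
    · rw [if_neg hm, map_zero, if_neg fun h' => hm ((h s m).1 h').2]

theorem isTimes_oddT : IsTimes oddT oddIndexT := by
  refine isTimes_X Sum.inl fun s m => ?_
  rcases s with n | n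
  · rw [Sum.inl.injEq, eq_comm (a := m), ← PNat.coe_inj]
    by_cases hn : Odd (n : ℕ)
    · simp only [oddIndexT, Sum.elim_inl, hn, if_true]
      exact ⟨fun h => ⟨h, h ▸ hn⟩, fun h => h.1⟩
    · simp only [oddIndexT, Sum.elim_inl, hn, if_false]
      exact ⟨fun h => absurd h m.pos.ne, fun h => absurd (h.1 ▸ h.2) hn⟩
  · simp [oddIndexT, m.pos.ne]

theorem isTimes_oddTStar : IsTimes oddTStar oddIndexTStar := by
  refine isTimes_X Sum.inr fun s m => ?_
  rcases s with n | n
  · simp [oddIndexTStar, m.pos.ne]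
  · rw [Sum.inr.injEq, eq_comm (a := m), ← PNat.coe_inj]
    by_cases hn : Odd (n : ℕ)
    · simp only [oddIndexTStar, Sum.elim_inr, hn, if_true]
      exact ⟨fun h => ⟨h, h ▸ hn⟩, fun h => h.1⟩
    · simp only [oddIndexTStar, Sum.elim_inr, hn, if_false]
      exact ⟨fun h => absurd h m.pos.ne, fun h => absurd (h.1 ▸ h.2) hn⟩

theorem flowT_odd (A : ℕ → Module.End ℂ (Fock ι)) :
    flowT (fun m => if Odd m then A m else 0) = linForm (flow oddIndexT A) := by
  rw [flowT]
  congr 1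
  funext s
  rcases s with m | m
  · by_cases hm : Odd (m : ℕ) <;> simp [flow, oddIndexT, hm]
  · simp [flow, oddIndexT]

theorem neg_flowTStar_odd (A : ℕ → Module.End ℂ (Fock ι)) :
    -flowTStar (fun m => if Odd m then A m else 0) =
      linForm (flow oddIndexTStar fun k => -A k) := by
  rw [flowTStar, linForm_neg]
  congr 1
  funext s
  rcases s with m | m
  · simp [flow, oddIndexTStar]
  · by_cases hm : Odd (m : ℕ) <;> simp [flow, oddIndexTStar, hm]

end Flows

/-! ### The BKP tau function as a sum over strict partitions -/

section BKP

variable {σ : Type}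

/-- The evolution operator `exp (∑ t_m H_m)` of the BKP hierarchy. -/
def evolB (χ : σ → ℕ) : MvPowerSeries σ (Module.End ℂ (Fock ℕ)) :=
  formalExp (linForm (flow χ fun k => hamB k))

/-- The evolution operator `exp (-∑ t*_m B_m)`. -/
def dualEvolB (r : ℤ → ℂ) (χ : σ → ℕ) : MvPowerSeries σ (Module.End ℂ (Fock ℕ)) :=
  formalExp (linForm (flow χ fun k => -opB r k))

theorem tauBKP_eq (r : ℤ → ℂ) :
    tauBKP r = formalExpectation ∅ (evolB oddIndexT * dualEvolB r oddIndexTStar) := by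
  rw [tauBKP, flowT_odd fun k => hamB k, neg_flowTStar_odd, evolB, dualEvolB]

theorem hamB_phiState {k : ℕ} (hk : Odd k) (l : List ℤ) :
    hamB k (phiState l) = shiftSum k phiState l := by
  induction l with
  | nil => exact hamB_vacuum hk
  | cons a l ih =>
    have h : (fun m => phiState (a :: m)) = fun m => phi a (phiState m) :=
      funext fun m => phiState_cons a m
    rw [phiState_cons, hamB_phi hk, ih, shiftSum, h, phiState_cons, add_comm]
    congr 1
    exact map_shiftSum (phi a).toAddMonoidHom k phiState l

theorem pderiv_vacSeries_evolB {χ : σ → ℕ} (hχ : ∀ s, χ s ≠ 0 → Odd (χ s)) (s : σ)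
    (v : Fock ℕ) : MvPowerSeries.pderiv ℂ s (vacSeries (evolB χ) v) =
      if χ s = 0 then 0 else vacSeries (evolB χ) (hamB (χ s) v) := by
  rw [evolB, pderiv_vacSeries (commute_flow fun s s' h h' => commute_hamB (hχ s h) (hχ s' h')),
    flow]
  split_ifs
  · simp
  · rfl

/-- Wick's theorem in the presence of a flow. -/
theorem vacSeries_phiState {t : ℕ+ → MvPowerSeries σ ℂ} {χ : σ → ℕ} (ht : IsTimes t χ)
    (hχ : ∀ s, χ s ≠ 0 → Odd (χ s)) (l : List ℤ) :
    vacSeries (evolB χ) (phiState l) = pfaff (pairSeries t) l := by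
  refine sub_eq_zero.1 (eq_zero_of_pderiv_mem_span
    (fun l => vacSeries (evolB χ) (phiState l) - pfaff (pairSeries t) l) (fun s l => ?_)
    (fun l => ?_) l)
  · have h1 : MvPowerSeries.pderiv ℂ s (pfaff (pairSeries t) l) =
        (if χ s = 0 then 0 else 1 : ℂ) • shiftSum (χ s) (pfaff (pairSeries t)) l := by
      refine derivation_pfaff _ _ _ _ (fun a b => ?_) l
      rw [ht.pderiv_pairSeries]
      split_ifs <;> simp
    rw [map_sub, pderiv_vacSeries_evolB hχ, h1]
    split_ifs with h
    · simp
    · have h2 : vacSeries (evolB χ) (shiftSum (χ s) phiState l) =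
          shiftSum (χ s) (fun l => vacSeries (evolB χ) (phiState l)) l :=
        map_shiftSum (vacSeries (evolB χ)).toAddMonoidHom _ _ l
      rw [hamB_phiState (hχ s h), h2, one_smul, ← shiftSum_sub]
      exact shiftSum_mem_span _ _ _ (fun l => Set.mem_range_self l) l
  · rw [map_sub, evolB, coeff_zero_vacSeries_formalExp, phiState_apply_empty]
    have h1 := map_pfaff (constantCoeff (σ := σ) (R := ℂ)) (pairSeries t) l
    have h2 : (fun a b => constantCoeff (pairSeries t a b)) = fun a b : ℤ =>
        if a + b = 0 then (if a < 0 then (-1 : ℂ) ^ a else if a = 0 then 2⁻¹ else 0) else 0 :=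
      funext fun a => funext fun b => ht.coeff_zero_pairSeries a b
    rw [h2] at h1
    exact sub_eq_zero.2 h1.symm

theorem phiState_of_sortedGT {l : List ℕ} (h : l.Pairwise (· > ·)) :
    phiState (l.map (↑)) = ket l.toFinset := by
  induction l with
  | nil => rfl
  | cons a l ih =>
    rw [List.pairwise_cons] at h
    rw [List.map_cons, phiState_cons, ih h.2, phi_ket_of_forall_lt, List.toFinset_cons]
    intro j hj
    exact h.1 j (List.mem_toFinset.1 hj)

theorem intertwines_parity_evolB {χ : σ → ℕ} (hχ : ∀ s, χ s ≠ 0 → Odd (χ s)) :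
    Intertwines parity (evolB χ) (evolB χ) := by
  refine (Intertwines.linForm fun s v => ?_).formalExp
  rw [flow]
  split_ifs with h
  · simp
  · exact parity_hamB (hχ s h) v

theorem intertwines_parity_dualEvolB (r : ℤ → ℂ) {χ : σ → ℕ} (hχ : ∀ s, χ s ≠ 0 → Odd (χ s)) :
    Intertwines parity (dualEvolB r χ) (dualEvolB r χ) := by
  refine (Intertwines.linForm fun s v => ?_).formalExp
  rw [flow]
  split_ifs with h
  · simp
  · rw [LinearMap.neg_apply, LinearMap.neg_apply, map_neg, parity_opB r (hχ s h)]

theorem vacSeries_ket_of_odd {χ : σ → ℕ} (hχ : ∀ s, χ s ≠ 0 → Odd (χ s)) {S : Finset ℕ}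
    (hS : Odd S.card) : vacSeries (evolB χ) (ket S) = 0 := by
  ext m
  have h1 := congrArg (fun v : Fock ℕ => v ∅) (intertwines_parity_evolB hχ m (ket S))
  simp only [parity, diagOp_ket, diagOp_apply, card_empty, pow_zero, one_mul, hS.neg_one_pow,
    neg_smul, one_smul] at h1
  rw [map_neg, Finsupp.neg_apply] at h1
  rw [coeff_vacSeries, map_zero]
  exact self_eq_neg.1 h1

/-- The coefficients of `e^{-B(t*)} |0⟩`. -/
theorem matrixElement_dualEvolB {r : ℤ → ℂ} (hr : ∀ n, r n = r (1 - n)) {χ : σ → ℕ}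
    (hχ : ∀ s, χ s ≠ 0 → Odd (χ s)) (S : Finset ℕ) : matrixElement S ∅ (dualEvolB r χ) =
      ((neutralNorm S)⁻¹ * ∏ n ∈ S, partWeight r n) • vacSeries (evolB χ) (ket S) := by
  ext m
  have h1 : Intertwines (neutralWeightOp r) (dualEvolB 1 χ) (dualEvolB r χ) := by
    refine (Intertwines.linForm fun s v => ?_).formalExp
    rw [flow, flow]
    split_ifs with h
    · simp
    · rw [LinearMap.neg_apply, LinearMap.neg_apply, map_neg, opB_neutralWeightOp hr (hχ s h)]
  have h2 := congrArg (fun v : Fock ℕ => v S) (h1 m (ket ∅))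
  simp only [neutralWeightOp, diagOp_ket, diagOp_apply, prod_empty, one_smul] at h2
  have h3 : diagForm neutralNorm (coeff m (dualEvolB 1 χ) (ket ∅)) (ket S) =
      diagForm neutralNorm (ket ∅) (coeff m (evolB χ) (ket S)) := by
    refine formalExp_linForm_adjoint (diagForm neutralNorm) (fun s x y => ?_) m _ _
    rw [flow, flow]
    split_ifs with h
    · simp
    · exact diagForm_opB_one (hχ s h) x y
  rw [diagForm_ket_right, diagForm_ket_left] at h3
  have h4 : neutralNorm ∅ = 1 := by simp [neutralNorm]
  rw [h4, one_mul] at h3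
  rw [coeff_matrixElement, ← h2, MvPowerSeries.coeff_smul, coeff_vacSeries, ← h3]
  have := neutralNorm_ne_zero S
  field_simp

/-- Insertion of a complete set of states between the two evolutions. -/
theorem hasSum_tauBKP {r : ℤ → ℂ} (hr : ∀ n, r n = r (1 - n)) :
    HasSum (fun S : Finset ℕ => ((neutralNorm S)⁻¹ * ∏ n ∈ S, partWeight r n) •
      (vacSeries (evolB oddIndexT) (ket S) * vacSeries (evolB oddIndexTStar) (ket S)))
      (tauBKP r) := by
  have h := hasSum_formalExpectation_mul (evolB oddIndexT) (dualEvolB r oddIndexTStar)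
  rw [← tauBKP_eq] at h
  convert h using 2 with S
  rw [matrixElement_dualEvolB hr oddIndexTStar_odd, mul_smul_comm]
  rfl

end BKP

/-! ### Strict partitions as states -/

/-- The parts of `μ`, with a part `0` added if their number is odd. -/
def paddedParts (μ : YoungDiagram) : List ℕ :=
  if Even μ.rowLens.length then μ.rowLens else μ.rowLens ++ [0]

/-- The set of excited modes which corresponds to a strict partition. -/
def strictState (μ : YoungDiagram) : Finset ℕ := (paddedParts μ).toFinset

theorem paddedParts_pairwise {μ : YoungDiagram} (h : μ.rowLens.SortedGT) :
    (paddedParts μ).Pairwise (· > ·) := by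
  rw [paddedParts]
  split_ifs
  · exact h.pairwise
  · rw [List.pairwise_append]
    refine ⟨h.pairwise, List.pairwise_singleton _ _, fun a ha b hb => ?_⟩
    rw [List.mem_singleton.1 hb]
    exact μ.pos_of_mem_rowLens a ha

theorem zero_notMem_rowLens (μ : YoungDiagram) : 0 ∉ μ.rowLens :=
  fun h => (μ.pos_of_mem_rowLens 0 h).false

theorem filter_paddedParts (μ : YoungDiagram) :
    (paddedParts μ).filter (fun a => 0 < a) = μ.rowLens := by
  have h : μ.rowLens.filter (fun a => 0 < a) = μ.rowLens :=
    List.filter_eq_self.2 fun a ha => by simpa using μ.pos_of_mem_rowLens a ha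
  rw [paddedParts]
  split_ifs
  · exact h
  · rw [List.filter_append, h]
    simp

theorem strictState_injective {μ ν : YoungDiagram} (hμ : μ.rowLens.SortedGT)
    (hν : ν.rowLens.SortedGT) (h : strictState μ = strictState ν) : μ = ν := by
  have h1 : paddedParts μ = paddedParts ν :=
    (paddedParts_pairwise hμ).eq_of_mem_iff (paddedParts_pairwise hν) fun a => by
      rw [← List.mem_toFinset, ← List.mem_toFinset]
      exact iff_of_eq (congrArg (a ∈ ·) h)
  have h2 : μ.rowLens = ν.rowLens := by
    rw [← filter_paddedParts μ, ← filter_paddedParts ν, h1]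
  exact YoungDiagram.equivListRowLens.injective (Subtype.ext h2)

theorem exists_strictState_eq {S : Finset ℕ} (hS : Even S.card) :
    ∃ μ : YoungDiagram, μ.rowLens.SortedGT ∧ strictState μ = S := by
  set w := (S.erase 0).sort (· ≥ ·) with hw
  have hw1 : w.SortedGT := Finset.sortedGT_sort _
  have hpos : ∀ x ∈ w, 0 < x := fun x hx => by
    rw [hw, Finset.mem_sort, mem_erase] at hx
    exact Nat.pos_of_ne_zero hx.1
  have hrow : (YoungDiagram.ofRowLens w hw1.sortedGE).rowLens = w :=
    YoungDiagram.rowLens_ofRowLens_eq_self hpos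
  refine ⟨YoungDiagram.ofRowLens w hw1.sortedGE, by rwa [hrow], ?_⟩
  have hlen : w.length = (S.erase 0).card := Finset.length_sort _
  have hfin : w.toFinset = S.erase 0 := Finset.sort_toFinset _ _
  rw [strictState, paddedParts, hrow, hlen]
  by_cases h0 : 0 ∈ S
  · rw [if_neg, List.toFinset_append, hfin]
    · simpa [union_comm] using insert_erase h0
    · rw [← card_erase_add_one h0] at hS
      exact Nat.even_add_one.1 hS
  · rw [erase_eq_of_notMem h0, if_pos hS, hfin, erase_eq_of_notMem h0]

theorem even_length_paddedParts (μ : YoungDiagram) : Even (paddedParts μ).length := by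
  rw [paddedParts]
  split_ifs with h
  · exact h
  · rw [List.length_append, List.length_singleton]
    exact (Nat.not_even_iff_odd.1 h).add_one

theorem two_mul_half_smul {A : Type} [Ring A] [Algebra ℂ A] (x : A) :
    2 * ((2⁻¹ : ℂ) • x) = x := by
  rw [two_mul, ← add_smul]
  norm_num

theorem qSym_half {σ : Type} {t : ℕ+ → MvPowerSeries σ ℂ}
    (ht : ∀ m : ℕ+, ¬ Odd (m : ℕ) → t m = 0) (k : ℕ) :
    qSym (fun m => (2⁻¹ : ℂ) • t m) k = hSym t k := by
  rw [qSym]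
  congr 1
  funext m
  split_ifs with h
  · exact two_mul_half_smul _
  · exact (ht m h).symm

theorem qPair_half {σ : Type} {t : ℕ+ → MvPowerSeries σ ℂ}
    (ht : ∀ m : ℕ+, ¬ Odd (m : ℕ) → t m = 0) (a b : ℕ) :
    qPair (fun m => (2⁻¹ : ℂ) • t m) a b = 2 * pairSeries t a b := by
  have h0 : ∀ n : ℕ, hSymInt t n = hSym t n := fun n => by simp [hSymInt]
  rw [qPair, pairSeries, mul_add, Int.toNat_natCast]
  simp only [qSym_half ht]
  refine congrArg₂ (· + ·) ?_ (congrArg (2 * ·) (sum_congr rfl fun i hi => ?_))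
  · rw [h0, h0]
    exact (two_mul_half_smul _).symm
  · rw [← Nat.cast_add, ← Nat.cast_sub (mem_Icc.1 hi).2, h0, h0]

/-- Schur's `Q`-functions are, up to normalization, matrix elements of the evolution operator. -/
theorem schurQ_half {σ : Type} {t : ℕ+ → MvPowerSeries σ ℂ} {χ : σ → ℕ} (ht : IsTimes t χ)
    (hχ : ∀ s, χ s ≠ 0 → Odd (χ s)) (ht' : ∀ m : ℕ+, ¬ Odd (m : ℕ) → t m = 0) {μ : YoungDiagram}
    (hμ : μ.rowLens.SortedGT) (n : ℕ) (hn : (paddedParts μ).length = 2 * n) :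
    schurQ μ (fun m => (2⁻¹ : ℂ) • t m) =
      (2 : ℂ) ^ n • vacSeries (evolB χ) (ket (strictState μ)) := by
  have h1 : qPair (fun m => (2⁻¹ : ℂ) • t m) =
      fun a b : ℕ => (fun a b : ℤ => 2 * pairSeries t a b) a b :=
    funext fun a => funext fun b => qPair_half ht' a b
  have h2 : schurQ μ (fun m => (2⁻¹ : ℂ) • t m) =
      pfaffian (qPair (fun m => (2⁻¹ : ℂ) • t m)) (paddedParts μ) := rfl
  rw [h2, h1]
  refine (pfaffian_eq_pfaff (fun n : ℕ => (n : ℤ)) (fun a b => 2 * pairSeries t a b)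
    (paddedParts μ)).trans ?_
  rw [pfaff_mul_left _ _ n, strictState,
    ← phiState_of_sortedGT (paddedParts_pairwise hμ), vacSeries_phiState ht hχ, Algebra.smul_def,
    map_pow, map_ofNat]
  · rw [List.length_map, hn]

theorem oddT_eq_zero (m : ℕ+) (h : ¬ Odd (m : ℕ)) : oddT m = 0 := if_neg h

theorem oddTStar_eq_zero (m : ℕ+) (h : ¬ Odd (m : ℕ)) : oddTStar m = 0 := if_neg h

theorem rStrict_eq (r : ℤ → ℂ) (μ : YoungDiagram) :
    rStrict r μ = (μ.rowLens.map (partWeight r)).prod := by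
  have h1 : ∀ l : List ℕ, (do let a ← l; pure (a : ℤ)) = l.map (fun n : ℕ => (n : ℤ)) := fun l => by
    induction l with
    | nil => rfl
    | cons a l ih => simpa using ih
  have h2 : ∀ n : ℕ, ∏ j ∈ Icc (1 : ℤ) n, r j = partWeight r n := fun n => by
    induction n with
    | zero => simp [partWeight_zero]
    | succ n ih =>
      have h3 : Icc (1 : ℤ) (n + 1 : ℕ) = insert (n + 1 : ℤ) (Icc (1 : ℤ) n) := by
        ext j
        simp only [mem_Icc, mem_insert]
        omega
      rw [h3, prod_insert (by simp), ih, partWeight, partWeight, prod_Icc_succ_top (by omega),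
        mul_comm, Nat.cast_add_one]
  rw [rStrict, h1, List.map_map]
  congr 2
  funext n
  exact h2 n

theorem prod_partWeight_strictState (r : ℤ → ℂ) {μ : YoungDiagram} (hμ : μ.rowLens.SortedGT) :
    ∏ n ∈ strictState μ, partWeight r n = rStrict r μ := by
  rw [strictState, List.prod_toFinset _ ((paddedParts_pairwise hμ).imp ne_of_gt), rStrict_eq,
    paddedParts]
  split_ifs
  · rfl
  · rw [List.map_append, List.prod_append, List.map_singleton, List.prod_singleton,
      partWeight_zero, mul_one]

theorem termBKP_eq (r : ℤ → ℂ) {μ : YoungDiagram} (hμ : μ.rowLens.SortedGT) :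
    termBKP r μ = ((neutralNorm (strictState μ))⁻¹ * ∏ n ∈ strictState μ, partWeight r n) •
      (vacSeries (evolB oddIndexT) (ket (strictState μ)) *
        vacSeries (evolB oddIndexTStar) (ket (strictState μ))) := by
  obtain ⟨n, hn⟩ := even_length_paddedParts μ
  rw [← two_mul] at hn
  rw [termBKP, schurQ_half isTimes_oddT oddIndexT_odd oddT_eq_zero hμ n hn,
    schurQ_half isTimes_oddTStar oddIndexTStar_odd oddTStar_eq_zero hμ n hn,
    smul_mul_smul_comm, smul_smul, prod_partWeight_strictState r hμ]
  congr 1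
  have h1 : (2 : ℂ) ^ n * 2 ^ n = 2 ^ (paddedParts μ).length := by rw [hn, ← pow_add, two_mul]
  have h2 : (2⁻¹ : ℂ) ^ μ.rowLens.length * 2 ^ μ.rowLens.length = 1 := by rw [← mul_pow]; simp
  rw [h1, neutralNorm, strictState]
  simp only [List.mem_toFinset]
  by_cases h : Even μ.rowLens.length
  · have h3 : paddedParts μ = μ.rowLens := if_pos h
    rw [h3, if_neg (zero_notMem_rowLens μ)]
    linear_combination rStrict r μ * h2
  · have h3 : paddedParts μ = μ.rowLens ++ [0] := if_neg h
    rw [h3, if_pos (by simp), List.length_append, List.length_singleton, pow_succ, inv_inv]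
    linear_combination 2 * rStrict r μ * h2

theorem hasSum_termBKP {r : ℤ → ℂ} (hr : ∀ n, r n = r (1 - n)) :
    HasSum (fun μ : {μ : YoungDiagram // μ.rowLens.SortedGT} => termBKP r μ.1) (tauBKP r) := by
  have h1 : Function.Injective
      fun μ : {μ : YoungDiagram // μ.rowLens.SortedGT} => strictState μ.1 :=
    fun μ ν h => Subtype.ext (strictState_injective μ.2 ν.2 h)
  have h2 := (h1.hasSum_iff fun S hS => ?_).2 (hasSum_tauBKP hr)
  · convert h2 using 2 with μ
    exact termBKP_eq r μ.2
  · have h3 : Odd S.card := by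
      rw [← Nat.not_even_iff_odd]
      intro h
      obtain ⟨μ, hμ, rfl⟩ := exists_strictState_eq h
      exact hS ⟨⟨μ, hμ⟩, rfl⟩
    rw [vacSeries_ket_of_odd oddIndexT_odd h3, zero_mul, smul_zero]

theorem rowLens_bot : (⊥ : YoungDiagram).rowLens = [] := by
  have h : (⊥ : YoungDiagram).rowLens.length = 0 := by
    rw [YoungDiagram.length_rowLens]
    by_contra h
    exact YoungDiagram.notMem_bot (0, 0) (YoungDiagram.mem_iff_lt_colLen.2 (Nat.pos_of_ne_zero h))
  exact List.length_eq_zero_iff.1 h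

theorem termBKP_bot (r : ℤ → ℂ) : termBKP r ⊥ = 1 := by
  simp [termBKP, rowLens_bot, rStrict_eq, schurQ, pfaffian]

/-- Removal of one term from a convergent sum. -/
theorem hasSum_subtype_ne {α M : Type} [AddCommGroup M] [TopologicalSpace M]
    [IsTopologicalAddGroup M] (p : α → Prop) (f : α → M) {c : M} (a : α) (ha : p a)
    (h : HasSum (fun x : {x // p x} => f x.1) c) :
    HasSum (fun x : {x // x ≠ a ∧ p x} => f x.1) (c - f a) := by
  classical
  have h1 : HasSum (Set.indicator {x | p x} f) c := hasSum_subtype_iff_indicator.1 h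
  have h2 := h1.sub (hasSum_ite_eq a (f a))
  refine hasSum_subtype_iff_indicator (s := {x | x ≠ a ∧ p x}).2 ?_
  convert h2 using 2 with x
  by_cases hx : x = a
  · subst hx
    simp [ha]
  · by_cases hp : p x <;> simp [Set.indicator, hx, hp]

theorem hasSum_nonzeroStrict {r : ℤ → ℂ} (hr : ∀ n, r n = r (1 - n)) :
    HasSum (fun μ : NonzeroStrict => termBKP r μ.1) (tauBKP r - 1) := by
  have h := hasSum_subtype_ne (fun μ : YoungDiagram => μ.rowLens.SortedGT) (termBKP r) ⊥
    (by rw [rowLens_bot]; exact List.Pairwise.nil.sortedGT) (hasSum_termBKP hr)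
  rwa [termBKP_bot] at h

/-! ### Charged fermions -/

theorem psi_of_nonneg {n : ℤ} (h : 0 ≤ n) : psi n = create n := if_pos h

theorem psi_of_neg {n : ℤ} (h : n < 0) : psi n = annihilate n := if_neg h.not_ge

theorem psiStar_of_nonneg {n : ℤ} (h : 0 ≤ n) : psiStar n = annihilate n := if_pos h

theorem psiStar_of_neg {n : ℤ} (h : n < 0) : psiStar n = create n := if_neg h.not_ge

theorem psi_mul_psi (m n : ℤ) : psi m * psi n + psi n * psi m = 0 := by
  rcases lt_or_ge m 0 with hm | hm <;> rcases lt_or_ge n 0 with hn | hn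
  · rw [psi_of_neg hm, psi_of_neg hn, annihilate_mul_annihilate]
  · rw [psi_of_neg hm, psi_of_nonneg hn, annihilate_mul_create, if_neg (by omega)]
  · rw [psi_of_nonneg hm, psi_of_neg hn, add_comm, annihilate_mul_create, if_neg (by omega)]
  · rw [psi_of_nonneg hm, psi_of_nonneg hn, create_mul_create]

theorem psiStar_mul_psiStar (m n : ℤ) : psiStar m * psiStar n + psiStar n * psiStar m = 0 := by
  rcases lt_or_ge m 0 with hm | hm <;> rcases lt_or_ge n 0 with hn | hn
  · rw [psiStar_of_neg hm, psiStar_of_neg hn, create_mul_create]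
  · rw [psiStar_of_neg hm, psiStar_of_nonneg hn, add_comm, annihilate_mul_create,
      if_neg (by omega)]
  · rw [psiStar_of_nonneg hm, psiStar_of_neg hn, annihilate_mul_create, if_neg (by omega)]
  · rw [psiStar_of_nonneg hm, psiStar_of_nonneg hn, annihilate_mul_annihilate]

theorem psi_mul_psiStar (m n : ℤ) :
    psi m * psiStar n + psiStar n * psi m = if m = n then 1 else 0 := by
  rcases lt_or_ge m 0 with hm | hm <;> rcases lt_or_ge n 0 with hn | hn
  · rw [psi_of_neg hm, psiStar_of_neg hn, annihilate_mul_create]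
  · rw [psi_of_neg hm, psiStar_of_nonneg hn, annihilate_mul_annihilate, if_neg (by omega)]
  · rw [psi_of_nonneg hm, psiStar_of_neg hn, create_mul_create, if_neg (by omega)]
  · rw [psi_of_nonneg hm, psiStar_of_nonneg hn, add_comm, annihilate_mul_create]
    exact if_congr eq_comm rfl rfl

theorem psi_psi (m n : ℤ) (v : Fock ℤ) : psi m (psi n v) = -psi n (psi m v) :=
  eq_neg_of_add_eq_zero_left (LinearMap.congr_fun (psi_mul_psi m n) v)

theorem psiStar_psiStar (m n : ℤ) (v : Fock ℤ) :
    psiStar m (psiStar n v) = -psiStar n (psiStar m v) :=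
  eq_neg_of_add_eq_zero_left (LinearMap.congr_fun (psiStar_mul_psiStar m n) v)

theorem psi_psiStar_add (m n : ℤ) (v : Fock ℤ) :
    psi m (psiStar n v) + psiStar n (psi m v) = if m = n then v else 0 := by
  have := LinearMap.congr_fun (psi_mul_psiStar m n) v
  split_ifs at this ⊢ <;> exact this

theorem psi_psiStar_of_ne {m n : ℤ} (h : m ≠ n) (v : Fock ℤ) :
    psi m (psiStar n v) = -psiStar n (psi m v) := by
  rw [eq_neg_iff_add_eq_zero, psi_psiStar_add, if_neg h]

theorem insert_eq_symmDiff {n : ℤ} {S : Finset ℤ} (h : n ∉ S) : insert n S = symmDiff S {n} := by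
  ext j
  rw [mem_symmDiff, mem_insert, mem_singleton]
  by_cases hj : j = n
  · subst hj; simp [h]
  · simp [hj]

theorem erase_eq_symmDiff {n : ℤ} {S : Finset ℤ} (h : n ∈ S) : S.erase n = symmDiff S {n} := by
  ext j
  rw [mem_symmDiff, mem_erase, mem_singleton]
  by_cases hj : j = n
  · subst hj; simp [h]
  · simp [hj]

/-- The level `n` is occupied in the state `ket S` if and only if `n ∈ S ↔ 0 ≤ n`; if it is not,
then `ψ_n` fills it. -/
theorem psi_ket (n : ℤ) (S : Finset ℤ) :
    psi n (ket S) = if n ∈ S ↔ 0 ≤ n then 0 else wedgeSign n S • ket (symmDiff S {n}) := by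
  rcases lt_or_ge n 0 with hn | hn
  · rw [psi_of_neg hn, annihilate_ket]
    by_cases h : n ∈ S
    · rw [if_pos h, if_neg (by simp [h, hn]), erase_eq_symmDiff h]
    · rw [if_neg h, if_pos (by simp [h, hn])]
  · rw [psi_of_nonneg hn, create_ket]
    by_cases h : n ∈ S
    · rw [if_pos h, if_pos (by simp [h, hn])]
    · rw [if_neg h, if_neg (by simp [h, hn]), insert_eq_symmDiff h]

theorem psiStar_ket (n : ℤ) (S : Finset ℤ) :
    psiStar n (ket S) = if n ∈ S ↔ 0 ≤ n then wedgeSign n S • ket (symmDiff S {n}) else 0 := by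
  rcases lt_or_ge n 0 with hn | hn
  · rw [psiStar_of_neg hn, create_ket]
    by_cases h : n ∈ S
    · rw [if_pos h, if_neg (by simp [h, hn])]
    · rw [if_neg h, if_pos (by simp [h, hn]), insert_eq_symmDiff h]
  · rw [psiStar_of_nonneg hn, annihilate_ket]
    by_cases h : n ∈ S
    · rw [if_pos h, if_pos (by simp [h, hn]), erase_eq_symmDiff h]
    · rw [if_neg h, if_neg (by simp [h, hn])]

theorem psi_vacuum {n : ℤ} (h : n < 0) : psi n (ket ∅) = 0 := by
  rw [psi_of_neg h, annihilate_vacuum]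

theorem psiStar_vacuum {n : ℤ} (h : 0 ≤ n) : psiStar n (ket ∅) = 0 := by
  rw [psiStar_of_nonneg h, annihilate_vacuum]

theorem psi_apply_empty {n : ℤ} (h : 0 ≤ n) (v : Fock ℤ) : psi n v ∅ = 0 := by
  rw [psi_of_nonneg h, create_apply_empty]

theorem psiStar_apply_empty {n : ℤ} (h : n < 0) (v : Fock ℤ) : psiStar n v ∅ = 0 := by
  rw [psiStar_of_neg h, create_apply_empty]

theorem diagForm_create_one (i : ℤ) (x y : Fock ℤ) :
    diagForm (fun _ => 1) (create i x) y = diagForm (fun _ => 1) x (annihilate i y) := by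
  rw [diagForm_create _ i 1 (fun _ _ => (one_mul _).symm), one_smul]

theorem diagForm_psi (n : ℤ) (x y : Fock ℤ) :
    diagForm (fun _ => 1) (psi n x) y = diagForm (fun _ => 1) x (psiStar n y) := by
  rcases lt_or_ge n 0 with hn | hn
  · rw [psi_of_neg hn, psiStar_of_neg hn, diagForm_comm, ← diagForm_create_one, diagForm_comm]
  · rw [psi_of_nonneg hn, psiStar_of_nonneg hn, diagForm_create_one]

theorem diagForm_psiStar (n : ℤ) (x y : Fock ℤ) :
    diagForm (fun _ => 1) (psiStar n x) y = diagForm (fun _ => 1) x (psi n y) := by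
  rw [diagForm_comm, ← diagForm_psi, diagForm_comm]

/-! ### Bilinear expressions in the charged fermions -/

/-- The terms of the bilinear expression `∑_n c_n ψ_n ψ*_{n+K}`. -/
def psiBilinear (c : ℤ → ℂ) (K n : ℤ) : Module.End ℂ (Fock ℤ) := c n • (psi n * psiStar (n + K))

theorem psiBilinear_apply (c : ℤ → ℂ) (K n : ℤ) (v : Fock ℤ) :
    psiBilinear c K n v = c n • psi n (psiStar (n + K) v) := rfl

theorem locallyFinite_psiBilinear (c : ℤ → ℂ) {K : ℤ} (hK : K ≠ 0) :
    LocallyFinite (psiBilinear c K) := by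
  intro S
  obtain ⟨N, hN⟩ : ∃ N : ℕ, ∀ j ∈ S, |j| < N := ⟨S.sup Int.natAbs + 1, fun j hj => by
    have := le_sup (f := Int.natAbs) hj
    rw [Int.abs_eq_natAbs]
    omega⟩
  refine (Set.finite_Icc (-(N : ℤ)) (N - K)).subset fun n hn => ?_
  by_contra hn'
  rw [Set.mem_Icc, not_and_or, not_le, not_le] at hn'
  apply hn
  change psiBilinear c K n (ket S) = 0
  rw [psiBilinear_apply]
  rcases hn' with h | h
  · have h1 : n ∉ S := fun h' => by
      have := (abs_lt.1 (hN _ h')).1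
      omega
    rw [psi_psiStar_of_ne (by omega), psi_ket, if_pos (by simp only [h1, false_iff]; omega)]
    simp
  · have h1 : n + K ∉ S := fun h' => by
      have := (abs_lt.1 (hN _ h')).2
      omega
    rw [psiStar_ket, if_neg (by simp only [h1, false_iff]; omega)]
    simp

theorem sumOp_psiBilinear_psi (c : ℤ → ℂ) {K : ℤ} (hK : K ≠ 0) (m : ℤ) (v : Fock ℤ) :
    sumOp (psiBilinear c K) (psi m v) = psi m (sumOp (psiBilinear c K) v) +
      c (m - K) • psi (m - K) v := by
  rw [← sub_eq_iff_eq_add', (locallyFinite_psiBilinear c hK).commutator_apply,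
    finsum_eq_single _ (m - K)]
  · rw [psiBilinear_apply, psiBilinear_apply, map_smul, ← smul_sub, psi_psi m, sub_neg_eq_add,
      ← map_add, add_comm, sub_add_cancel, psi_psiStar_add, if_pos rfl]
  · intro n hn
    rw [psiBilinear_apply, psiBilinear_apply, map_smul, ← smul_sub, psi_psi m, sub_neg_eq_add,
      ← map_add, add_comm, psi_psiStar_add, if_neg (by omega), map_zero, smul_zero]

theorem sumOp_psiBilinear_psiStar (c : ℤ → ℂ) {K : ℤ} (hK : K ≠ 0) (m : ℤ) (v : Fock ℤ) :
    sumOp (psiBilinear c K) (psiStar m v) = psiStar m (sumOp (psiBilinear c K) v) +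
      (-c m) • psiStar (m + K) v := by
  have h1 : ∀ n, psiBilinear c K n (psiStar m v) - psiStar m (psiBilinear c K n v) =
      -(c n • if n = m then psiStar (n + K) v else 0) := fun n => by
    rw [psiBilinear_apply, psiBilinear_apply, map_smul, ← smul_sub, psiStar_psiStar _ m, map_neg,
      ← psi_psiStar_add n m, ← smul_neg]
    congr 1
    abel
  rw [← sub_eq_iff_eq_add', (locallyFinite_psiBilinear c hK).commutator_apply,
    finsum_eq_single _ m]
  · rw [h1, if_pos rfl, neg_smul]
  · intro n hn
    rw [h1, if_neg hn, smul_zero, neg_zero]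

theorem hamKP_eq (k : ℤ) : hamKP k = sumOp (psiBilinear 1 k) := by
  rw [hamKP]
  congr 1
  funext n
  exact (one_smul ℂ _).symm

theorem opA_eq (r : ℤ → ℂ) {k : ℕ} (hk : k ≠ 0) :
    opA r k = sumOp (psiBilinear (fun n => -rProd r n k) (-k)) := by
  rw [opA]
  congr 1
  funext n
  refine LinearMap.ext fun v => ?_
  have h : n ≠ n + -(k : ℤ) := by omega
  rw [psiBilinear_apply, psi_psiStar_of_ne h, smul_neg, neg_smul, neg_neg]
  rfl

theorem hamKP_psi {k : ℕ} (hk : k ≠ 0) (m : ℤ) (v : Fock ℤ) :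
    hamKP k (psi m v) = psi m (hamKP k v) + psi (m - k) v := by
  rw [hamKP_eq, sumOp_psiBilinear_psi _ (by exact_mod_cast hk), Pi.one_apply, one_smul]

theorem hamKP_psiStar {k : ℕ} (hk : k ≠ 0) (m : ℤ) (v : Fock ℤ) :
    hamKP k (psiStar m v) = psiStar m (hamKP k v) + (-1 : ℂ) • psiStar (m + k) v := by
  rw [hamKP_eq, sumOp_psiBilinear_psiStar _ (by exact_mod_cast hk), Pi.one_apply]

theorem opA_psi (r : ℤ → ℂ) {k : ℕ} (hk : k ≠ 0) (m : ℤ) (v : Fock ℤ) :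
    opA r k (psi m v) = psi m (opA r k v) + (-rProd r (m + k) k) • psi (m + k) v := by
  rw [opA_eq r hk, sumOp_psiBilinear_psi _ (by omega), sub_neg_eq_add]

theorem opA_psiStar (r : ℤ → ℂ) {k : ℕ} (hk : k ≠ 0) (m : ℤ) (v : Fock ℤ) :
    opA r k (psiStar m v) = psiStar m (opA r k v) + rProd r m k • psiStar (m - k) v := by
  rw [opA_eq r hk, sumOp_psiBilinear_psiStar _ (by omega), neg_neg, ← sub_eq_add_neg]

/-- The states `|-l⟩`, in which the levels below `-l` are occupied, are killed by the
Hamiltonians. -/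
theorem hamKP_ket_Ico {k : ℕ} (hk : k ≠ 0) (l : ℕ) : hamKP k (ket (Ico (-(l : ℤ)) 0)) = 0 := by
  rw [hamKP_eq, (locallyFinite_psiBilinear _ (by exact_mod_cast hk)).sumOp_apply,
    finsum_eq_zero_of_forall_eq_zero]
  intro n
  rw [psiBilinear_apply]
  by_cases h : n + (k : ℤ) < -l
  · rw [psi_psiStar_of_ne (by omega), psi_ket, if_pos (by rw [mem_Ico]; omega)]
    simp
  · rw [psiStar_ket, if_neg (by rw [mem_Ico]; omega)]
    simp

theorem hamKP_vacuum {k : ℕ} (hk : k ≠ 0) : hamKP k (ket ∅) = 0 := by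
  simpa using hamKP_ket_Ico hk 0

theorem commute_hamKP {k l : ℕ} (hk : k ≠ 0) (hl : l ≠ 0) : Commute (hamKP k) (hamKP l) := by
  refine sub_eq_zero.1 (eq_zero_of_commute_creation create
    (fun i S h => create_ket_of_forall_lt h) _ (fun i => ?_) ?_)
  · rcases lt_or_ge i 0 with hi | hi
    · rw [← psiStar_of_neg hi]
      refine commute_commutator_of_shift psiStar (hamKP k) (hamKP l) (fun _ => -1) (fun _ => -1)
        k l (fun m => ?_) (fun m => ?_) (fun _ => rfl) i
      · exact LinearMap.ext fun v => hamKP_psiStar hk m v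
      · exact LinearMap.ext fun v => hamKP_psiStar hl m v
    · rw [← psi_of_nonneg hi]
      refine commute_commutator_of_shift psi (hamKP k) (hamKP l) 1 1 (-k) (-l) (fun m => ?_)
        (fun m => ?_) (fun _ => rfl) i
      · exact LinearMap.ext fun v => (hamKP_psi hk m v).trans (by simp [sub_eq_add_neg])
      · exact LinearMap.ext fun v => (hamKP_psi hl m v).trans (by simp [sub_eq_add_neg])
  · change hamKP k (hamKP l (ket ∅)) - hamKP l (hamKP k (ket ∅)) = 0
    rw [hamKP_vacuum hk, hamKP_vacuum hl, map_zero, map_zero, sub_zero]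

/-- For `r = 1`, the operators `-A_k` are adjoint to the Hamiltonians `H^{KP}_k`. -/
theorem diagForm_opA_one {k : ℕ} (hk : k ≠ 0) (x y : Fock ℤ) :
    diagForm (fun _ => 1) (-opA 1 k x) y = diagForm (fun _ => 1) x (hamKP k y) := by
  have hk0 : (k : ℤ) ≠ 0 := by exact_mod_cast hk
  rw [opA_eq 1 hk, hamKP_eq, map_neg, LinearMap.neg_apply]
  have h1 := (locallyFinite_psiBilinear (fun n => -rProd 1 n k) (neg_ne_zero.2 hk0)).map_sumOp_apply
    ((diagForm fun _ => 1).flip y) x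
  have h2 := (locallyFinite_psiBilinear 1 hk0).map_sumOp_apply (diagForm (fun _ => 1) x) y
  rw [LinearMap.flip_apply] at h1
  rw [h1, h2, ← finsum_neg_distrib, ← finsum_comp_equiv (Equiv.subRight (k : ℤ))
    (f := fun n => diagForm (fun _ => 1) x (psiBilinear 1 k n y))]
  refine finsum_congr fun n => ?_
  have h3 : rProd 1 n k = 1 := by simp [rProd]
  rw [LinearMap.flip_apply, Equiv.subRight_apply, psiBilinear_apply, psiBilinear_apply, map_smul,
    map_smul, LinearMap.smul_apply, diagForm_psi, diagForm_psiStar, h3, sub_add_cancel,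
    Pi.one_apply, ← sub_eq_add_neg]
  simp

/-! ### Weights and charges of states -/

/-- The weight of an excited mode: the product of `r` over the levels between the vacuum's Fermi
level and `n`. -/
def levelWeight (r : ℤ → ℂ) (n : ℤ) : ℂ :=
  if 0 ≤ n then rProd r n (n + 1).toNat else rProd r (-1) (-n - 1).toNat

/-- The diagonal operator whose eigenvalue on `ket S` is the product of the weights of the
elements of `S`. -/
def chargedWeightOp (r : ℤ → ℂ) : Module.End ℂ (Fock ℤ) :=
  diagOp fun S => ∏ n ∈ S, levelWeight r n

/-- Moving the diagonal operator of the weights past `ψ_n ψ*_{n-k}` produces the coefficient of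
this product in `-A_k`. -/
theorem chargedWeightOp_psi_psiStar (r : ℤ → ℂ) {k : ℕ} (hk : k ≠ 0) (n : ℤ) (v : Fock ℤ) :
    chargedWeightOp r (psi n (psiStar (n - k) v)) =
      rProd r n k • psi n (psiStar (n - k) (chargedWeightOp r v)) := by
  have hc : ∀ i v, chargedWeightOp r (create i v) =
      levelWeight r i • create i (chargedWeightOp r v) :=
    fun i v => LinearMap.congr_fun (diagOp_create (levelWeight r) i) v
  have ha : ∀ i v, levelWeight r i • chargedWeightOp r (annihilate i v) =
      annihilate i (chargedWeightOp r v) :=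
    fun i v => LinearMap.congr_fun (diagOp_annihilate (levelWeight r) i) v
  rcases lt_or_ge n 0 with hn | hn
  · have h1 : levelWeight r (n - k) = rProd r n k * levelWeight r n := by
      have h2 := rProd_add r (n - k) (-n - 1).toNat k
      rw [show n - (k : ℤ) + k + ((-n - 1).toNat : ℕ) = -1 by omega, sub_add_cancel] at h2
      rw [levelWeight, if_neg (by omega), levelWeight, if_neg (by omega), mul_comm, ← h2]
      congr 1
      omega
    rw [psi_psiStar_of_ne (by omega), psi_psiStar_of_ne (by omega), psiStar_of_neg (by omega),
      psi_of_neg hn, map_neg, hc, h1, smul_neg, ← ha, map_smul, smul_smul]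
  · rcases lt_or_ge (n - k) 0 with hm | hm
    · have h1 : rProd r n k = levelWeight r n * levelWeight r (n - k) := by
        have h2 := rProd_add r (n - k) (n + 1).toNat (-(n - k) - 1).toNat
        rw [show n - (k : ℤ) + ((-(n - k) - 1).toNat : ℕ) + ((n + 1).toNat : ℕ) = n by omega,
          show n - (k : ℤ) + ((-(n - k) - 1).toNat : ℕ) = -1 by omega] at h2
        rw [levelWeight, if_pos hn, levelWeight, if_neg (by omega), ← h2]
        congr 1
        omega
      rw [psiStar_of_neg hm, psi_of_nonneg hn, hc, hc, map_smul, smul_smul, h1]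
    · have h1 : levelWeight r n = rProd r n k * levelWeight r (n - k) := by
        have h2 := rProd_add r (-1) k (n - k + 1).toNat
        rw [show -1 + (((n - k + 1).toNat : ℕ) : ℤ) + k = n by omega,
          show -1 + (((n - k + 1).toNat : ℕ) : ℤ) = n - k by omega] at h2
        rw [levelWeight, if_pos hn, levelWeight, if_pos hm, ← h2]
        congr 1
        omega
      rw [psiStar_of_nonneg hm, psi_of_nonneg hn, hc, h1, ← ha, map_smul, smul_smul]

theorem opA_chargedWeightOp (r : ℤ → ℂ) {k : ℕ} (hk : k ≠ 0) (v : Fock ℤ) :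
    opA r k (chargedWeightOp r v) = chargedWeightOp r (opA 1 k v) := by
  have hk0 : -(k : ℤ) ≠ 0 := by omega
  rw [opA_eq r hk, opA_eq 1 hk, (locallyFinite_psiBilinear _ hk0).sumOp_apply,
    (locallyFinite_psiBilinear _ hk0).map_sumOp_apply]
  refine finsum_congr fun n => ?_
  have h3 : rProd 1 n k = 1 := by simp [rProd]
  rw [psiBilinear_apply, psiBilinear_apply, map_smul, ← sub_eq_add_neg,
    chargedWeightOp_psi_psiStar r hk, h3, smul_smul, neg_one_mul]

/-- The charge of the state `ket S`. -/
def charge (S : Finset ℤ) : ℤ := ∑ n ∈ S, if 0 ≤ n then 1 else -1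

/-- The operator with eigenvalues `2 ^ charge S`. -/
def chargeOp : Module.End ℂ (Fock ℤ) := diagOp fun S => ∏ n ∈ S, if 0 ≤ n then 2 else 2⁻¹

theorem chargeOp_ket (S : Finset ℤ) : chargeOp (ket S) = (2 : ℂ) ^ charge S • ket S := by
  rw [chargeOp, diagOp_ket, charge]
  congr 1
  induction S using Finset.induction_on with
  | empty => simp
  | insert n S hn ih =>
    rw [prod_insert hn, sum_insert hn, ih, zpow_add₀ (by norm_num)]
    congr 1
    split_ifs <;> simp

theorem chargeOp_create (n : ℤ) (v : Fock ℤ) : chargeOp (create n v) =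
    (if 0 ≤ n then 2 else 2⁻¹ : ℂ) • create n (chargeOp v) :=
  LinearMap.congr_fun (diagOp_create (fun n : ℤ => if 0 ≤ n then 2 else 2⁻¹) n) v

theorem chargeOp_annihilate (n : ℤ) (v : Fock ℤ) : (if 0 ≤ n then 2 else 2⁻¹ : ℂ) •
    chargeOp (annihilate n v) = annihilate n (chargeOp v) :=
  LinearMap.congr_fun (diagOp_annihilate (fun n : ℤ => if 0 ≤ n then 2 else 2⁻¹) n) v

theorem chargeOp_psi (n : ℤ) (v : Fock ℤ) : chargeOp (psi n v) = (2 : ℂ) • psi n (chargeOp v) := by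
  rcases lt_or_ge n 0 with hn | hn
  · rw [psi_of_neg hn, ← chargeOp_annihilate, if_neg hn.not_ge, smul_smul,
      mul_inv_cancel₀ (by norm_num), one_smul]
  · rw [psi_of_nonneg hn, chargeOp_create, if_pos hn]

theorem chargeOp_psiStar (n : ℤ) (v : Fock ℤ) :
    chargeOp (psiStar n v) = (2⁻¹ : ℂ) • psiStar n (chargeOp v) := by
  rcases lt_or_ge n 0 with hn | hn
  · rw [psiStar_of_neg hn, chargeOp_create, if_neg hn.not_ge]
  · rw [psiStar_of_nonneg hn, ← chargeOp_annihilate, if_pos hn, smul_smul,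
      inv_mul_cancel₀ (by norm_num), one_smul]

theorem chargeOp_hamKP {k : ℕ} (hk : k ≠ 0) (v : Fock ℤ) :
    chargeOp (hamKP k v) = hamKP k (chargeOp v) := by
  have hk0 : (k : ℤ) ≠ 0 := by exact_mod_cast hk
  rw [hamKP_eq, (locallyFinite_psiBilinear 1 hk0).map_sumOp_apply,
    (locallyFinite_psiBilinear 1 hk0).sumOp_apply]
  refine finsum_congr fun n => ?_
  rw [psiBilinear_apply, psiBilinear_apply, map_smul, chargeOp_psi, chargeOp_psiStar, map_smul,
    smul_smul (2 : ℂ), mul_inv_cancel₀ (by norm_num), one_smul]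

/-! ### The KP tau function as a sum over states -/

section KP

variable {σ : Type}

/-- The evolution operator `exp (∑ t_m H^{KP}_m)` of the KP hierarchy. -/
def evolKP (χ : σ → ℕ) : MvPowerSeries σ (Module.End ℂ (Fock ℤ)) :=
  formalExp (linForm (flow χ fun k => hamKP k))

/-- The evolution operator `exp (-∑ t*_m A_m)`. -/
def dualEvolKP (r : ℤ → ℂ) (χ : σ → ℕ) : MvPowerSeries σ (Module.End ℂ (Fock ℤ)) :=
  formalExp (linForm (flow χ fun k => -opA r k))

theorem pderiv_vacSeries_evolKP (χ : σ → ℕ) (s : σ) (v : Fock ℤ) :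
    MvPowerSeries.pderiv ℂ s (vacSeries (evolKP χ) v) =
      if χ s = 0 then 0 else vacSeries (evolKP χ) (hamKP (χ s) v) := by
  rw [evolKP, pderiv_vacSeries (commute_flow fun s s' h h' => commute_hamKP h h'), flow]
  split_ifs
  · simp
  · rfl

/-- The evolution conserves the charge. -/
theorem vacSeries_ket_of_charge_ne_zero (χ : σ → ℕ) {S : Finset ℤ} (hS : charge S ≠ 0) :
    vacSeries (evolKP χ) (ket S) = 0 := by
  have h0 : Intertwines chargeOp (evolKP χ) (evolKP χ) := by
    refine (Intertwines.linForm fun s v => ?_).formalExp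
    rw [flow]
    split_ifs with h
    · simp
    · exact chargeOp_hamKP h v
  ext m
  have h1 := congrArg (fun v : Fock ℤ => v ∅) (h0 m (ket S))
  rw [chargeOp_ket, map_smul] at h1
  simp only [chargeOp, diagOp_apply, prod_empty, one_mul, Finsupp.smul_apply, smul_eq_mul] at h1
  rw [coeff_vacSeries, map_zero]
  by_contra h
  have h2 : (2 : ℂ) ^ charge S = 1 := mul_right_cancel₀ h (by rw [one_mul, ← h1])
  have h3 := congrArg norm h2
  rw [norm_zpow, norm_one, Complex.norm_ofNat] at h3
  exact hS ((zpow_eq_one_iff_right₀ (by norm_num) (by norm_num)).1 h3)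

/-- The coefficients of `e^{-A(t*)} |0⟩`. -/
theorem matrixElement_dualEvolKP (r : ℤ → ℂ) (χ : σ → ℕ) (S : Finset ℤ) :
    matrixElement S ∅ (dualEvolKP r χ) =
      (∏ n ∈ S, levelWeight r n) • vacSeries (evolKP χ) (ket S) := by
  ext m
  have h1 : Intertwines (chargedWeightOp r) (dualEvolKP 1 χ) (dualEvolKP r χ) := by
    refine (Intertwines.linForm fun s v => ?_).formalExp
    rw [flow, flow]
    split_ifs with h
    · simp
    · rw [LinearMap.neg_apply, LinearMap.neg_apply, map_neg, opA_chargedWeightOp r h]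
  have h2 := congrArg (fun v : Fock ℤ => v S) (h1 m (ket ∅))
  simp only [chargedWeightOp, diagOp_ket, diagOp_apply, prod_empty, one_smul] at h2
  have h3 : diagForm (fun _ => 1) (coeff m (dualEvolKP 1 χ) (ket ∅)) (ket S) =
      diagForm (fun _ => 1) (ket ∅) (coeff m (evolKP χ) (ket S)) := by
    refine formalExp_linForm_adjoint (diagForm fun _ => 1) (fun s x y => ?_) m _ _
    rw [flow, flow]
    split_ifs with h
    · simp
    · exact diagForm_opA_one h x y
  rw [diagForm_ket_right, diagForm_ket_left, one_mul, one_mul] at h3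
  rw [coeff_matrixElement, ← h2, MvPowerSeries.coeff_smul, coeff_vacSeries, ← h3]

theorem hasSum_evolKP (r : ℤ → ℂ) :
    HasSum (fun S : Finset ℤ => (∏ n ∈ S, levelWeight r n) •
      (vacSeries (evolKP oddIndexT) (ket S) * vacSeries (evolKP oddIndexTStar) (ket S)))
      (formalExpectation ∅ (evolKP oddIndexT * dualEvolKP r oddIndexTStar)) := by
  have h := hasSum_formalExpectation_mul (evolKP oddIndexT) (dualEvolKP r oddIndexTStar)
  convert h using 2 with S
  rw [matrixElement_dualEvolKP, mul_smul_comm]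
  rfl

end KP

/-! ### Determinants as vacuum expectations -/

section Determinants

/-- The product `ψ_{a_1} ⋯ ψ_{a_l}`. -/
def psiProd (l : List ℤ) : Module.End ℂ (Fock ℤ) := (l.map psi).prod

theorem psiProd_cons (a : ℤ) (l : List ℤ) (v : Fock ℤ) :
    psiProd (a :: l) v = psi a (psiProd l v) := by
  rw [psiProd, List.map_cons, List.prod_cons]
  rfl

/-- The operators `ψ_a` fill the levels `a`, provided that these are unoccupied and distinct. -/
theorem psiProd_ket {l : List ℤ} (hl : l.Nodup) (S : Finset ℤ) :
    ∃ ε : ℂ, ε * ε = 1 ∧ psiProd l (ket S) =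
      if ∃ a ∈ l, (a ∈ S ↔ 0 ≤ a) then 0 else ε • ket (symmDiff S l.toFinset) := by
  induction l with
  | nil =>
    refine ⟨1, one_mul 1, ?_⟩
    rw [List.toFinset_nil, ← bot_eq_empty, symmDiff_bot]
    simp [psiProd]
  | cons a l ih =>
    rw [List.nodup_cons] at hl
    obtain ⟨ε, hε, h⟩ := ih hl.2
    refine ⟨ε * wedgeSign a (symmDiff S l.toFinset), ?_, ?_⟩
    · rw [mul_mul_mul_comm, hε, wedgeSign_mul_self, one_mul]
    · have ha : a ∈ symmDiff S l.toFinset ↔ a ∈ S := by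
        simp [mem_symmDiff, hl.1]
      rw [psiProd_cons, h]
      by_cases h1 : ∃ b ∈ l, (b ∈ S ↔ 0 ≤ b)
      · obtain ⟨b, hb, hb'⟩ := h1
        rw [if_pos ⟨b, hb, hb'⟩, if_pos ⟨b, List.mem_cons_of_mem _ hb, hb'⟩, map_zero]
      · rw [if_neg h1, map_smul, psi_ket]
        by_cases h2 : a ∈ S ↔ 0 ≤ a
        · rw [if_pos (ha.trans h2), if_pos ⟨a, List.mem_cons_self, h2⟩, smul_zero]
        · rw [if_neg fun h3 => h2 (ha.symm.trans h3), if_neg, smul_smul, List.toFinset_cons,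
            insert_eq_symmDiff (by simpa using hl.1), symmDiff_assoc]
          rintro ⟨b, hb, hb'⟩
          rcases List.mem_cons.1 hb with rfl | hb
          · exact h2 hb'
          · exact h1 ⟨b, hb, hb'⟩

/-- Products of operators `ψ_a`, as an alternating function of their arguments. -/
def psiAlternating (n : ℕ) : (ℤ →₀ ℂ) [⋀^Fin n]→ₗ[ℂ] Module.End ℂ (Fock ℤ) :=
  (ExteriorAlgebra.lift ℂ ⟨Finsupp.linearCombination ℂ psi, fun v => by
    have h : ∀ v w, Finsupp.linearCombination ℂ psi v * Finsupp.linearCombination ℂ psi w +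
        Finsupp.linearCombination ℂ psi w * Finsupp.linearCombination ℂ psi v = 0 := by
      intro v w
      induction v using Finsupp.induction_linear with
      | zero => simp
      | add x y hx hy =>
        rw [map_add, add_mul, mul_add, add_add_add_comm, hx, hy, add_zero]
      | single a x =>
        induction w using Finsupp.induction_linear with
        | zero => simp
        | add x y hx hy =>
          rw [map_add, add_mul, mul_add, add_add_add_comm, hx, hy, add_zero]
        | single b y =>
          rw [Finsupp.linearCombination_single, Finsupp.linearCombination_single,
            smul_mul_smul_comm, smul_mul_smul_comm, mul_comm y, ← smul_add, psi_mul_psi, smul_zero]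
    have h1 := h v v
    rw [← two_smul ℂ] at h1
    exact (smul_eq_zero.1 h1).resolve_left (by norm_num)⟩).toLinearMap.compAlternatingMap
    (ExteriorAlgebra.ιMulti ℂ n)

theorem psiAlternating_single {n : ℕ} (a : Fin n → ℤ) :
    psiAlternating n (fun i => Finsupp.single (a i) 1) = psiProd (List.ofFn a) := by
  rw [psiAlternating, psiProd, LinearMap.compAlternatingMap_apply, ExteriorAlgebra.ιMulti_apply,
    AlgHom.toLinearMap_apply, map_list_prod, List.map_ofFn, List.map_ofFn]
  congr 2
  funext i
  simp

/-- The vacuum component of `ψ_{a_1} ⋯ ψ_{a_n} |-n⟩`. -/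
theorem exists_psiProd_apply_empty (n : ℕ) : ∃ ε : ℂ, ε * ε = 1 ∧ ∀ a : Fin n → ℤ,
    psiProd (List.ofFn a) (ket (Ico (-(n : ℤ)) 0)) ∅ =
      ε * Matrix.det (Matrix.of fun i j : Fin n => if a i + j + 1 = 0 then (1 : ℂ) else 0) := by
  set b : Fin n → ℤ := fun i => -(i : ℤ) - 1 with hb
  have hbinj : Function.Injective b := fun i j h => by
    simp only [hb] at h
    omega
  have hbset : (List.ofFn b).toFinset = Ico (-(n : ℤ)) 0 := by
    ext x
    rw [List.mem_toFinset, List.mem_ofFn, mem_Ico]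
    constructor
    · rintro ⟨i, rfl⟩
      simp only [hb]
      omega
    · intro hx
      exact ⟨⟨(-x - 1).toNat, by omega⟩, by simp only [hb]; omega⟩
  obtain ⟨ε, hε, h⟩ := psiProd_ket (List.nodup_ofFn.2 hbinj) (Ico (-(n : ℤ)) 0)
  refine ⟨ε, hε, ?_⟩
  let A : (ℤ →₀ ℂ) [⋀^Fin n]→ₗ[ℂ] ℂ := (Finsupp.lapply ∅ ∘ₗ
    LinearMap.applyₗ (R := ℂ) (ket (Ico (-(n : ℤ)) 0))).compAlternatingMap (psiAlternating n)
  let B : (ℤ →₀ ℂ) [⋀^Fin n]→ₗ[ℂ] ℂ := Matrix.detRowAlternating.compLinearMap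
    (Finsupp.linearCombination ℂ fun m : ℤ => fun j : Fin n =>
      if m + (j : ℤ) + 1 = 0 then (1 : ℂ) else 0)
  have hA : ∀ a : Fin n → ℤ, A (fun i => Finsupp.single (a i) 1) =
      psiProd (List.ofFn a) (ket (Ico (-(n : ℤ)) 0)) ∅ := fun a => by
    rw [← psiAlternating_single]
    rfl
  have hB : ∀ a : Fin n → ℤ, B (fun i => Finsupp.single (a i) 1) =
      Matrix.det (Matrix.of fun i j : Fin n => if a i + j + 1 = 0 then (1 : ℂ) else 0) := by
    intro a
    change Matrix.det _ = _
    congr 1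
    funext i
    simp
    rfl
  suffices hAB : A = ε • B by
    intro a
    rw [← hA, hAB, ← hB]
    rfl
  refine Module.Basis.ext_alternating Finsupp.basisSingleOne fun a ha => ?_
  simp only [Finsupp.coe_basisSingleOne]
  by_cases hab : ∀ i, a i ∈ Ico (-(n : ℤ)) 0
  · -- The `a i` are a permutation of the levels which are filled by `|0⟩` but not by `|-n⟩`.
    have h1 : ∀ i, ∃ j, b j = a i := fun i =>
      List.mem_ofFn.1 (List.mem_toFinset.1 (hbset ▸ hab i))
    choose τ hτ using h1
    have hτinj : Function.Injective τ := fun i j hij => ha (by rw [← hτ, ← hτ, hij])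
    let π : Equiv.Perm (Fin n) := Equiv.ofBijective τ (Finite.injective_iff_bijective.1 hτinj)
    have h2 : (fun i => Finsupp.single (a i) (1 : ℂ)) =
        (fun j => Finsupp.single (b j) (1 : ℂ)) ∘ π := by
      funext i
      exact congrArg (Finsupp.single · 1) (hτ i).symm
    have h3 : A (fun j => Finsupp.single (b j) 1) = ε := by
      rw [hA, h, hbset, if_neg, symmDiff_self]
      · simp [ket]
      · rintro ⟨c, hc, hc'⟩
        rw [← List.mem_toFinset, hbset] at hc
        exact absurd (mem_Ico.1 hc).2 (not_lt.2 (hc'.1 hc))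
    have h4 : B (fun j => Finsupp.single (b j) 1) = 1 := by
      rw [hB]
      refine (congrArg Matrix.det ?_).trans Matrix.det_one
      ext i j
      rw [Matrix.of_apply, Matrix.one_apply]
      refine if_congr ?_ rfl rfl
      simp only [hb, Fin.ext_iff]
      omega
    rw [h2, AlternatingMap.map_perm, AlternatingMap.map_perm, h3, AlternatingMap.smul_apply, h4,
      smul_eq_mul, mul_one]
  · push Not at hab
    obtain ⟨i, hi⟩ := hab
    obtain ⟨ε', -, h'⟩ := psiProd_ket (List.nodup_ofFn.2 ha) (Ico (-(n : ℤ)) 0)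
    have h1 : A (fun i => Finsupp.single (a i) 1) = 0 := by
      rw [hA, h']
      split_ifs with h2
      · rfl
      · rw [Finsupp.smul_apply, ket_apply_of_ne, smul_zero]
        intro h3
        have h4 := symmDiff_eq_bot.1 h3.symm
        rw [h4] at hi
        exact hi (List.mem_toFinset.2 (List.mem_ofFn.2 ⟨i, rfl⟩))
    have h2 : B (fun i => Finsupp.single (a i) 1) = 0 := by
      rw [hB]
      refine Matrix.det_eq_zero_of_row_eq_zero i fun j => ?_
      rw [mem_Ico] at hi
      rw [Matrix.of_apply, if_neg (by omega)]
    rw [h1, AlternatingMap.smul_apply, h2, smul_zero]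

theorem psiProd_hamKP {k : ℕ} (hk : k ≠ 0) {v : Fock ℤ} (hv : hamKP k v = 0) (l : List ℤ) :
    hamKP k (psiProd l v) = shiftSum k (fun m => psiProd m v) l := by
  induction l with
  | nil => exact hv
  | cons a l ih =>
    have h : (fun m => psiProd (a :: m) v) = fun m => psi a (psiProd m v) :=
      funext fun m => psiProd_cons a m v
    rw [psiProd_cons, hamKP_psi hk, ih, shiftSum, h, psiProd_cons, add_comm]
    congr 1
    exact map_shiftSum (psi a).toAddMonoidHom k (fun m => psiProd m v) l

theorem shiftSum_ofFn {M : Type} [AddCommMonoid M] (k : ℤ) (G : List ℤ → M) {n : ℕ}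
    (a : Fin n → ℤ) : shiftSum k G (List.ofFn a) =
      ∑ i, G (List.ofFn (Function.update a i (a i - k))) := by
  induction n generalizing G with
  | zero => simp [shiftSum]
  | succ n ih =>
    rw [List.ofFn_succ, shiftSum, ih, Fin.sum_univ_succ]
    congr 1
    · rw [List.ofFn_succ]
      simp
    · refine sum_congr rfl fun i _ => ?_
      rw [List.ofFn_succ, Function.update_of_ne (Fin.succ_ne_zero i).symm]
      congr 3
      funext j
      by_cases hij : j = i
      · subst hij; simp
      · rw [Function.update_of_ne hij, Function.update_of_ne fun h => hij (Fin.succ_injective _ h)]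

theorem derivation_prod {R : Type} [CommRing R] [Algebra ℂ R] (D : Derivation ℂ R R) {n : ℕ}
    (f : Fin n → R) : D (∏ j, f j) = ∑ i, ∏ j, Function.update f i (D (f i)) j := by
  induction n with
  | zero => simp
  | succ n ih =>
    rw [Fin.prod_univ_succ, Derivation.leibniz, ih, Fin.sum_univ_succ, add_comm, smul_eq_mul,
      smul_eq_mul, mul_sum]
    congr 1
    · rw [Fin.prod_univ_succ, mul_comm]
      simp
    · refine sum_congr rfl fun i _ => ?_
      rw [Fin.prod_univ_succ, Function.update_of_ne (Fin.succ_ne_zero i).symm]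
      congr 1
      refine prod_congr rfl fun j _ => ?_
      by_cases hij : j = i
      · subst hij; simp
      · rw [Function.update_of_ne hij, Function.update_of_ne fun h => hij (Fin.succ_injective _ h)]

/-- The derivative of a determinant is the sum of the determinants in which one row has been
differentiated. -/
theorem derivation_det {R : Type} [CommRing R] [Algebra ℂ R] (D : Derivation ℂ R R) {n : ℕ}
    (M : Matrix (Fin n) (Fin n) R) :
    D M.det = ∑ i, (M.updateRow i fun j => D (M i j)).det := by
  have h : ∀ M : Matrix (Fin n) (Fin n) R,
      M.det = ∑ π : Equiv.Perm (Fin n), (Equiv.Perm.sign π : ℤ) • ∏ i, M i (π i) := fun M => by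
    rw [← Matrix.det_transpose, Matrix.det_apply]
    rfl
  rw [h, map_sum]
  simp only [h, map_zsmul, derivation_prod, smul_sum]
  rw [sum_comm]
  refine sum_congr rfl fun i _ => sum_congr rfl fun π _ => ?_
  congr 1
  refine prod_congr rfl fun j _ => ?_
  by_cases hij : j = i
  · subst hij; simp
  · rw [Function.update_of_ne hij, Matrix.updateRow_ne hij]

variable {σ : Type}

/-- The evolution of the states `ψ_{a_1} ⋯ ψ_{a_n} |-n⟩` is given by determinants of complete
symmetric functions. -/
theorem exists_vacSeries_psiProd (n : ℕ) : ∃ ε : ℂ, ε * ε = 1 ∧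
    ∀ {t : ℕ+ → MvPowerSeries σ ℂ} {χ : σ → ℕ}, IsTimes t χ → ∀ a : Fin n → ℤ,
      vacSeries (evolKP χ) (psiProd (List.ofFn a) (ket (Ico (-(n : ℤ)) 0))) =
        ε • Matrix.det (Matrix.of fun i j : Fin n => hSymInt t (a i + j + 1)) := by
  obtain ⟨ε, hε, h⟩ := exists_psiProd_apply_empty n
  refine ⟨ε, hε, fun {t χ} ht a => sub_eq_zero.1 (eq_zero_of_pderiv_mem_span (fun a : Fin n → ℤ =>
    vacSeries (evolKP χ) (psiProd (List.ofFn a) (ket (Ico (-(n : ℤ)) 0))) -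
      ε • Matrix.det (Matrix.of fun i j : Fin n => hSymInt t (a i + j + 1)))
    (fun s a => ?_) (fun a => ?_) a)⟩
  · rw [map_sub, Derivation.map_smul, pderiv_vacSeries_evolKP, derivation_det]
    simp only [Matrix.of_apply, ht.pderiv_hSymInt]
    by_cases hs : χ s = 0
    · have h1 : ∀ i, ((Matrix.of fun i j : Fin n => hSymInt t (a i + j + 1)).updateRow i
          fun _ => 0).det = 0 := fun i =>
        Matrix.det_eq_zero_of_row_eq_zero i fun j => by rw [Matrix.updateRow_self]
      simp only [hs, if_true]
      rw [sum_eq_zero fun i _ => h1 i, smul_zero, sub_zero]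
      exact zero_mem _
    · simp only [hs, if_false]
      have h1 : ∀ i, (Matrix.of fun i j : Fin n => hSymInt t (a i + j + 1)).updateRow i
          (fun j => hSymInt t (a i + j + 1 - χ s)) = Matrix.of fun i' j : Fin n =>
            hSymInt t (Function.update a i (a i - χ s) i' + j + 1) := by
        intro i
        ext1 i' j
        by_cases hi : i' = i
        · subst hi
          rw [Matrix.updateRow_self, Matrix.of_apply, Function.update_self]
          congr 1
          ring
        · rw [Matrix.updateRow_ne hi, Matrix.of_apply, Matrix.of_apply, Function.update_of_ne hi]
      simp only [h1]
      rw [psiProd_hamKP hs (hamKP_ket_Ico hs n), shiftSum_ofFn, map_sum, smul_sum,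
        ← sum_sub_distrib]
      exact Submodule.sum_mem _ fun i _ => Submodule.subset_span ⟨_, rfl⟩
  · rw [map_sub, evolKP, coeff_zero_vacSeries_formalExp, h, MvPowerSeries.coeff_smul, sub_eq_zero]
    congr 1
    refine Eq.trans ?_ (RingHom.map_det (constantCoeff (σ := σ) (R := ℂ)) _).symm
    congr 1
    ext i j
    exact (ht.coeff_zero_hSymInt _).symm

end Determinants

/-! ### Partitions as states of charge zero -/

/-- The levels which are occupied in the state of a partition. -/
def partLevel (μ : YoungDiagram) (i : ℕ) : ℤ := μ.rowLen i - i - 1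

theorem partLevel_strictAnti (μ : YoungDiagram) : StrictAnti (partLevel μ) := by
  intro i j h
  have := μ.rowLen_anti i j h.le
  rw [partLevel, partLevel]
  omega

theorem neg_le_partLevel (μ : YoungDiagram) (i : ℕ) : -(i : ℤ) - 1 ≤ partLevel μ i := by
  rw [partLevel]
  omega

/-- The set of excited modes of the state in which the levels `-1, …, -l` have been moved to the
levels determined by the first `l` rows of `μ`. -/
def rowState (μ : YoungDiagram) (l : ℕ) : Finset ℤ :=
  symmDiff (Ico (-(l : ℤ)) 0) ((range l).image (partLevel μ))

/-- The set of excited modes which corresponds to a partition. -/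
def partitionState (μ : YoungDiagram) : Finset ℤ := rowState μ (μ.colLen 0)

theorem rowLen_eq_zero {μ : YoungDiagram} {i : ℕ} (h : μ.colLen 0 ≤ i) : μ.rowLen i = 0 := by
  by_contra h'
  have := YoungDiagram.mem_iff_lt_colLen.1
    (YoungDiagram.mem_iff_lt_rowLen.2 (Nat.pos_of_ne_zero h') : (i, 0) ∈ μ)
  omega

/-- An excitation of the vacuum is a level `n` which is either `≥ 0` and of the form `μ_i - i`
(counting rows from `1`), or `< 0` and not of this form. -/
theorem mem_rowState {μ : YoungDiagram} {l : ℕ} (hl : μ.colLen 0 ≤ l) (n : ℤ) :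
    n ∈ rowState μ l ↔ ¬((∃ i, partLevel μ i = n) ↔ n < 0) := by
  rw [rowState, mem_symmDiff, mem_Ico, mem_image]
  simp only [mem_range]
  by_cases hn : -(l : ℤ) ≤ n
  · have h1 : (∃ i, partLevel μ i = n) ↔ ∃ i, i < l ∧ partLevel μ i = n := by
      refine ⟨?_, fun ⟨i, _, hi⟩ => ⟨i, hi⟩⟩
      rintro ⟨i, hi⟩
      refine ⟨i, ?_, hi⟩
      by_contra h
      rw [partLevel, rowLen_eq_zero (by omega)] at hi
      omega
    rw [h1]
    simp only [hn, true_and]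
    by_cases h2 : n < 0 <;> by_cases h3 : ∃ i, i < l ∧ partLevel μ i = n <;> simp only [h2, h3] <;>
      simp
  · have h1 : ∃ i, partLevel μ i = n := ⟨(-n - 1).toNat, by
      rw [partLevel, rowLen_eq_zero (by omega)]
      omega⟩
    have h2 : ¬ ∃ i, i < l ∧ partLevel μ i = n := by
      rintro ⟨i, hi, rfl⟩
      have := neg_le_partLevel μ i
      omega
    simp only [h1, h2, hn, false_and, or_self, false_iff, true_iff, not_not]
    omega

theorem rowState_eq {μ : YoungDiagram} {l : ℕ} (hl : μ.colLen 0 ≤ l) :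
    rowState μ l = partitionState μ := by
  ext n
  rw [partitionState, mem_rowState hl, mem_rowState le_rfl]

theorem partitionState_injective : Function.Injective partitionState := by
  intro μ ν h
  have h1 : Set.range (partLevel μ) = Set.range (partLevel ν) := by
    ext n
    have h2 := mem_rowState (le_refl (μ.colLen 0)) n
    have h3 := mem_rowState (le_refl (ν.colLen 0)) n
    change n ∈ partitionState μ ↔ _ at h2
    rw [h] at h2
    have h4 := h2.symm.trans h3
    rw [Set.mem_range, Set.mem_range]
    tauto
  have h2 : partLevel μ = partLevel ν := by
    have h3 := (StrictMono.range_inj (partLevel_strictAnti μ).dual_right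
      (partLevel_strictAnti ν).dual_right).1 (by
        rw [Set.range_comp, Set.range_comp, h1])
    funext i
    exact OrderDual.toDual.injective (congrFun h3 i)
  ext ⟨i, j⟩
  have h3 := congrFun h2 i
  rw [partLevel, partLevel] at h3
  rw [YoungDiagram.mem_cells, YoungDiagram.mem_cells, YoungDiagram.mem_iff_lt_rowLen,
    YoungDiagram.mem_iff_lt_rowLen]
  omega

theorem card_symmDiff_Ico {S : Finset ℤ} {l : ℕ} (hl : ∀ n ∈ S, -(l : ℤ) ≤ n) :
    ((symmDiff S (Ico (-(l : ℤ)) 0)).card : ℤ) = l + charge S := by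
  induction S using Finset.induction_on with
  | empty => rw [← bot_eq_empty, bot_symmDiff]; simp [charge]
  | insert n S hn ih =>
    have ih' := ih fun m hm => hl m (mem_insert_of_mem hm)
    have hnl := hl n (mem_insert_self n S)
    rw [insert_eq_symmDiff hn, symmDiff_right_comm, ← insert_eq_symmDiff hn, charge,
      sum_insert hn, ← charge]
    rcases lt_or_ge n 0 with h | h
    · have h1 : n ∈ symmDiff S (Ico (-(l : ℤ)) 0) := by
        rw [mem_symmDiff, mem_Ico]
        exact Or.inr ⟨⟨hnl, h⟩, hn⟩
      rw [← erase_eq_symmDiff h1, card_erase_of_mem h1, if_neg h.not_ge,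
        Nat.cast_sub (card_pos.2 ⟨n, h1⟩), ih']
      push_cast
      ring
    · have h1 : n ∉ symmDiff S (Ico (-(l : ℤ)) 0) := by
        rw [mem_symmDiff, mem_Ico]
        rintro (h2 | h2)
        · exact hn h2.1
        · omega
      rw [← insert_eq_symmDiff h1, card_insert_of_notMem h1, if_pos h, Nat.cast_add, ih']
      push_cast
      ring

/-- The `l` occupied levels `≥ -l` of a state `S` of charge zero, listed decreasingly and increased
by `1, …, l`, are the parts of the partition of `S`. -/
theorem exists_partitionState_eq {S : Finset ℤ} (hS : charge S = 0) :
    ∃ μ, partitionState μ = S := by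
  obtain ⟨l, hl⟩ : ∃ l : ℕ, ∀ n ∈ S, -(l : ℤ) ≤ n := ⟨S.sup Int.natAbs, fun n hn => by
    have := le_sup (f := Int.natAbs) hn
    omega⟩
  set A := symmDiff S (Ico (-(l : ℤ)) 0) with hA
  have hcard : A.card = l := by
    have := card_symmDiff_Ico hl
    rw [hS, add_zero] at this
    exact_mod_cast this
  have hAl : ∀ n ∈ A, -(l : ℤ) ≤ n := by
    intro n hn
    rw [hA, mem_symmDiff, mem_Ico] at hn
    rcases hn with h | h
    · exact hl n h.1
    · exact h.1.1
  let b := A.orderEmbOfFin hcard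
  have hb : ∀ (d : ℕ) (x y : Fin l), (y : ℕ) = x + d → b x + d ≤ b y := by
    intro d
    induction d with
    | zero =>
      intro x y h
      rw [Fin.ext (a := y) (b := x) (by omega)]
      simp
    | succ d ih =>
      intro x y h
      have h1 := ih x ⟨x + d, by omega⟩ rfl
      have h2 : b ⟨x + d, by omega⟩ < b y := b.strictMono (Fin.lt_def.2 (by simp only; omega))
      push_cast
      omega
  let f : Fin l → ℕ := fun i => (b i.rev + i + 1).toNat
  have hf : ∀ i, (f i : ℤ) = b i.rev + i + 1 := by
    intro i
    have hi := i.isLt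
    have h1 := hb (l - 1 - i) ⟨0, by omega⟩ i.rev (by rw [Fin.val_rev]; simp only; omega)
    have h2 := hAl _ (A.orderEmbOfFin_mem hcard ⟨0, by omega⟩)
    change -(l : ℤ) ≤ b _ at h2
    simp only [f]
    omega
  have hw : (List.ofFn f).SortedGE := by
    rw [List.sortedGE_ofFn_iff]
    intro i j hij
    have h1 := hb (j - i) j.rev i.rev (by rw [Fin.val_rev, Fin.val_rev]; omega)
    have h2 := hf i
    have h3 := hf j
    have h4 : (i : ℕ) ≤ j := hij
    omega
  let μ := YoungDiagram.ofRowLens (List.ofFn f) hw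
  have hμ : ∀ i : Fin l, μ.rowLen i = f i := fun i => by
    have h := YoungDiagram.rowLen_ofRowLens (hw := hw) ⟨i, by simp⟩
    simpa using h
  have hcol : μ.colLen 0 ≤ l := by
    by_contra h
    obtain ⟨h1, -⟩ := YoungDiagram.mem_ofRowLens.1
      (YoungDiagram.mem_iff_lt_colLen.2 (not_le.1 h) : (l, 0) ∈ μ)
    simp at h1
  refine ⟨μ, ?_⟩
  rw [← rowState_eq hcol, rowState]
  have himage : (range l).image (partLevel μ) = A := by
    ext n
    rw [mem_image]
    have hlev : ∀ i : Fin l, partLevel μ i = b i.rev := fun i => by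
      rw [partLevel, hμ, hf]
      ring
    constructor
    · rintro ⟨i, hi, rfl⟩
      have := hlev ⟨i, mem_range.1 hi⟩
      simp only at this
      rw [this]
      exact A.orderEmbOfFin_mem hcard _
    · intro hn
      obtain ⟨j, hj⟩ : n ∈ Set.range b := by rw [A.range_orderEmbOfFin hcard]; exact hn
      refine ⟨j.rev, mem_range.2 j.rev.isLt, ?_⟩
      rw [hlev, Fin.rev_rev, hj]
  rw [himage, hA, symmDiff_comm S, symmDiff_symmDiff_cancel_left]

/-- Moving a particle from the level `m` to the level `n > m` multiplies the weight of a state by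
the values of `r` on the levels from `m + 1` to `n`. -/
theorem prod_levelWeight_move (r : ℤ → ℂ) {S : Finset ℤ} {n : ℤ} {k : ℕ} (hk : k ≠ 0)
    (hm : n - k ∈ S ↔ 0 ≤ n - k) (hn : ¬(n ∈ S ↔ 0 ≤ n)) :
    ∏ j ∈ symmDiff (symmDiff S {n - (k : ℤ)}) {n}, levelWeight r j =
      rProd r n k * ∏ j ∈ S, levelWeight r j := by
  have hn' : ¬(n ∈ symmDiff S {n - (k : ℤ)} ↔ 0 ≤ n) := by
    have : n ∈ symmDiff S {n - (k : ℤ)} ↔ n ∈ S := by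
      have h : n ≠ n - (k : ℤ) := by omega
      simp [mem_symmDiff, h]
    rwa [this]
  have h := chargedWeightOp_psi_psiStar r hk n (ket S)
  simp only [chargedWeightOp, diagOp_ket, map_smul] at h
  rw [psiStar_ket, if_pos hm, map_smul, psi_ket, if_neg hn', map_smul, map_smul, diagOp_ket] at h
  have h1 := congrArg (fun v : Fock ℤ => v (symmDiff (symmDiff S {n - (k : ℤ)}) {n})) h
  simp only [Finsupp.smul_apply, ket_apply_self, smul_eq_mul, mul_one] at h1
  have h2 : ∀ i S, wedgeSign i (S : Finset ℤ) ≠ 0 := fun i S h => by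
    have := wedgeSign_mul_self i S
    rw [h, mul_zero] at this
    exact zero_ne_one this
  refine mul_left_cancel₀ (mul_ne_zero (h2 (n - k) S) (h2 n (symmDiff S {n - (k : ℤ)}))) ?_
  linear_combination h1

theorem prod_levelWeight_rowState (r : ℤ → ℂ) (μ : YoungDiagram) (l : ℕ) :
    ∏ n ∈ rowState μ l, levelWeight r n =
      ∏ i ∈ range l, ∏ j ∈ range (μ.rowLen i), r ((j : ℤ) - i) := by
  induction l with
  | zero => simp [rowState]
  | succ l ih =>
    have h1 : partLevel μ l ∉ (range l).image (partLevel μ) := by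
      rw [mem_image]
      rintro ⟨i, hi, h⟩
      have := (partLevel_strictAnti μ).injective h
      rw [mem_range] at hi
      omega
    have h2 : -(l : ℤ) - 1 ∉ Ico (-(l : ℤ)) 0 := by rw [mem_Ico]; omega
    have h3 : Ico (-((l + 1 : ℕ) : ℤ)) 0 = symmDiff (Ico (-(l : ℤ)) 0) {-(l : ℤ) - 1} := by
      rw [← insert_eq_symmDiff h2]
      ext n
      rw [mem_insert, mem_Ico, mem_Ico]
      omega
    have h4 : rowState μ (l + 1) =
        symmDiff (symmDiff (rowState μ l) {-(l : ℤ) - 1}) {partLevel μ l} := by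
      rw [rowState, range_add_one, image_insert, insert_eq_symmDiff h1, h3, rowState,
        ← symmDiff_assoc, symmDiff_right_comm (Ico (-(l : ℤ)) 0)]
    have h5 : rProd r (partLevel μ l) (μ.rowLen l) =
        ∏ j ∈ range (μ.rowLen l), r ((j : ℤ) - l) := by
      rw [rProd, ← prod_range_reflect]
      refine prod_congr rfl fun j hj => ?_
      rw [mem_range] at hj
      rw [partLevel]
      congr 1
      omega
    rw [prod_range_succ, ← ih, h4, ← h5, mul_comm]
    have h6 : -(l : ℤ) - 1 = partLevel μ l - (μ.rowLen l : ℕ) := by rw [partLevel]; ring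
    have h7 : -(l : ℤ) - 1 ∉ (range l).image (partLevel μ) := by
      rw [mem_image]
      rintro ⟨i, hi, h⟩
      have := neg_le_partLevel μ i
      rw [mem_range] at hi
      omega
    by_cases hk : μ.rowLen l = 0
    · rw [hk, Nat.cast_zero, sub_zero] at h6
      rw [← h6, hk, symmDiff_symmDiff_cancel_right]
      simp [rProd]
    · rw [h6]
      refine prod_levelWeight_move r hk ?_ ?_
      · rw [← h6, rowState, mem_symmDiff]
        simp only [h2, h7, false_and, or_self, false_iff]
        omega
      · rw [rowState, mem_symmDiff, mem_Ico]
        simp only [h1, not_false_eq_true, and_true, false_and, or_false]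
        omega

theorem prod_levelWeight_partitionState (r : ℤ → ℂ) (μ : YoungDiagram) :
    ∏ n ∈ partitionState μ, levelWeight r n = rKP r 0 μ := by
  rw [partitionState, prod_levelWeight_rowState, rKP,
    prod_finset_product μ.cells (range (μ.colLen 0)) fun i => range (μ.rowLen i)]
  · simp only [zero_add]
  · rintro ⟨i, j⟩
    rw [YoungDiagram.mem_cells, mem_range, mem_range, ← YoungDiagram.mem_iff_lt_rowLen,
      ← YoungDiagram.mem_iff_lt_colLen]
    exact ⟨fun h => ⟨μ.up_left_mem le_rfl (Nat.zero_le _) h, h⟩, fun h => h.2⟩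

/-! ### The KP tau function as a sum over partitions -/

/-- Schur functions are, up to a sign which depends only on the partition, matrix elements of the
evolution operator. -/
theorem exists_vacSeries_partitionState (μ : YoungDiagram) : ∃ ε : ℂ, ε * ε = 1 ∧
    ∀ {t : ℕ+ → MvPowerSeries Times ℂ} {χ : Times → ℕ}, IsTimes t χ →
      vacSeries (evolKP χ) (ket (partitionState μ)) = ε • schurS μ t := by
  have ha : Function.Injective fun i : Fin (μ.colLen 0) => partLevel μ i := fun i j h =>
    Fin.ext ((partLevel_strictAnti μ).injective h)
  obtain ⟨ε, hε, h⟩ := exists_vacSeries_psiProd (σ := Times) (μ.colLen 0)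
  obtain ⟨ε', hε', h'⟩ := psiProd_ket (List.nodup_ofFn.2 ha) (Ico (-(μ.colLen 0 : ℤ)) 0)
  have h1 : (List.ofFn fun i : Fin (μ.colLen 0) => partLevel μ i).toFinset =
      (range (μ.colLen 0)).image (partLevel μ) := by
    ext n
    rw [List.mem_toFinset, List.mem_ofFn, mem_image]
    constructor
    · rintro ⟨i, rfl⟩
      exact ⟨i, mem_range.2 i.isLt, rfl⟩
    · rintro ⟨i, hi, rfl⟩
      exact ⟨⟨i, mem_range.1 hi⟩, rfl⟩
  rw [if_neg, h1, ← rowState, ← partitionState] at h'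
  · refine ⟨ε' * ε, by rw [mul_mul_mul_comm, hε, hε', one_mul], fun {t χ} ht => ?_⟩
    have h2 : ket (partitionState μ) = ε' • psiProd (List.ofFn fun i : Fin (μ.colLen 0) =>
        partLevel μ i) (ket (Ico (-(μ.colLen 0 : ℤ)) 0)) := by
      rw [h', smul_smul, hε', one_smul]
    rw [h2, map_smul, h ht, smul_smul, schurS]
    congr 3
    funext i j
    rw [partLevel]
    congr 1
    ring
  · rintro ⟨n, hn, hn'⟩
    rw [List.mem_ofFn] at hn
    obtain ⟨i, rfl⟩ := hn
    have h2 := neg_le_partLevel μ i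
    have h3 := i.isLt
    rw [mem_Ico] at hn'
    omega

theorem termKP_eq (r : ℤ → ℂ) (μ : YoungDiagram) :
    termKP r μ = (∏ n ∈ partitionState μ, levelWeight r n) •
      (vacSeries (evolKP oddIndexT) (ket (partitionState μ)) *
        vacSeries (evolKP oddIndexTStar) (ket (partitionState μ))) := by
  obtain ⟨ε, hε, h⟩ := exists_vacSeries_partitionState μ
  rw [h isTimes_oddT, h isTimes_oddTStar, smul_mul_smul_comm, hε, one_smul,
    prod_levelWeight_partitionState, termKP]

theorem hasSum_termKP (r : ℤ → ℂ) : HasSum (termKP r)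
    (formalExpectation ∅ (evolKP oddIndexT * dualEvolKP r oddIndexTStar)) := by
  have h2 := (partitionState_injective.hasSum_iff fun S hS => ?_).2 (hasSum_evolKP r)
  · exact (funext (termKP_eq r)).symm ▸ h2
  · rw [vacSeries_ket_of_charge_ne_zero _ fun h => hS (exists_partitionState_eq h), zero_mul,
      smul_zero]

theorem termKP_bot (r : ℤ → ℂ) : termKP r ⊥ = 1 := by
  have h : (⊥ : YoungDiagram).colLen 0 = 0 := by
    rw [← YoungDiagram.length_rowLens, rowLens_bot, List.length_nil]
  have h1 : ∀ t : ℕ+ → MvPowerSeries Times ℂ, schurS ⊥ t = 1 := fun t => by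
    have : IsEmpty (Fin ((⊥ : YoungDiagram).colLen 0)) := by rw [h]; infer_instance
    exact Matrix.det_isEmpty
  rw [termKP, h1, h1, rKP, YoungDiagram.cells_bot, prod_empty, one_smul, one_mul]

theorem hasSum_nonzeroPartition (r : ℤ → ℂ) :
    HasSum (fun μ : NonzeroPartition => termKP r μ.1)
      (formalExpectation ∅ (evolKP oddIndexT * dualEvolKP r oddIndexTStar) - 1) := by
  have h := hasSum_subtype_ne (fun _ : YoungDiagram => True) (termKP r) ⊥ trivial
    ((Equiv.subtypeUnivEquiv fun _ => trivial).hasSum_iff.2 (hasSum_termKP r))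
  rw [termKP_bot] at h
  exact (Equiv.subtypeEquivRight fun μ : YoungDiagram =>
    show μ ≠ ⊥ ↔ μ ≠ ⊥ ∧ True from ⟨fun h => ⟨h, trivial⟩, fun h => h.1⟩).hasSum_iff.2 h

/-! ### The universal property of the neutral Fock space -/

section Universal

variable {V : Type} [AddCommGroup V] [Module ℂ V]

theorem phi_ket_mem_span {N : ℕ} {n : ℤ} (hn : n < N) {S : Finset ℕ} (hS : ∀ j ∈ S, j < N) :
    phi n (ket S) ∈ Submodule.span ℂ (ket '' {S : Finset ℕ | ∀ j ∈ S, j < N}) := by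
  rw [phi_eq, LinearMap.add_apply, LinearMap.smul_apply, LinearMap.smul_apply, create_ket,
    annihilate_ket]
  refine add_mem ?_ (Submodule.smul_mem _ _ ?_)
  · split_ifs with h1 h2
    · simp
    · refine Submodule.smul_mem _ _ (Submodule.smul_mem _ _ (Submodule.subset_span ⟨_, ?_, rfl⟩))
      intro j hj
      rcases mem_insert.1 hj with rfl | hj
      · omega
      · exact hS j hj
    · simp
    · simp
  · split_ifs with h1
    · exact Submodule.smul_mem _ _ (Submodule.subset_span
        ⟨_, fun j hj => hS j (mem_of_mem_erase hj), rfl⟩)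
    · exact zero_mem _

/-- The Fock space of the neutral fermions maps to every representation of their algebra with a
vector which is killed by the operators of negative index. -/
theorem exists_intertwiner (Φ : ℤ → Module.End ℂ V)
    (hΦ : ∀ m n v, Φ m (Φ n v) + Φ n (Φ m v) = if m + n = 0 then ((-1 : ℂ) ^ m) • v else 0)
    (v₀ : V) (h₀ : ∀ n < 0, Φ n v₀ = 0) :
    ∃ T : Fock ℕ →ₗ[ℂ] V, T (ket ∅) = v₀ ∧ ∀ n x, T (phi n x) = Φ n (T x) := by
  let T : Fock ℕ →ₗ[ℂ] V := Finsupp.linearCombination ℂ fun S : Finset ℕ =>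
    ((S.sort (· ≥ ·)).map fun i : ℕ => Φ i).prod v₀
  have hT : ∀ S : Finset ℕ, T (ket S) = ((S.sort (· ≥ ·)).map fun i : ℕ => Φ i).prod v₀ :=
    fun S => by simp [T, ket]
  have hT0 : T (ket ∅) = v₀ := by rw [hT]; simp
  have hTi : ∀ (i : ℕ) S, (∀ j ∈ S, j < i) → T (phi i (ket S)) = Φ i (T (ket S)) := by
    intro i S h
    rw [phi_ket_of_forall_lt i S h, hT, hT, sort_insert _ (fun j hj => (h j hj).le)
      fun hi => (h i hi).false, List.map_cons, List.prod_cons]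
    rfl
  have hTspan : ∀ (N : ℕ), ∀ v ∈ Submodule.span ℂ (ket '' {S : Finset ℕ | ∀ j ∈ S, j < N}),
      T (phi N v) = Φ N (T v) := by
    intro N v hv
    induction hv using Submodule.span_induction with
    | mem x h => obtain ⟨S, hS, rfl⟩ := h; exact hTi N S hS
    | zero => simp
    | add x y _ _ hx hy => simp only [map_add, hx, hy]
    | smul a x _ hx => simp only [map_smul, hx]
  have key : ∀ (N : ℕ) (n : ℤ), n < N → ∀ S : Finset ℕ, (∀ j ∈ S, j < N) →
      T (phi n (ket S)) = Φ n (T (ket S)) := by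
    intro N
    induction N with
    | zero =>
      intro n hn S hS
      obtain rfl : S = ∅ := eq_empty_of_forall_notMem fun j hj => by simpa using hS j hj
      rw [phi_vacuum (by simpa using hn), map_zero, hT0, h₀ n (by simpa using hn)]
    | succ N ih =>
      intro n hn S hS
      by_cases hN : N ∈ S
      · -- Move `φ_n` past `φ_N`, the leftmost factor of `ket S`.
        have hS' : ∀ j ∈ S.erase N, j < N := fun j hj => by
          have h1 := hS j (mem_of_mem_erase hj)
          have h2 := ne_of_mem_erase hj
          omega
        have hket : ket S = phi N (ket (S.erase N)) := by
          rw [phi_ket_of_forall_lt _ _ hS', insert_erase hN]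
        have h1 := congrArg T (phi_phi_add n N (ket (S.erase N)))
        have h2 := hΦ n N (T (ket (S.erase N)))
        have h3 : T (if n + (N : ℤ) = 0 then ((-1 : ℂ) ^ n) • ket (S.erase N) else 0) =
            if n + (N : ℤ) = 0 then ((-1 : ℂ) ^ n) • T (ket (S.erase N)) else 0 := by
          split_ifs <;> simp
        rw [h3, ← h2, map_add] at h1
        rw [hket, hTi N _ hS']
        rcases lt_or_eq_of_le (show n ≤ N by push_cast at hn; omega) with hn' | rfl
        · rw [hTspan N _ (phi_ket_mem_span hn' hS'), ih n hn' _ hS'] at h1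
          exact add_right_cancel h1
        · rw [← two_smul ℂ, ← two_smul ℂ] at h1
          exact smul_right_injective V (two_ne_zero' ℂ) h1
      · have hS' : ∀ j ∈ S, j < N := fun j hj => by
          have h1 := hS j hj
          have h2 : j ≠ N := fun h => hN (h ▸ hj)
          omega
        rcases lt_or_eq_of_le (show n ≤ N by push_cast at hn; omega) with hn' | rfl
        · exact ih n hn' S hS'
        · exact hTi N S hS'
  refine ⟨T, hT0, fun n x => ?_⟩
  suffices h : T ∘ₗ phi n = Φ n ∘ₗ T from LinearMap.congr_fun h x
  refine ket_ext fun S => ?_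
  refine key (max (S.sup id + 1) (n.toNat + 1)) n ?_ S fun j hj => ?_
  · push_cast
    omega
  · have := le_sup (f := id) hj
    simp only [id] at this
    omega

/-- Linear maps which agree on the vacuum, and are compatible with the neutral fermions, agree. -/
theorem eq_zero_of_phi {Δ : Fock ℕ →ₗ[ℂ] V} (Φ : ℕ → Module.End ℂ V) (h0 : Δ (ket ∅) = 0)
    (h : ∀ (i : ℕ) x, Δ (phi i x) = Φ i (Δ x)) : Δ = 0 := by
  refine ket_ext fun S => ?_
  induction S using Finset.induction_on_max with
  | empty => exact h0
  | insert i S hi ih =>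
    rw [← phi_ket_of_forall_lt i S hi, h, ih]
    simp

end Universal

/-! ### Two neutral fermions in a charged fermion -/

/-- A square root of `1/2`. -/
def sqrtHalf : ℂ := (Real.sqrt 2 : ℂ)⁻¹

theorem sqrtHalf_mul_self : sqrtHalf * sqrtHalf = 2⁻¹ := by
  rw [sqrtHalf, ← mul_inv, ← Complex.ofReal_mul, Real.mul_self_sqrt (by norm_num)]
  norm_num

/-- The combinations `c ψ_n + d (-1)^n ψ*_{-n}` of charged fermions. -/
def psiMix (c d : ℂ) (n : ℤ) : Module.End ℂ (Fock ℤ) :=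
  c • psi n + (d * (-1) ^ n) • psiStar (-n)

/-- The neutral fermions `2^{-1/2} (ψ_n + (-1)^n ψ*_{-n})`. -/
abbrev phiOne : ℤ → Module.End ℂ (Fock ℤ) := psiMix sqrtHalf sqrtHalf

/-- The neutral fermions `2^{-1/2} i (ψ_n - (-1)^n ψ*_{-n})`. -/
abbrev phiTwo : ℤ → Module.End ℂ (Fock ℤ) := psiMix (Complex.I * sqrtHalf) (-Complex.I * sqrtHalf)

theorem psiMix_apply (c d : ℂ) (n : ℤ) (v : Fock ℤ) :
    psiMix c d n v = c • psi n v + (d * (-1) ^ n) • psiStar (-n) v := rfl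

theorem psiMix_psiMix_add (c d c' d' : ℂ) (m n : ℤ) (v : Fock ℤ) :
    psiMix c d m (psiMix c' d' n v) + psiMix c' d' n (psiMix c d m v) =
      if m + n = 0 then ((c * d' + d * c') * (-1) ^ m) • v else 0 := by
  have h : psiMix c d m * psiMix c' d' n + psiMix c' d' n * psiMix c d m =
      if m + n = 0 then ((c * d' + d * c') * (-1) ^ m) • 1 else 0 := by
    rw [psiMix, psiMix, anticommutator_smul_add, psi_mul_psi, psiStar_mul_psiStar,
      psi_mul_psiStar, add_comm (psiStar (-m) * psi n), psi_mul_psiStar, smul_zero, smul_zero,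
      zero_add, add_zero]
    by_cases hmn : m + n = 0
    · obtain rfl : n = -m := by omega
      rw [if_pos (by ring), if_pos rfl, if_pos hmn, neg_one_zpow_neg, ← add_smul]
      congr 1
      ring
    · rw [if_neg (by omega), if_neg (by omega), if_neg hmn, smul_zero, smul_zero, add_zero]
  have h1 := LinearMap.congr_fun h v
  split_ifs at h1 ⊢ <;> exact h1

theorem phiOne_phiOne_add (m n : ℤ) (v : Fock ℤ) : phiOne m (phiOne n v) + phiOne n (phiOne m v) =
    if m + n = 0 then ((-1 : ℂ) ^ m) • v else 0 := by
  have h : sqrtHalf * sqrtHalf + sqrtHalf * sqrtHalf = 1 := by rw [sqrtHalf_mul_self]; norm_num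
  rw [psiMix_psiMix_add, h, one_mul]

theorem phiTwo_phiTwo_add (m n : ℤ) (v : Fock ℤ) : phiTwo m (phiTwo n v) + phiTwo n (phiTwo m v) =
    if m + n = 0 then ((-1 : ℂ) ^ m) • v else 0 := by
  have h : Complex.I * sqrtHalf * (-Complex.I * sqrtHalf) +
      -Complex.I * sqrtHalf * (Complex.I * sqrtHalf) = 1 := by
    linear_combination -2 * sqrtHalf * sqrtHalf * Complex.I_mul_I + 2 * sqrtHalf_mul_self
  rw [psiMix_psiMix_add, h, one_mul]

theorem phiOne_phiTwo (m n : ℤ) (v : Fock ℤ) : phiOne m (phiTwo n v) = -phiTwo n (phiOne m v) := by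
  rw [eq_neg_iff_add_eq_zero, psiMix_psiMix_add]
  have h : sqrtHalf * (-Complex.I * sqrtHalf) + sqrtHalf * (Complex.I * sqrtHalf) = 0 := by ring
  rw [h, zero_mul, zero_smul, ite_self]

theorem psiMix_vacuum (c d : ℂ) {n : ℤ} (hn : n < 0) : psiMix c d n (ket ∅) = 0 := by
  rw [psiMix_apply, psi_vacuum hn, psiStar_vacuum (by omega), smul_zero, smul_zero, add_zero]

theorem psiMix_apply_empty (c d : ℂ) {n : ℤ} (hn : 0 < n) (v : Fock ℤ) : psiMix c d n v ∅ = 0 := by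
  rw [psiMix_apply, Finsupp.add_apply, Finsupp.smul_apply, Finsupp.smul_apply,
    psi_apply_empty hn.le, psiStar_apply_empty (by omega), smul_zero, smul_zero, add_zero]

theorem hamKP_psiMix {k : ℕ} (hk : Odd k) (c d : ℂ) (m : ℤ) (v : Fock ℤ) :
    hamKP k (psiMix c d m v) = psiMix c d m (hamKP k v) + psiMix c d (m - k) v := by
  have hk0 := hk.pos.ne'
  rw [psiMix_apply, psiMix_apply, psiMix_apply, map_add, map_smul, map_smul, hamKP_psi hk0,
    hamKP_psiStar hk0, neg_one_zpow_sub, neg_one_zpow_odd hk, show -(m - (k : ℤ)) = -m + k by ring]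
  module

theorem opA_psiMix {r : ℤ → ℂ} (hr : ∀ n, r n = r (1 - n)) {k : ℕ} (hk : Odd k) (c d : ℂ) (m : ℤ)
    (v : Fock ℤ) : opA r k (psiMix c d m v) =
      psiMix c d m (opA r k v) + (-rProd r (m + k) k) • psiMix c d (m + k) v := by
  have hk0 := hk.pos.ne'
  rw [psiMix_apply, psiMix_apply, psiMix_apply, map_add, map_smul, map_smul, opA_psi r hk0,
    opA_psiStar r hk0, neg_one_zpow_add, neg_one_zpow_odd hk, rProd_neg hr, neg_add,
    ← sub_eq_add_neg (-m)]
  module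

theorem parity_vacuum {ι : Type} : parity (ket (∅ : Finset ι)) = ket ∅ := by
  rw [parity, diagOp_ket, card_empty, pow_zero, one_smul]

/-- There is a bilinear map from pairs of neutral Fock spaces to the charged Fock space for which
the two families of neutral fermions in the charged fermions act on the two factors. -/
theorem exists_doubling : ∃ M : Fock ℕ →ₗ[ℂ] Fock ℕ →ₗ[ℂ] Fock ℤ, M (ket ∅) (ket ∅) = ket ∅ ∧
    (∀ n x y, M (phi n x) y = phiTwo n (M x y)) ∧
      ∀ n x y, M x (phi n y) = phiOne n (M (parity x) y) := by
  obtain ⟨T, hT0, hT⟩ := exists_intertwiner phiOne phiOne_phiOne_add (ket ∅)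
    fun n hn => psiMix_vacuum _ _ hn
  have h0 : ∀ n < 0, phiTwo n ∘ₗ T = 0 := fun n hn => by
    refine eq_zero_of_phi (fun i => -phiOne i) ?_ fun i x => ?_
    · rw [LinearMap.comp_apply, hT0, psiMix_vacuum _ _ hn]
    · rw [LinearMap.comp_apply, LinearMap.comp_apply, LinearMap.neg_apply, phiOne_phiTwo, neg_neg,
        hT]
  obtain ⟨M, hM0, hM⟩ := exists_intertwiner
    (fun n => (LinearMap.compRight ℂ (phiTwo n) : Module.End ℂ (Fock ℕ →ₗ[ℂ] Fock ℤ)))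
    (fun m n v => by
      refine LinearMap.ext fun y => ?_
      refine (phiTwo_phiTwo_add m n (v y)).trans ?_
      split_ifs <;> rfl) T h0
  have hM' : ∀ n x y, M (phi n x) y = phiTwo n (M x y) := fun n x y =>
    LinearMap.congr_fun (hM n x) y
  refine ⟨M, by rw [hM0, hT0], hM', fun n x y => ?_⟩
  suffices h : M.flip (phi n y) - phiOne n ∘ₗ M.flip y ∘ₗ parity = 0 from
    sub_eq_zero.1 (LinearMap.congr_fun h x)
  refine eq_zero_of_phi (fun i => phiTwo i) ?_ fun i x => ?_
  · simp only [LinearMap.sub_apply, LinearMap.comp_apply, LinearMap.flip_apply, parity_vacuum, hM0,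
      hT, sub_self]
  · simp only [LinearMap.sub_apply, LinearMap.comp_apply, LinearMap.flip_apply, parity_phi, hM',
      map_neg, phiOne_phiTwo, map_sub, neg_neg]

/-- The map of `exists_doubling`. -/
def doubling : Fock ℕ →ₗ[ℂ] Fock ℕ →ₗ[ℂ] Fock ℤ := exists_doubling.choose

theorem doubling_vacuum : doubling (ket ∅) (ket ∅) = ket ∅ := exists_doubling.choose_spec.1

theorem doubling_phi_left (n : ℤ) (x y : Fock ℕ) :
    doubling (phi n x) y = phiTwo n (doubling x y) := exists_doubling.choose_spec.2.1 n x y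

theorem doubling_phi_right (n : ℤ) (x y : Fock ℕ) :
    doubling x (phi n y) = phiOne n (doubling (parity x) y) := exists_doubling.choose_spec.2.2 n x y

/-- An operator which acts in the same way on the charged fermions as `B` acts on the neutral
fermions corresponds to the action of `B` on both factors, if it does so on the vacuum. -/
theorem doubling_derivation (D : Module.End ℂ (Fock ℤ)) (B : Module.End ℂ (Fock ℕ)) (α : ℤ → ℂ)
    (k : ℤ)
    (hD : ∀ c d m v, D (psiMix c d m v) = psiMix c d m (D v) + α m • psiMix c d (m + k) v)
    (hB : ∀ m v, B (phi m v) = phi m (B v) + α m • phi (m + k) v)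
    (hP : ∀ v, parity (B v) = B (parity v))
    (h0 : D (ket ∅) = doubling (B (ket ∅)) (ket ∅) + doubling (ket ∅) (B (ket ∅)))
    (x y : Fock ℕ) : D (doubling x y) = doubling (B x) y + doubling x (B y) := by
  have h1 : ∀ y, D (doubling (ket ∅) y) =
      doubling (B (ket ∅)) y + doubling (ket ∅) (B y) := fun y => by
    suffices h : D ∘ₗ doubling (ket ∅) - (doubling (B (ket ∅)) + doubling (ket ∅) ∘ₗ B) = 0 from
      sub_eq_zero.1 (LinearMap.congr_fun h y)
    refine eq_zero_of_phi (fun i => phiOne i) ?_ fun i x => ?_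
    · change D (doubling (ket ∅) (ket ∅)) - (doubling (B (ket ∅)) (ket ∅) +
        doubling (ket ∅) (B (ket ∅))) = 0
      rw [doubling_vacuum, h0, sub_self]
    simp only [LinearMap.sub_apply, LinearMap.add_apply, LinearMap.comp_apply, hB, map_add,
      map_smul, doubling_phi_right, hP, parity_vacuum, hD, map_sub]
    abel
  suffices h : D ∘ₗ doubling.flip y - (doubling.flip y ∘ₗ B + doubling.flip (B y)) = 0 from
    sub_eq_zero.1 (LinearMap.congr_fun h x)
  refine eq_zero_of_phi (fun i => phiTwo i) ?_ fun i x => ?_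
  · rw [LinearMap.sub_apply]
    exact sub_eq_zero.2 (h1 y)
  simp only [LinearMap.sub_apply, LinearMap.add_apply, LinearMap.comp_apply, LinearMap.flip_apply,
    hB, map_add, map_smul, doubling_phi_left, hD, map_sub]
  abel

theorem hamKP_doubling {k : ℕ} (hk : Odd k) (x y : Fock ℕ) :
    hamKP k (doubling x y) = doubling (hamB k x) y + doubling x (hamB k y) := by
  refine doubling_derivation _ _ (fun _ => 1) (-k) (fun c d m v => ?_) (fun m v => ?_)
    (parity_hamB hk) ?_ x y
  · rw [hamKP_psiMix hk, one_smul, sub_eq_add_neg]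
  · rw [hamB_phi hk, one_smul, sub_eq_add_neg]
  · rw [hamKP_vacuum hk.pos.ne', hamB_vacuum hk, map_zero, map_zero, LinearMap.zero_apply, add_zero]

/-- The terms which are bilinear in `ψ` alone, or in `ψ*` alone, cancel in the sum over the two
neutral fermions. -/
theorem phiOne_add_phiTwo (m n : ℤ) (v : Fock ℤ) :
    phiOne m (phiOne n v) + phiTwo m (phiTwo n v) =
      ((-1 : ℂ) ^ n) • psi m (psiStar (-n) v) + ((-1 : ℂ) ^ m) • psiStar (-m) (psi n v) := by
  simp only [psiMix_apply, map_add, map_smul, smul_add, smul_smul]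
  have h1 : Complex.I * sqrtHalf * (Complex.I * sqrtHalf) = -(sqrtHalf * sqrtHalf) := by
    linear_combination sqrtHalf * sqrtHalf * Complex.I_mul_I
  have h2 := sqrtHalf_mul_self
  match_scalars
  · linear_combination h1
  · linear_combination (-1 : ℂ) ^ m * (2 * h2 - h1)
  · linear_combination (-1 : ℂ) ^ n * (2 * h2 - h1)
  · linear_combination (-1 : ℂ) ^ m * (-1 : ℂ) ^ n * h1

/-- On the vacuum, `A_k` is the sum of the two copies of `B_k`. -/
theorem opA_vacuum {r : ℤ → ℂ} (hr : ∀ n, r n = r (1 - n)) {k : ℕ} (hk : Odd k) :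
    opA r k (ket ∅) = doubling (opB r k (ket ∅)) (ket ∅) + doubling (ket ∅) (opB r k (ket ∅)) := by
  have hk0 : (k : ℤ) ≠ 0 := by exact_mod_cast hk.pos.ne'
  set c : ℤ → ℂ := fun n => (-1) ^ n * rProd r n k with hc
  set f : ℤ → Fock ℤ := fun n => psiBilinear (fun n => -rProd r n k) (-k) n (ket ∅) with hf
  have hB := locallyFinite_phiBilinear c hk0
  have h1 : ∀ L : Fock ℕ →ₗ[ℂ] Fock ℤ,
      L (opB r k (ket ∅)) = (2⁻¹ : ℂ) • ∑ᶠ n, L (phiBilinear c k n (ket ∅)) := fun L => by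
    rw [opB_eq, LinearMap.smul_apply, map_smul, hB.map_sumOp_apply]
  have h2 : ∀ L : Fock ℕ →ₗ[ℂ] Fock ℤ,
      (Function.support fun n => L (phiBilinear c k n (ket ∅))).Finite := fun L =>
    (hB.finite_support (ket ∅)).subset fun n hn h => hn (by
      change L (phiBilinear c k n (ket ∅)) = 0
      rw [show phiBilinear c k n (ket ∅) = 0 from h, map_zero])
  have h3 : (Function.support f).Finite :=
    (locallyFinite_psiBilinear _ (neg_ne_zero.2 hk0)).finite_support (ket ∅)
  have h4 : ∀ n, doubling.flip (ket ∅) (phiBilinear c k n (ket ∅)) +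
      doubling (ket ∅) (phiBilinear c k n (ket ∅)) =
        f n + f (Equiv.subLeft (k : ℤ) n) := fun n => by
    rw [Equiv.subLeft_apply]
    have h5 := rProd_neg hr (n - k) k
    rw [neg_sub, sub_add_cancel] at h5
    change doubling (c n • phi n (phi (k - n) (ket ∅))) (ket ∅) +
      doubling (ket ∅) (c n • phi n (phi (k - n) (ket ∅))) = _
    rw [map_smul, map_smul, LinearMap.smul_apply, doubling_phi_left, doubling_phi_left,
      doubling_phi_right, parity_vacuum, doubling_phi_right, parity_vacuum, doubling_vacuum,
      ← smul_add, add_comm (phiTwo n _), phiOne_add_phiTwo, hf]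
    simp only [psiBilinear_apply]
    rw [h5, psi_psiStar_of_ne (m := (k : ℤ) - n) (by omega), show (k : ℤ) - n + -k = -n by ring,
      show -((k : ℤ) - n) = n + -k by ring, neg_one_zpow_sub, neg_one_zpow_odd hk, hc]
    have h6 := neg_one_zpow_mul_self n
    simp only [smul_add, smul_smul, smul_neg, neg_smul]
    match_scalars
    · linear_combination -rProd r n k * h6
    · linear_combination rProd r n k * h6
  have h5 := h1 (doubling.flip (ket ∅))
  rw [LinearMap.flip_apply] at h5
  rw [h5, h1, ← smul_add, ← finsum_add_distrib (h2 _) (h2 _), finsum_congr h4,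
    finsum_add_distrib h3 (h3.preimage (Equiv.subLeft (k : ℤ)).injective.injOn),
    finsum_comp_equiv (Equiv.subLeft (k : ℤ)) (f := f), ← two_smul ℂ, smul_smul,
    inv_mul_cancel₀ (by norm_num), one_smul, opA_eq r hk.pos.ne',
    (locallyFinite_psiBilinear _ (neg_ne_zero.2 hk0)).sumOp_apply]

theorem opA_doubling {r : ℤ → ℂ} (hr : ∀ n, r n = r (1 - n)) {k : ℕ} (hk : Odd k) (x y : Fock ℕ) :
    opA r k (doubling x y) = doubling (opB r k x) y + doubling x (opB r k y) :=
  doubling_derivation _ _ (fun m => -rProd r (m + k) k) k (opA_psiMix hr hk) (opB_phi hr hk)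
    (parity_opB r hk) (opA_vacuum hr hk) x y

/-- A functional which vanishes on the images of the `φ_i`, `i > 0`, only depends on the vacuum
component of an even vector: among the states, only `|0⟩` and `φ_0 |0⟩` are not such images, and
the latter is odd. -/
theorem apply_eq_of_parity {W : Type} [AddCommGroup W] [Module ℂ W] (L : Fock ℕ →ₗ[ℂ] W)
    (hL : ∀ (i : ℕ) x, 0 < i → L (phi i x) = 0) {u : Fock ℕ} (hu : parity u = u) :
    L u = u ∅ • L (ket ∅) := by
  conv_lhs => rw [eq_sum_ket u]
  rw [map_sum, sum_eq_single ∅, map_smul]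
  · intro S _ hS
    rw [map_smul]
    by_cases hpar : Even S.card
    · have hi := S.max'_mem (nonempty_iff_ne_empty.2 hS)
      set i := S.max' (nonempty_iff_ne_empty.2 hS)
      have hi0 : 0 < i := by
        rw [Nat.pos_iff_ne_zero]
        intro h0
        have h1 : S = {0} := eq_singleton_iff_unique_mem.2 ⟨h0 ▸ hi, fun j hj => by
          have := S.le_max' j hj
          omega⟩
        rw [h1, card_singleton] at hpar
        exact Nat.not_even_one hpar
      have h2 : ket S = phi i (ket (S.erase i)) := by
        rw [phi_ket_of_forall_lt, insert_erase hi]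
        intro j hj
        exact lt_of_le_of_ne (S.le_max' j (mem_of_mem_erase hj)) (ne_of_mem_erase hj)
      rw [h2, hL i _ hi0, smul_zero]
    · have h1 := congrArg (fun v : Fock ℕ => v S) hu
      simp only [parity, diagOp_apply, (Nat.not_even_iff_odd.1 hpar).neg_one_pow] at h1
      have h2 : u S = 0 := by linear_combination -h1 / 2
      rw [h2, zero_smul]
  · intro h
    rw [Finsupp.notMem_support_iff.1 h, zero_smul, map_zero]

theorem doubling_apply_empty {u v : Fock ℕ} (hu : parity u = u) (hv : parity v = v) :
    doubling u v ∅ = u ∅ * v ∅ := by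
  have h1 := apply_eq_of_parity (Finsupp.lapply ∅ ∘ₗ doubling.flip v) (fun i x hi => by
    rw [LinearMap.comp_apply, LinearMap.flip_apply, doubling_phi_left]
    exact psiMix_apply_empty _ _ (by exact_mod_cast hi) _) hu
  have h2 := apply_eq_of_parity (Finsupp.lapply ∅ ∘ₗ doubling (ket ∅)) (fun i x hi => by
    rw [LinearMap.comp_apply, doubling_phi_right]
    exact psiMix_apply_empty _ _ (by exact_mod_cast hi) _) hv
  simp only [LinearMap.comp_apply, LinearMap.flip_apply, Finsupp.lapply_apply, smul_eq_mul,
    doubling_vacuum, ket_apply_self, mul_one] at h1 h2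
  rw [h1, h2]

/-! ### The KP tau function as the square of the BKP tau function -/

section Algebras

variable {σ R R' : Type} [Ring R] [Algebra ℂ R] [Ring R'] [Algebra ℂ R']

theorem map_formalExp (f : R →ₐ[ℂ] R') (X : MvPowerSeries σ R) :
    MvPowerSeries.map (f : R →+* R') (formalExp X) =
      formalExp (MvPowerSeries.map (f : R →+* R') X) := by
  ext m
  rw [coeff_map, coeff_formalExp_eq_sum, coeff_formalExp_eq_sum, map_sum]
  refine sum_congr rfl fun k _ => ?_
  rw [← map_pow, coeff_map]
  exact map_smul f _ _

theorem map_linForm (f : R →ₐ[ℂ] R') (c : σ → R) :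
    MvPowerSeries.map (f : R →+* R') (linForm c) = linForm fun s => f (c s) := by
  ext m
  rw [coeff_map]
  by_cases h : ∃ s, m = Finsupp.single s 1
  · obtain ⟨s, rfl⟩ := h
    rw [coeff_linForm_single, coeff_linForm_single]
    rfl
  · rw [coeff_linForm_eq_zero _ _ (not_exists.1 h), coeff_linForm_eq_zero _ _ (not_exists.1 h),
      map_zero]

end Algebras

theorem commute_neg_neg {V : Type} [AddCommGroup V] [Module ℂ V] {A B : Module.End ℂ V}
    (h : Commute A B) : Commute (-A) (-B) := by
  refine LinearMap.ext fun v => ?_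
  change -A (-B v) = -B (-A v)
  rw [map_neg, map_neg]
  exact congrArg (fun w => - -w) (LinearMap.congr_fun h.eq v)

theorem commute_of_coeff {σ R : Type} [Ring R] {X Y : MvPowerSeries σ R}
    (h : ∀ p q, Commute (coeff p X) (coeff q Y)) : Commute X Y := by
  classical
  refine MvPowerSeries.ext fun m => ?_
  rw [coeff_mul, coeff_mul]
  exact (sum_congr rfl fun p _ => (h p.1 p.2).eq).trans
    (Finsupp.sum_antidiagonal_swap m fun a b => coeff b Y * coeff a X)

section Doubling

open TensorProduct

variable {σ V U : Type} [AddCommGroup V] [Module ℂ V] [AddCommGroup U] [Module ℂ U]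

/-- If operators on `U` act by the Leibniz rule on the image of a bilinear map, then products of
exponentials of such operators act on both arguments. -/
theorem coeff_mul_formalExp_bilinear (T : V →ₗ[ℂ] V →ₗ[ℂ] U) {a b : σ → Module.End ℂ V}
    {a' b' : σ → Module.End ℂ U} (ha : ∀ s s', Commute (a s) (a s'))
    (hb : ∀ s s', Commute (b s) (b s'))
    (ha' : ∀ s x y, a' s (T x y) = T (a s x) y + T x (a s y))
    (hb' : ∀ s x y, b' s (T x y) = T (b s x) y + T x (b s y)) [DecidableEq σ] (m : σ →₀ ℕ)
    (x y : V) :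
    coeff m (formalExp (linForm a') * formalExp (linForm b')) (T x y) =
      ∑ p ∈ antidiagonal m,
        T (coeff p.1 (formalExp (linForm a) * formalExp (linForm b)) x)
          (coeff p.2 (formalExp (linForm a) * formalExp (linForm b)) y) := by
  let ρ : Module.End ℂ V →ₐ[ℂ] Module.End ℂ (V ⊗[ℂ] V) := Module.End.rTensorAlgHom ℂ V V
  let κ : Module.End ℂ V →ₐ[ℂ] Module.End ℂ (V ⊗[ℂ] V) := Module.End.lTensorAlgHom ℂ V V
  have hρκ : ∀ A B, Commute (ρ A) (κ B) := fun A B => TensorProduct.ext' fun x y => rfl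
  have hexp : ∀ c : σ → Module.End ℂ V, (∀ s s', Commute (c s) (c s')) →
      formalExp (linForm fun s => ρ (c s) + κ (c s)) =
        MvPowerSeries.map (ρ : Module.End ℂ V →+* Module.End ℂ (V ⊗[ℂ] V))
            (formalExp (linForm c)) *
          MvPowerSeries.map (κ : Module.End ℂ V →+* Module.End ℂ (V ⊗[ℂ] V))
            (formalExp (linForm c)) := by
    intro c hc
    rw [map_formalExp, map_formalExp, map_linForm, map_linForm, formalExp_linForm_add]
    · exact fun s s' => (hc s s').map ρ
    · exact fun s s' => (hc s s').map κ
    · exact fun s s' => hρκ _ _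
  have hT : ∀ {c : σ → Module.End ℂ V} {c' : σ → Module.End ℂ U},
      (∀ s x y, c' s (T x y) = T (c s x) y + T x (c s y)) →
      Intertwines (TensorProduct.lift T) (formalExp (linForm fun s => ρ (c s) + κ (c s)))
        (formalExp (linForm c')) := by
    intro c c' h
    refine (Intertwines.linForm fun s v => ?_).formalExp
    suffices h' : TensorProduct.lift T ∘ₗ (ρ (c s) + κ (c s)) = c' s ∘ₗ TensorProduct.lift T from
      LinearMap.congr_fun h' v
    refine TensorProduct.ext' fun x y => ?_
    change TensorProduct.lift T (c s x ⊗ₜ y + x ⊗ₜ c s y) = c' s (T x y)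
    rw [map_add, TensorProduct.lift.tmul, TensorProduct.lift.tmul, h]
  have h1 := ((hT ha').mul (hT hb')) m (x ⊗ₜ y)
  rw [TensorProduct.lift.tmul] at h1
  have hcomm : Commute
      (MvPowerSeries.map (κ : Module.End ℂ V →+* Module.End ℂ (V ⊗[ℂ] V)) (formalExp (linForm a)))
      (MvPowerSeries.map (ρ : Module.End ℂ V →+* Module.End ℂ (V ⊗[ℂ] V))
        (formalExp (linForm b))) := by
    refine commute_of_coeff fun p q => ?_
    rw [coeff_map, coeff_map]
    exact (hρκ _ _).symm
  rw [← h1, hexp a ha, hexp b hb, hcomm.mul_mul_mul_comm, ← map_mul, ← map_mul, coeff_mul,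
    LinearMap.sum_apply, map_sum]
  rfl

end Doubling

theorem parity_coeff_evolB_mul (r : ℤ → ℂ) (m : Times →₀ ℕ) :
    parity (coeff m (evolB oddIndexT * dualEvolB r oddIndexTStar) (ket ∅)) =
      coeff m (evolB oddIndexT * dualEvolB r oddIndexTStar) (ket ∅) := by
  rw [((intertwines_parity_evolB oddIndexT_odd).mul
    (intertwines_parity_dualEvolB r oddIndexTStar_odd)) m (ket ∅), parity_vacuum]

/-- For odd times, the vacuum expectation of the charged fermions is the square of that of the
neutral fermions. -/
theorem formalExpectation_evolKP {r : ℤ → ℂ} (hr : ∀ n, r n = r (1 - n)) :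
    formalExpectation ∅ (evolKP oddIndexT * dualEvolKP r oddIndexTStar) = tauBKP r ^ 2 := by
  classical
  ext m
  rw [tauBKP_eq, sq, coeff_mul]
  change coeff m (evolKP oddIndexT * dualEvolKP r oddIndexTStar) (ket ∅) ∅ = _
  rw [← doubling_vacuum, evolKP, dualEvolKP,
    coeff_mul_formalExp_bilinear doubling (a := flow oddIndexT fun k => hamB k)
      (b := flow oddIndexTStar fun k => -opB r k)]
  · rw [Finsupp.finsetSum_apply]
    refine sum_congr rfl fun p _ => ?_
    exact doubling_apply_empty (parity_coeff_evolB_mul r p.1) (parity_coeff_evolB_mul r p.2)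
  · exact commute_flow fun s s' h h' => commute_hamB (oddIndexT_odd s h) (oddIndexT_odd s' h')
  · exact commute_flow fun s s' h h' =>
      commute_neg_neg (commute_opB hr (oddIndexTStar_odd s h) (oddIndexTStar_odd s' h'))
  · intro s x y
    rw [flow, flow]
    split_ifs with h
    · simp
    · exact hamKP_doubling (oddIndexT_odd s h) x y
  · intro s x y
    rw [flow, flow]
    split_ifs with h
    · simp
    · rw [LinearMap.neg_apply, LinearMap.neg_apply, LinearMap.neg_apply,
        opA_doubling hr (oddIndexTStar_odd s h), map_neg, map_neg, LinearMap.neg_apply, neg_add]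

theorem restrictOdd_tauKP (r : ℤ → ℂ) : restrictOdd (tauKP r 0) =
    formalExpectation ∅ (evolKP oddIndexT * dualEvolKP r oddIndexTStar) := by
  classical
  set P : Times → Prop := fun s => Odd (Sum.elim PNat.val PNat.val s) with hP
  have h0 : chargedVacuum 0 = ∅ := by simp [chargedVacuum]
  have h1 : ∀ X : MvPowerSeries Times (Module.End ℂ (Fock ℤ)),
      restrictOdd (formalExpectation ∅ X) = formalExpectation ∅ (restrictVars P X) := by
    intro X
    ext m
    change (if _ then coeff m X (ket ∅) ∅ else 0) = coeff m (restrictVars P X) (ket ∅) ∅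
    by_cases h : ∀ s ∈ m.support, P s
    · exact (if_pos h).trans (congrArg (fun A : Module.End ℂ (Fock ℤ) => A (ket ∅) ∅)
        ((coeff_restrictVars P X m).trans (if_pos h))).symm
    · exact (if_neg h).trans (congrArg (fun A : Module.End ℂ (Fock ℤ) => A (ket ∅) ∅)
        ((coeff_restrictVars P X m).trans (if_neg h))).symm
  rw [tauKP, h0, h1, restrictVars_mul, restrictVars_formalExp, restrictVars_formalExp, evolKP,
    dualEvolKP, flowT, flowTStar, linForm_neg, restrictVars_linForm, restrictVars_linForm]
  congr 4
  · funext s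
    rcases s with m | m
    · by_cases hm : Odd (m : ℕ) <;> simp [hP, flow, oddIndexT, hm]
    · simp [flow, oddIndexT]
  · funext s
    rcases s with m | m
    · simp [flow, oddIndexTStar]
    · by_cases hm : Odd (m : ℕ) <;> simp [hP, flow, oddIndexTStar, hm]

end HypTau

end

theorem proposition2 (r : ℤ → ℂ) (hr : ∀ n : ℤ, r n = r (1 - n)) :
    restrictOdd (tauKP r 0) = tauBKP r ^ 2 ∧
    Summable (fun μ : NonzeroStrict => termBKP r μ.1) ∧
    Summable (fun μ : NonzeroPartition => termKP r μ.1) ∧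
    (1 + ∑' μ : NonzeroStrict, termBKP r μ.1) ^ 2 =
      1 + ∑' μ : NonzeroPartition, termKP r μ.1 := by
  have h1 := hasSum_nonzeroStrict hr
  have h2 := hasSum_nonzeroPartition r
  have h3 := formalExpectation_evolKP hr
  refine ⟨(restrictOdd_tauKP r).trans h3, h1.summable, h2.summable, ?_⟩
  rw [h1.tsum_eq, h2.tsum_eq, h3]
  ring
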